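/- **Setting.** Let $(\mathcal D,\wedge,S^0)$ be a pointed closed symmetric monoidal model category with internal Hom objects $\mathrm{Hom}$, and write $[A,B]$ for the set of maps $A\to B$ in $Ho(\mathcal D)$. Let $T$ be a cofibrant object of $\mathcal D$ such that $-\wedge T$ preserves weak equivalences, and put $T^n=T^{\wedge n}$. Assume that $T$ has a *sign*: an automorphism $(-1)_T$ of $T$ in $Ho(\mathcal D)$ with $(-1)_T^2=1$ such that (1) for every $n\ge 1$ and $\tau\in\Sigma_n$ the permutation $\tau\colon T^n\to T^n$ of factors equals $|\tau|_T\wedge T^{n-1}$ in $Ho(\mathcal D)$, where $|\tau|_T=(-1)_T$ if $\tau$ is odd and $|\tau|_T=1$ if $\tau$ is even, and (2) $(-1)_T\wedge T=T\wedge(-1)_T$ in $Ho(\mathcal D)$. Let $i\colon sSet_*\to\mathcal D$ be a (strong) monoidal left Quillen functor with right adjoint $j$. Let $\mathcal B$ be a class of cofibrant objects of $\mathcal D$. Assume that $\mathcal D$ has sequential colimits, that fibrant objects of $\mathcal D$ are closed under sequential colimits, and that $j$, $\mathrm{Hom}(T,-)$ and $\mathrm{Hom}(A,-)$ for all $A\in\mathcal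 B$ preserve sequential colimits. **Spectra.** A *$T$-spectrum* is a sequence $(X_n)_{n\ge 0}$ of objects with maps $\sigma_n\colon X_n\wedge T\to X_{n+1}$. A *symmetric $T$-spectrum* has in addition left actions of $\Sigma_n$ on $X_n$ such that all iterated structure maps $X_n\wedge T^m\to X_{n+m}$ are $\Sigma_n\times\Sigma_m$-equivariant. The categories are $Sp(\mathcal D,T)$ and $Sp^\Sigma(\mathcal D,T)$. For a symmetric spectrum $X$: * $T\wedge X$ has $(T\wedge X)_n=T\wedge X_n$; $\Omega X=\mathrm{Hom}(T,X)$ has $(\Omega X)_n=\mathrm{Hom}(T,X_n)$; $sh\,X$ has $(sh\,X)_n=X_{1+n}$, on which $\gamma\in\Sigma_n$ acts as $1+\gamma\in\Sigma_{1+n}$; and $R=\Omega\circ sh$; * $\lambda_X\colon T\wedge X\to sh\,X$ is $T\wedge X_n\cong X_n\wedge T\xrightarrow{\sigma_n}X_{n+1}\xrightarrow{\chi_{n,1}}X_{1+n}$ in degree $n$, where $\chi_{n,1}$ moves the first $n$ letters past the last one; $\tilde\lambda_X\colon X\to RX$ is its adjoint; * $R^\infty X=\operatorname{colim}_k R^kX$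 along the maps $R^k\tilde\lambda_X$, and $\tilde\lambda^\infty_X\colon X\to R^\infty X$ is the canonical map. A map of spectra is a *level equivalence* (*level fibration*) if it is a weak equivalence (fibration) in every degree. A spectrum $X$ is *level fibrant* if all $X_n$ are fibrant, and an *$\Omega$-spectrum* if it is level fibrant and the adjoint structure maps $\tilde\sigma_n\colon X_n\to\mathrm{Hom}(T,X_{n+1})$ are weak equivalences. The *projective level model structure* has the level equivalences as weak equivalences and the level fibrations as fibrations. For a spectrum $X$, $(\Theta^\infty X)_n=\operatorname{colim}_k\Omega^kX_{n+k}$ along the maps $\Omega^k\tilde\sigma_{n+k}$. A map $f\colon X\to Y$ in $Sp(\mathcal D,T)$ is a *stable equivalence* if it induces bijections $[Y,W]\to[X,W]$ in the level homotopy category for all $\Omega$-spectra $W$. **Stable homotopy.** For $q\in\mathbb Z$, $V\in\mathcal B$ and a $T$-spectrum $X$ let $$\pi_q^V(X)=\operatorname{colim}_{m\ge 0,\ q+m\ge 1}[V\wedge T^{q+m},X_m],\qquad a\mapsto\sigma_m\circ(a\wedge T).$$ A map $f$ is a *$\pi^{\mathcal B}$-stable equivalence* if $\pi_q^V(f)$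 is bijective for all $q\in\mathbb Z$, $V\in\mathcal B$. Let $\mathcal M$ be the monoid of injective self-maps of $\mathbb N$, and let $d\in\mathcal M$, $d(x)=x+1$, be the *cycle operator*. If $X$ is symmetric, $\mathcal M$ acts on $\pi_q^V(X)$: if $x$ is represented by $a\in[V\wedge T^{q+m},X_m]$ and $f\in\mathcal M$, choose $n\ge m$ and $\gamma\in\Sigma_n$ which agrees with $f$ on the first $m$ letters; then $f\cdot x$ is represented by $\gamma\circ a'\circ(V\wedge|\gamma|_T\wedge T^{q+n-1})$, where $a'\in[V\wedge T^{q+n},X_n]$ is the stabilization of $a$. The symmetric spectrum $X$ is *semistable* if $\mathcal M$ acts trivially on $\pi_q^V(X)$ for all $q\in\mathbb Z$, $V\in\mathcal B$. Finally, $\widetilde{\pi_q^V}(X)$ is the collection of natural transformations $Sp^\Sigma(\mathcal D,T)(X,-)\to\pi_q^V$ of functors on the full subcategory of semistable symmetric spectra, and $c_X\colon\pi_q^V(X)\to\widetilde{\pi_q^V}(X)$ sends $x$ to $k\mapsto\pi_q^V(k)(x)$. **Theorem.** For every symmetric $T$-spectrum $X$ in $\mathcal D$ the following are equivalent: * (i)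 $X$ is semistable. * (ii) The cycle operator $d$ acts surjectively on $\pi_q^V(X)$ for all $q\in\mathbb Z$, $V\in\mathcal B$. * (iii) $\lambda_X\colon T\wedge X\to sh\,X$ is a $\pi^{\mathcal B}$-stable equivalence. * (i$'$) $c_X\colon\pi_q^V(X)\to\widetilde{\pi_q^V}(X)$ is a bijection for all $q\in\mathbb Z$, $V\in\mathcal B$. If $X$ is level fibrant, these are also equivalent to each of: * (iv) $\tilde\lambda_X\colon X\to RX$ is a $\pi^{\mathcal B}$-stable equivalence. * (v) $\tilde\lambda_X^\infty\colon X\to R^\infty X$ is a $\pi^{\mathcal B}$-stable equivalence. * (vi) $R^\infty X$ is semistable. Consider further the conditions * (vii) $R^\infty X$ is an $\Omega$-spectrum. * (viii) There is a $\pi^{\mathcal B}$-stable equivalence in $Sp^\Sigma(\mathcal D,T)$ from $X$ to an $\Omega$-spectrum. Assume moreover that * the projective level model structure on $Sp(\mathcal D,T)$ exists, and (a) for every map $f$ in $Sp(\mathcal D,T)$ the following are equivalent: $f$ is a stable equivalence; $\Theta^\infty f'$ is a level equivalence for every level fibrant replacement $f'$ of $f$; $\Theta^\infty f'$ is a level equivalence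 for some level fibrant replacement $f'$ of $f$; (b) countable compositions of stable equivalences in $Sp(\mathcal D,T)$ between level fibrant spectra are stable equivalences; * the projective level model structure on $Sp^\Sigma(\mathcal D,T)$ exists; * the $\pi^{\mathcal B}$-stable equivalences in $Sp(\mathcal D,T)$ are exactly the stable equivalences. Then (i)–(iii) are equivalent to (viii), and if $X$ is level fibrant, all the above conditions are also equivalent to (vii). Without these last assumptions the implications (viii) $\Rightarrow$ (i) and (vii) $\Rightarrow$ (vi) always hold. -/

import Mathlib

open CategoryTheory Limits MonoidalCategory HomotopicalAlgebra

universe w v u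

namespace SemistableSpectra

/-! ### Pointed simplicial sets -/

section PointedSimplicialSets

/-- Two pairs are identified in `X ∧ Y` when they are equal or both lie in `X ∨ Y`. -/
def smashSetoid (X Y : Pointed.{w}) : Setoid (X × Y) where
  r p p' := p = p' ∨ ((p.1 = X.point ∨ p.2 = Y.point) ∧ (p'.1 = X.point ∨ p'.2 = Y.point))
  iseqv := by
    refine ⟨fun _ => Or.inl rfl, ?_, ?_⟩
    · rintro p p' (h | ⟨h, h'⟩)
      exacts [Or.inl h.symm, Or.inr ⟨h', h⟩]
    · rintro p p' p'' (rfl | ⟨h, h'⟩) (rfl | ⟨k, k'⟩)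
      exacts [Or.inl rfl, Or.inr ⟨k, k'⟩, Or.inr ⟨h, h'⟩, Or.inr ⟨h, k'⟩]

/-- The smash product `X ∧ Y = (X × Y) / (X ∨ Y)` of pointed sets. -/
def smash (X Y : Pointed.{w}) : Pointed.{w} :=
  ⟨Quotient (smashSetoid X Y), Quotient.mk _ (X.point, Y.point)⟩

/-- The class `x ∧ y`. -/
def smashMk {X Y : Pointed.{w}} (x : X) (y : Y) : (smash X Y).X :=
  Quotient.mk (smashSetoid X Y) (x, y)

theorem smashMk_left {X Y : Pointed.{w}} (y : Y) :
    smashMk X.point y = (smash X Y).point :=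
  Quotient.sound (Or.inr ⟨Or.inl rfl, Or.inl rfl⟩)

theorem smashMk_right {X Y : Pointed.{w}} (x : X) :
    smashMk x Y.point = (smash X Y).point :=
  Quotient.sound (Or.inr ⟨Or.inr rfl, Or.inl rfl⟩)

/-- A map out of `X ∧ Y` is a map out of `X × Y` that is trivial on `X ∨ Y`. -/
def smashDesc {X Y Z : Pointed.{w}} (f : X → Y → Z) (h₁ : ∀ y, f X.point y = Z.point)
    (h₂ : ∀ x, f x Y.point = Z.point) : smash X Y ⟶ Z :=
  Pointed.Hom.mk
    (Quotient.lift (s := smashSetoid X Y) (fun p => f p.1 p.2) (by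
      rintro ⟨x, y⟩ ⟨x', y'⟩ (h | ⟨h, h'⟩)
      · cases h; rfl
      · have e : ∀ (x : X) (y : Y), (x = X.point ∨ y = Y.point) → f x y = Z.point := by
          rintro x y (rfl | rfl)
          exacts [h₁ _, h₂ _]
        exact (e x y h).trans (e x' y' h').symm))
    (h₁ _)

theorem smash_hom_ext {X Y Z : Pointed.{w}} {f g : smash X Y ⟶ Z}
    (h : ∀ x y, f.toFun (smashMk x y) = g.toFun (smashMk x y)) : f = g :=
  Pointed.Hom.ext (funext fun p => Quotient.inductionOn p fun q => h q.1 q.2)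

/-- The smash product of two pointed maps. -/
def smashMap {X X' Y Y' : Pointed.{w}} (f : X ⟶ X') (g : Y ⟶ Y') : smash X Y ⟶ smash X' Y' :=
  smashDesc (fun x y => smashMk (f.toFun x) (g.toFun y))
    (fun y => by rw [f.map_point, smashMk_left]) (fun x => by rw [g.map_point, smashMk_right])

/-- `(X ∧ Y) ∧ Z → X ∧ (Y ∧ Z)`. -/
def smashAssocHom (X Y Z : Pointed.{w}) : smash (smash X Y) Z ⟶ smash X (smash Y Z) :=
  smashDesc
    (fun p z => (smashDesc (Z := smash X (smash Y Z)) (fun x y => smashMk x (smashMk y z))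
      (fun _ => smashMk_left _) (fun _ => by rw [smashMk_left, smashMk_right])).toFun p)
    (fun z => Pointed.Hom.map_point _)
    (fun p => Quotient.inductionOn p fun q => by
      change smashMk q.1 (smashMk q.2 Z.point) = _
      rw [smashMk_right, smashMk_right])

/-- `X ∧ (Y ∧ Z) → (X ∧ Y) ∧ Z`. -/
def smashAssocInv (X Y Z : Pointed.{w}) : smash X (smash Y Z) ⟶ smash (smash X Y) Z :=
  smashDesc
    (fun x p => (smashDesc (Z := smash (smash X Y) Z) (fun y z => smashMk (smashMk x y) z)
      (fun _ => by rw [smashMk_right, smashMk_left]) (fun _ => smashMk_right _)).toFun p)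
    (fun p => Quotient.inductionOn p fun q => by
      change smashMk (smashMk X.point q.1) q.2 = _
      rw [smashMk_left, smashMk_left])
    (fun x => Pointed.Hom.map_point _)

/-- The pointed set `S⁰`. -/
def zeroSphere : Pointed.{w} := ⟨Option PUnit, none⟩

/-- The symmetric smash product makes pointed sets a monoidal category with unit `S⁰`. -/
instance pointedMonoidal : MonoidalCategory Pointed.{w} where
  tensorObj := smash
  whiskerLeft X _ _ g := smashMap (𝟙 X) g
  whiskerRight f Y := smashMap f (𝟙 Y)
  tensorHom f g := smashMap f g
  tensorUnit := zeroSphere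
  associator X Y Z :=
    { hom := smashAssocHom X Y Z
      inv := smashAssocInv X Y Z
      hom_inv_id := smash_hom_ext fun p _ => Quotient.inductionOn p fun _ => rfl
      inv_hom_id := smash_hom_ext fun _ p => Quotient.inductionOn p fun _ => rfl }
  leftUnitor X :=
    { hom := smashDesc (X := zeroSphere) (fun o x => o.elim X.point (fun _ => x))
        (fun _ => rfl) (fun o => by cases o <;> rfl)
      inv := Pointed.Hom.mk (fun x => smashMk (X := zeroSphere) (some PUnit.unit) x)
        (smashMk_right _)
      hom_inv_id := smash_hom_ext fun o x => by
        cases o with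
        | none => exact (smashMk_right _).trans (smashMk_left (X := zeroSphere) x).symm
        | some a => rfl
      inv_hom_id := rfl }
  rightUnitor X :=
    { hom := smashDesc (Y := zeroSphere) (fun x o => o.elim X.point (fun _ => x))
        (fun o => by cases o <;> rfl) (fun _ => rfl)
      inv := Pointed.Hom.mk (fun x => smashMk (Y := zeroSphere) x (some PUnit.unit))
        (smashMk_left _)
      hom_inv_id := smash_hom_ext fun x o => by
        cases o with
        | none => exact (smashMk_left _).trans (smashMk_right (Y := zeroSphere) x).symm
        | some a => rfl
      inv_hom_id := rfl }
  tensorHom_def _ _ := smash_hom_ext fun _ _ => rfl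
  id_tensorHom_id _ _ := smash_hom_ext fun _ _ => rfl
  tensorHom_comp_tensorHom _ _ _ _ := smash_hom_ext fun _ _ => rfl
  whiskerLeft_id _ _ := smash_hom_ext fun _ _ => rfl
  id_whiskerRight _ _ := smash_hom_ext fun _ _ => rfl
  associator_naturality _ _ _ := smash_hom_ext fun p _ => Quotient.inductionOn p fun _ => rfl
  leftUnitor_naturality f := smash_hom_ext fun o x => by
    cases o with
    | none => exact f.map_point.symm
    | some a => rfl
  rightUnitor_naturality f := smash_hom_ext fun x o => by
    cases o with
    | none => exact f.map_point.symm
    | some a => rfl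
  pentagon _ _ _ _ := smash_hom_ext fun p _ => Quotient.inductionOn p fun q => by
    obtain ⟨q, _⟩ := q
    exact Quotient.inductionOn q fun _ => rfl
  triangle X Y := smash_hom_ext fun p y => Quotient.inductionOn p fun q => by
    obtain ⟨x, o⟩ := q
    cases o with
    | none => exact (smashMk_right x).trans (smashMk_left y).symm
    | some a => rfl

/-- The category of pointed simplicial sets, with the levelwise smash product as monoidal
structure (`CategoryTheory.Monoidal.functorCategoryMonoidal`). -/
abbrev PointedSSet : Type (w + 1) := SimplexCategoryᵒᵖ ⥤ Pointed.{w}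

/-- The underlying simplicial set of a pointed simplicial set. -/
def underlyingSSet : PointedSSet.{w} ⥤ SSet.{w} :=
  (Functor.whiskeringRight SimplexCategoryᵒᵖ Pointed.{w} (Type w)).obj (forget Pointed.{w})

end PointedSimplicialSets


/-! ### Spectra and symmetric spectra -/

section Permutations

/-- `γ + 1 ∈ Σ_{n+1}`: the permutation `γ` on the first `n` letters. -/
def permAddOne {n : ℕ} (γ : Equiv.Perm (Fin n)) : Equiv.Perm (Fin (n + 1)) :=
  finSuccEquivLast.symm.permCongr (Equiv.optionCongr γ)

/-- `1 + γ ∈ Σ_{1+n}`: the permutation `γ` on the last `n` letters. -/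
def permOneAdd {n : ℕ} (γ : Equiv.Perm (Fin n)) : Equiv.Perm (Fin (n + 1)) :=
  (finSuccEquiv n).symm.permCongr (Equiv.optionCongr γ)

/-- The transposition of the last two of `n + 2` letters. -/
def lastSwap (n : ℕ) : Equiv.Perm (Fin (n + 2)) :=
  Equiv.swap (Fin.last n).castSucc (Fin.last (n + 1))

/-- The block permutation `χ_{n,1} ∈ Σ_{n+1}`, which moves the first `n` letters past the
last one: `i ↦ i + 1` for `i < n`, and `n ↦ 0`. -/
def chi (n : ℕ) : Equiv.Perm (Fin (n + 1)) := finRotate (n + 1)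

/-- The block sum `γ + τ ∈ Σ_{n+m}`. -/
def permAdd {n m : ℕ} (γ : Equiv.Perm (Fin n)) (τ : Equiv.Perm (Fin m)) :
    Equiv.Perm (Fin (n + m)) :=
  finSumFinEquiv.permCongr (Equiv.sumCongr γ τ)

@[simp] theorem permAddOne_castSucc {n : ℕ} (γ : Equiv.Perm (Fin n)) (i : Fin n) :
    permAddOne γ i.castSucc = (γ i).castSucc := by
  simp [permAddOne]

@[simp] theorem permAddOne_last {n : ℕ} (γ : Equiv.Perm (Fin n)) :
    permAddOne γ (Fin.last n) = Fin.last n := by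
  simp [permAddOne]

@[simp] theorem permOneAdd_succ {n : ℕ} (γ : Equiv.Perm (Fin n)) (i : Fin n) :
    permOneAdd γ i.succ = (γ i).succ := by
  simp [permOneAdd]

@[simp] theorem permOneAdd_zero {n : ℕ} (γ : Equiv.Perm (Fin n)) :
    permOneAdd γ 0 = 0 := by
  simp [permOneAdd]

@[simp] theorem chi_castSucc {n : ℕ} (i : Fin n) : chi n i.castSucc = i.succ := by
  simp [chi]

@[simp] theorem chi_last (n : ℕ) : chi n (Fin.last n) = 0 := by
  simp [chi]

@[simp] theorem lastSwap_last (n : ℕ) :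
    lastSwap n (Fin.last (n + 1)) = (Fin.last n).castSucc := Equiv.swap_apply_right _ _

@[simp] theorem lastSwap_castSucc_last (n : ℕ) :
    lastSwap n (Fin.last n).castSucc = Fin.last (n + 1) := Equiv.swap_apply_left _ _

@[simp] theorem lastSwap_castSucc_castSucc {n : ℕ} (i : Fin n) :
    lastSwap n i.castSucc.castSucc = i.castSucc.castSucc := by
  apply Equiv.swap_apply_of_ne_of_ne
  · simp [Fin.ext_iff]; omega
  · simp [Fin.ext_iff]; omega

theorem permAddOne_one (n : ℕ) : permAddOne (1 : Equiv.Perm (Fin n)) = 1 := by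
  ext i; refine Fin.lastCases ?_ (fun i => ?_) i <;> simp

theorem permOneAdd_one (n : ℕ) : permOneAdd (1 : Equiv.Perm (Fin n)) = 1 := by
  ext i; refine Fin.cases ?_ (fun i => ?_) i <;> simp

theorem permAddOne_mul {n : ℕ} (γ δ : Equiv.Perm (Fin n)) :
    permAddOne (γ * δ) = permAddOne γ * permAddOne δ := by
  ext i; refine Fin.lastCases ?_ (fun i => ?_) i <;> simp

theorem permOneAdd_mul {n : ℕ} (γ δ : Equiv.Perm (Fin n)) :
    permOneAdd (γ * δ) = permOneAdd γ * permOneAdd δ := by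
  ext i; refine Fin.cases ?_ (fun i => ?_) i <;> simp

theorem permOneAdd_permAddOne {n : ℕ} (γ : Equiv.Perm (Fin n)) :
    permOneAdd (permAddOne γ) = permAddOne (permOneAdd γ) := by
  ext i
  refine Fin.cases ?_ (fun i => ?_) i
  · rw [permOneAdd_zero, ← Fin.castSucc_zero, permAddOne_castSucc, permOneAdd_zero]
  · refine Fin.lastCases ?_ (fun i => ?_) i
    · rw [permOneAdd_succ, permAddOne_last, Fin.succ_last, permAddOne_last]
    · rw [permOneAdd_succ, permAddOne_castSucc, Fin.succ_castSucc, Fin.succ_castSucc,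
        permAddOne_castSucc, permOneAdd_succ]

theorem permOneAdd_lastSwap (n : ℕ) : permOneAdd (lastSwap n) = lastSwap (n + 1) := by
  ext i
  refine Fin.cases ?_ (fun i => ?_) i
  · rw [permOneAdd_zero, ← Fin.castSucc_zero, ← Fin.castSucc_zero, lastSwap_castSucc_castSucc]
  · rw [permOneAdd_succ]
    refine Fin.lastCases ?_ (fun i => ?_) i
    · rw [lastSwap_last, Fin.succ_last, lastSwap_last, Fin.succ_castSucc, Fin.succ_last]
    · refine Fin.lastCases ?_ (fun i => ?_) i
      · rw [lastSwap_castSucc_last, Fin.succ_last, Fin.succ_castSucc, Fin.succ_last,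
          lastSwap_castSucc_last]
      · rw [lastSwap_castSucc_castSucc, Fin.succ_castSucc, Fin.succ_castSucc,
          lastSwap_castSucc_castSucc]

theorem chi_mul_permAddOne {n : ℕ} (γ : Equiv.Perm (Fin n)) :
    chi n * permAddOne γ = permOneAdd γ * chi n := by
  ext i; refine Fin.lastCases ?_ (fun i => ?_) i <;> simp

theorem chi_mul_lastSwap (n : ℕ) : chi (n + 1) * lastSwap n = permAddOne (chi n) := by
  ext i
  refine Fin.lastCases ?_ (fun i => ?_) i
  · simp
  · refine Fin.lastCases ?_ (fun i => ?_) i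
    · rw [Equiv.Perm.mul_apply, lastSwap_castSucc_last, chi_last, permAddOne_castSucc, chi_last,
        Fin.castSucc_zero]
    · rw [Equiv.Perm.mul_apply, lastSwap_castSucc_castSucc, chi_castSucc, permAddOne_castSucc,
        chi_castSucc, Fin.succ_castSucc]

end Permutations

section Spectra

variable {D : Type u} [Category.{v} D] [MonoidalCategory D]

/-- A `T`-spectrum: objects `X_n` and structure maps `σ_n : X_n ∧ T ⟶ X_{n+1}`. -/
structure Spectrum (T : D) where
  obj : ℕ → D
  σ : ∀ n, obj n ⊗ T ⟶ obj (n + 1)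

/-- A map of `T`-spectra. -/
@[ext]
structure Spectrum.Hom {T : D} (X Y : Spectrum T) where
  app : ∀ n, X.obj n ⟶ Y.obj n
  comm : ∀ n, X.σ n ≫ app (n + 1) = app n ▷ T ≫ Y.σ n

instance (T : D) : Category (Spectrum T) where
  Hom := Spectrum.Hom
  id X := { app := fun n => 𝟙 _, comm := fun n => by simp }
  comp f g :=
    { app := fun n => f.app n ≫ g.app n
      comm := fun n => by
        rw [← Category.assoc, f.comm, Category.assoc, g.comm, comp_whiskerRight,
          Category.assoc] }

@[ext]
theorem Spectrum.hom_ext {T : D} {X Y : Spectrum T} {f g : X ⟶ Y}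
    (h : ∀ n, f.app n = g.app n) : f = g :=
  Spectrum.Hom.ext (funext h)

@[simp] theorem Spectrum.id_app {T : D} (X : Spectrum T) (n : ℕ) :
    (𝟙 X : X ⟶ X).app n = 𝟙 _ := rfl

@[simp] theorem Spectrum.comp_app {T : D} {X Y Z : Spectrum T} (f : X ⟶ Y) (g : Y ⟶ Z)
    (n : ℕ) : (f ≫ g).app n = f.app n ≫ g.app n := rfl

/-- `A ∧ T^n`, bracketed as `(⋯((A ∧ T) ∧ T)⋯) ∧ T`. -/
def smashPow (T A : D) : ℕ → D
  | 0 => A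
  | n + 1 => smashPow T A n ⊗ T

/-- The iterated structure map `σ^m : X_n ∧ T^m ⟶ X_{n+m}`. -/
def Spectrum.iterσ {T : D} (X : Spectrum T) (n : ℕ) : ∀ m, smashPow T (X.obj n) m ⟶ X.obj (n + m)
  | 0 => 𝟙 _
  | m + 1 => X.iterσ n m ▷ T ≫ X.σ (n + m)

theorem iterσ_step {T A Y Z : D} {φ : A ⟶ A} {s : A ⟶ Y} {a : Y ⟶ Y} {σ : Y ⊗ T ⟶ Z} {b : Z ⟶ Z}
    (h : φ ≫ s = s ≫ a) (h' : a ▷ T ≫ σ = σ ≫ b) :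
    φ ▷ T ≫ s ▷ T ≫ σ = (s ▷ T ≫ σ) ≫ b := by
  rw [Category.assoc, ← h', ← comp_whiskerRight_assoc, h, comp_whiskerRight_assoc]

variable [SymmetricCategory D]

/-- The symmetry of the last two factors of `(A ∧ T) ∧ T`. -/
def twistLast (T A : D) : (A ⊗ T) ⊗ T ⟶ (A ⊗ T) ⊗ T :=
  (α_ A T T).hom ≫ A ◁ (β_ T T).hom ≫ (α_ A T T).inv

/-- `PermMap T A n τ φ` says that `φ` is the permutation `A ∧ τ` of the `T`-factors of
`A ∧ T^n`. These are the maps of the left action of `Σ_n` for which adjacent transpositions act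
through the symmetry of `T ∧ T`. -/
inductive PermMap (T A : D) :
    ∀ n : ℕ, Equiv.Perm (Fin n) → (smashPow T A n ⟶ smashPow T A n) → Prop
  | one (n : ℕ) : PermMap T A n 1 (𝟙 _)
  | mul {n : ℕ} {γ δ : Equiv.Perm (Fin n)} {φ ψ : smashPow T A n ⟶ smashPow T A n} :
      PermMap T A n γ φ → PermMap T A n δ ψ → PermMap T A n (γ * δ) (ψ ≫ φ)
  | addOne {n : ℕ} {γ : Equiv.Perm (Fin n)} {φ : smashPow T A n ⟶ smashPow T A n} :
      PermMap T A n γ φ → PermMap T A (n + 1) (permAddOne γ) (φ ▷ T)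
  | swap (n : ℕ) : PermMap T A (n + 2) (lastSwap n) (twistLast T (smashPow T A n))

/-- A symmetric `T`-spectrum: a `T`-spectrum with left actions of `Σ_n` on `X_n` such that the
iterated structure maps `X_n ∧ T^m ⟶ X_{n+m}` are `Σ_n × Σ_m`-equivariant. It is enough to ask
this for `σ` itself and for the transposition of `T ∧ T`; the general case is
`SymSpectrum.iterσ_equivariant`. -/
structure SymSpectrum (T : D) extends Spectrum T where
  act : ∀ n, Equiv.Perm (Fin n) → (obj n ⟶ obj n)
  act_one : ∀ n, act n 1 = 𝟙 _
  act_mul : ∀ n (γ δ : Equiv.Perm (Fin n)), act n (γ * δ) = act n δ ≫ act n γ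
  act_σ : ∀ n (γ : Equiv.Perm (Fin n)), act n γ ▷ T ≫ σ n = σ n ≫ act (n + 1) (permAddOne γ)
  twist_σ : ∀ n, twistLast T (obj n) ≫ σ n ▷ T ≫ σ (n + 1) =
    (σ n ▷ T ≫ σ (n + 1)) ≫ act (n + 2) (lastSwap n)

/-- A map of symmetric `T`-spectra. -/
@[ext]
structure SymSpectrum.Hom {T : D} (X Y : SymSpectrum T) where
  app : ∀ n, X.obj n ⟶ Y.obj n
  comm : ∀ n, X.σ n ≫ app (n + 1) = app n ▷ T ≫ Y.σ n
  act_comm : ∀ n γ, X.act n γ ≫ app n = app n ≫ Y.act n γ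

instance (T : D) : Category (SymSpectrum T) where
  Hom := SymSpectrum.Hom
  id X := { app := fun n => 𝟙 _, comm := fun n => by simp, act_comm := fun n γ => by simp }
  comp f g :=
    { app := fun n => f.app n ≫ g.app n
      comm := fun n => by
        rw [← Category.assoc, f.comm, Category.assoc, g.comm, comp_whiskerRight,
          Category.assoc]
      act_comm := fun n γ => by
        rw [← Category.assoc, f.act_comm, Category.assoc, g.act_comm, Category.assoc] }

@[ext]
theorem SymSpectrum.hom_ext {T : D} {X Y : SymSpectrum T} {f g : X ⟶ Y}
    (h : ∀ n, f.app n = g.app n) : f = g :=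
  SymSpectrum.Hom.ext (funext h)

@[simp] theorem SymSpectrum.id_app {T : D} (X : SymSpectrum T) (n : ℕ) :
    (𝟙 X : X ⟶ X).app n = 𝟙 _ := rfl

@[simp] theorem SymSpectrum.comp_app {T : D} {X Y Z : SymSpectrum T} (f : X ⟶ Y) (g : Y ⟶ Z)
    (n : ℕ) : (f ≫ g).app n = f.app n ≫ g.app n := rfl

/-- The underlying `T`-spectrum of a symmetric `T`-spectrum. -/
abbrev forgetSym (T : D) : SymSpectrum T ⥤ Spectrum T where
  obj X := X.toSpectrum
  map f := { app := f.app, comm := f.comm }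

theorem permAdd_one_addOne {n m : ℕ} (γ : Equiv.Perm (Fin n)) (τ : Equiv.Perm (Fin m)) :
    permAdd γ (permAddOne τ) = permAddOne (permAdd γ τ) := by
  ext i
  refine Fin.lastCases ?_ (fun i => ?_) i
  · have : (Fin.last (n + m) : Fin (n + m + 1)) = finSumFinEquiv (Sum.inr (Fin.last m)) := by
      ext; simp
    have h : permAddOne (permAdd γ τ) (Fin.last (n + m)) = Fin.last (n + m) := permAddOne_last _
    change ((permAdd γ (permAddOne τ) (Fin.last (n + m) : Fin (n + m + 1)) : Fin (n + m + 1)) : ℕ) =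
      (permAddOne (permAdd γ τ) (Fin.last (n + m)) : ℕ)
    rw [h, this]
    have h' : permAdd γ (permAddOne τ) (finSumFinEquiv (Sum.inr (Fin.last m))) =
        finSumFinEquiv (Sum.inr (Fin.last m)) := by
      simp only [permAdd, Equiv.permCongr_apply, Equiv.symm_apply_apply, Equiv.sumCongr_apply,
        Sum.map_inr, permAddOne_last]
    exact congrArg Fin.val h'
  · rw [permAddOne_castSucc]
    obtain ⟨k, rfl⟩ := finSumFinEquiv.surjective i
    cases k with
    | inl k =>
      have : (finSumFinEquiv (Sum.inl k) : Fin (n + m)).castSucc =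
        (finSumFinEquiv (Sum.inl k) : Fin (n + (m + 1))) := by ext; simp
      rw [this]; simp [permAdd]
    | inr k =>
      have : (finSumFinEquiv (Sum.inr k) : Fin (n + m)).castSucc =
        (finSumFinEquiv (Sum.inr k.castSucc) : Fin (n + (m + 1))) := by ext; simp
      rw [this]; simp [permAdd]

theorem permAdd_one_lastSwap (n m : ℕ) :
    permAdd (1 : Equiv.Perm (Fin n)) (lastSwap m) = lastSwap (n + m) := by
  ext i
  obtain ⟨k, rfl⟩ := finSumFinEquiv.surjective i
  cases k with
  | inl k =>
    have : (finSumFinEquiv (Sum.inl k) : Fin (n + (m + 2))) =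
        (finSumFinEquiv (Sum.inl k) : Fin (n + m)).castSucc.castSucc := by ext; simp
    conv_rhs => rw [this]
    erw [lastSwap_castSucc_castSucc]
    simp [permAdd]
  | inr k =>
    refine Fin.lastCases ?_ (fun k => ?_) k
    · have : (finSumFinEquiv (Sum.inr (Fin.last (m + 1))) : Fin (n + (m + 2))) =
        Fin.last (n + m + 1) := by ext; simp; rfl
      conv_rhs => rw [this]
      erw [lastSwap_last]
      simp only [permAdd, Equiv.permCongr_apply, Equiv.symm_apply_apply, Equiv.sumCongr_apply,
        Sum.map_inr, lastSwap_last]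
      simp
    · refine Fin.lastCases ?_ (fun k => ?_) k
      · have : (finSumFinEquiv (Sum.inr (Fin.last m).castSucc) : Fin (n + (m + 2))) =
          (Fin.last (n + m)).castSucc := by ext; simp
        conv_rhs => rw [this]
        erw [lastSwap_castSucc_last]
        simp [permAdd]; rfl
      · have : (finSumFinEquiv (Sum.inr k.castSucc.castSucc) : Fin (n + (m + 2))) =
          (finSumFinEquiv (Sum.inr k) : Fin (n + m)).castSucc.castSucc := by ext; simp
        conv_rhs => rw [this]
        erw [lastSwap_castSucc_castSucc]
        simp [permAdd]

theorem permAdd_mul {n m : ℕ} (γ γ' : Equiv.Perm (Fin n)) (τ τ' : Equiv.Perm (Fin m)) :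
    permAdd (γ * γ') (τ * τ') = permAdd γ τ * permAdd γ' τ' := by
  ext i
  obtain ⟨k, rfl⟩ := finSumFinEquiv.surjective i
  cases k <;> simp [permAdd]

theorem twistLast_natural (T : D) {A B : D} (f : A ⟶ B) :
    f ▷ T ▷ T ≫ twistLast T B = twistLast T A ≫ f ▷ T ▷ T := by
  simp only [twistLast, Category.assoc]
  rw [associator_naturality_left_assoc, ← whisker_exchange_assoc, associator_inv_naturality_left]

theorem iterσ_swap {T A Y Z Z' : D} (s : A ⟶ Y) {σ : Y ⊗ T ⟶ Z} {σ' : Z ⊗ T ⟶ Z'} {b : Z' ⟶ Z'}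
    (h : twistLast T Y ≫ σ ▷ T ≫ σ' = (σ ▷ T ≫ σ') ≫ b) :
    twistLast T A ≫ (s ▷ T ≫ σ) ▷ T ≫ σ' = ((s ▷ T ≫ σ) ▷ T ≫ σ') ≫ b := by
  simp only [comp_whiskerRight, Category.assoc] at h ⊢
  rw [← h, ← Category.assoc, ← twistLast_natural, Category.assoc]

theorem permAdd_one_right {n m : ℕ} (γ : Equiv.Perm (Fin n)) :
    permAdd γ (1 : Equiv.Perm (Fin (m + 1))) = permAddOne (permAdd γ (1 : Equiv.Perm (Fin m))) := by
  rw [← permAdd_one_addOne, permAddOne_one]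

/-- The map `γ ∧ T^m` on `A ∧ T^m`. -/
def smashPowMap (T : D) {A B : D} (f : A ⟶ B) : ∀ m, smashPow T A m ⟶ smashPow T B m
  | 0 => f
  | m + 1 => smashPowMap T f m ▷ T

theorem SymSpectrum.iterσ_act {T : D} (X : SymSpectrum T) (n : ℕ) (γ : Equiv.Perm (Fin n)) :
    ∀ m, smashPowMap T (X.act n γ) m ≫ X.iterσ n m = X.iterσ n m ≫ X.act (n + m) (permAdd γ 1)
  | 0 => by
    have : permAdd γ (1 : Equiv.Perm (Fin 0)) = γ := by
      ext i
      obtain ⟨k, rfl⟩ := finSumFinEquiv.surjective i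
      cases k with
      | inl k => simp [permAdd]; rfl
      | inr k => exact k.elim0
    rw [this]
    exact (Category.comp_id _).trans (Category.id_comp _).symm
  | m + 1 => by
    have h := SymSpectrum.iterσ_act X n γ m
    have e : X.act (n + (m + 1)) (permAdd γ 1) = X.act (n + m + 1) (permAddOne (permAdd γ 1)) :=
      congrArg (X.act (n + m + 1)) (permAdd_one_right γ)
    rw [e]
    exact iterσ_step h (X.act_σ _ _)

theorem SymSpectrum.iterσ_permMap {T : D} (X : SymSpectrum T) (n : ℕ) {m : ℕ}
    {τ : Equiv.Perm (Fin m)} {φ : smashPow T (X.obj n) m ⟶ smashPow T (X.obj n) m}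
    (h : PermMap T (X.obj n) m τ φ) :
    φ ≫ X.iterσ n m = X.iterσ n m ≫ X.act (n + m) (permAdd 1 τ) := by
  induction h with
  | one m =>
    have : permAdd (1 : Equiv.Perm (Fin n)) (1 : Equiv.Perm (Fin m)) = 1 := by
      ext i
      obtain ⟨k, rfl⟩ := finSumFinEquiv.surjective i
      cases k <;> simp [permAdd]
    rw [this, X.act_one]; simp
  | mul h₁ h₂ ih₁ ih₂ =>
    rw [show (1 : Equiv.Perm (Fin n)) = 1 * 1 from (mul_one 1).symm, permAdd_mul, X.act_mul,
      Category.assoc, ih₁, ← Category.assoc, ih₂, Category.assoc]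
  | @addOne m τ φ h ih =>
    have e : X.act (n + (m + 1)) (permAdd 1 (permAddOne τ)) =
        X.act (n + m + 1) (permAddOne (permAdd 1 τ)) :=
      congrArg (X.act (n + m + 1)) (permAdd_one_addOne 1 τ)
    rw [e]
    exact iterσ_step ih (X.act_σ _ _)
  | swap m =>
    have e : X.act (n + (m + 2)) (permAdd 1 (lastSwap m)) =
        X.act (n + m + 2) (lastSwap (n + m)) :=
      congrArg (X.act (n + m + 2)) (permAdd_one_lastSwap n m)
    rw [e]
    exact iterσ_swap (X.iterσ n m) (X.twist_σ (n + m))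

/-- The iterated structure maps of a symmetric spectrum are `Σ_n × Σ_m`-equivariant. -/
theorem SymSpectrum.iterσ_equivariant {T : D} (X : SymSpectrum T) (n : ℕ) {m : ℕ}
    (γ : Equiv.Perm (Fin n)) {τ : Equiv.Perm (Fin m)}
    {φ : smashPow T (X.obj n) m ⟶ smashPow T (X.obj n) m} (h : PermMap T (X.obj n) m τ φ) :
    φ ≫ smashPowMap T (X.act n γ) m ≫ X.iterσ n m =
      X.iterσ n m ≫ X.act (n + m) (permAdd γ τ) := by
  have : permAdd γ τ = permAdd γ 1 * permAdd 1 τ := by rw [← permAdd_mul, mul_one, one_mul]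
  rw [this, X.act_mul, X.iterσ_act, ← Category.assoc, X.iterσ_permMap n h, Category.assoc]

end Spectra

section Omega

variable {D : Type u} [Category.{v} D] [MonoidalCategory D] [MonoidalClosed D]

/-- The structure map of `Ω X`: the adjoint `Hom(T, A) ∧ T ⟶ Hom(T, B)` of
`T ∧ Hom(T, A) ∧ T ⟶ A ∧ T ⟶ B`. -/
def omegaσ {T A B : D} (s : A ⊗ T ⟶ B) : (ihom T).obj A ⊗ T ⟶ (ihom T).obj B :=
  MonoidalClosed.curry ((α_ T ((ihom T).obj A) T).inv ≫ (ihom.ev T).app A ▷ T ≫ s)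

theorem omegaσ_natural {T A B A' B' : D} {s : A ⊗ T ⟶ B} {s' : A' ⊗ T ⟶ B'} {a : A ⟶ A'}
    {b : B ⟶ B'} (h : s ≫ b = a ▷ T ≫ s') :
    omegaσ s ≫ (ihom T).map b = (ihom T).map a ▷ T ≫ omegaσ s' := by
  unfold omegaσ
  rw [← MonoidalClosed.curry_natural_right, ← MonoidalClosed.curry_natural_left]
  congr 1
  simp only [Category.assoc]
  rw [associator_inv_naturality_middle_assoc, ← comp_whiskerRight_assoc, ihom.ev_naturality,
    comp_whiskerRight_assoc, h]

theorem curry_omegaσ {T A B C : D} (f : T ⊗ C ⟶ A) (s : A ⊗ T ⟶ B) :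
    MonoidalClosed.curry f ▷ T ≫ omegaσ s =
      MonoidalClosed.curry ((α_ T C T).inv ≫ f ▷ T ≫ s) := by
  unfold omegaσ
  rw [← MonoidalClosed.curry_natural_left]
  congr 1
  rw [associator_inv_naturality_middle_assoc, ← comp_whiskerRight_assoc,
    MonoidalClosed.whiskerLeft_curry_ihom_ev_app]

theorem omegaσ_omegaσ {T A B C : D} (s : A ⊗ T ⟶ B) (s' : B ⊗ T ⟶ C) :
    omegaσ s ▷ T ≫ omegaσ s' = MonoidalClosed.curry
      ((α_ T ((ihom T).obj A ⊗ T) T).inv ≫ (α_ T ((ihom T).obj A) T).inv ▷ T ≫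
        (ihom.ev T).app A ▷ T ▷ T ≫ s ▷ T ≫ s') := by
  conv_lhs => rw [omegaσ, curry_omegaσ]
  simp only [comp_whiskerRight, Category.assoc]

end Omega

section Constructions

variable {D : Type u} [Category.{v} D] [MonoidalCategory D] [SymmetricCategory D]

theorem twistLast_smash (T A B : D) :
    twistLast T (A ⊗ B) ≫ (α_ A B T).hom ▷ T ≫ (α_ A (B ⊗ T) T).hom =
      (α_ A B T).hom ▷ T ≫ (α_ A (B ⊗ T) T).hom ≫ A ◁ twistLast T B := by
  simp only [twistLast, MonoidalCategory.whiskerLeft_comp]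
  monoidal

theorem omega_twist {T W A B C : D} (e : T ⊗ W ⟶ A) {s : A ⊗ T ⟶ B} {s' : B ⊗ T ⟶ C}
    {b : C ⟶ C} (h : twistLast T A ≫ s ▷ T ≫ s' = (s ▷ T ≫ s') ≫ b) :
    T ◁ twistLast T W ≫ (α_ T (W ⊗ T) T).inv ≫ (α_ T W T).inv ▷ T ≫ e ▷ T ▷ T ≫ s ▷ T ≫ s' =
      ((α_ T (W ⊗ T) T).inv ≫ (α_ T W T).inv ▷ T ≫ e ▷ T ▷ T ≫ s ▷ T ≫ s') ≫ b := by
  have h' := twistLast_smash T T W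
  simp only [Category.assoc] at h ⊢
  rw [← h, reassoc_of% (twistLast_natural T e),
    ← cancel_epi ((α_ T W T).hom ▷ T ≫ (α_ T (W ⊗ T) T).hom)]
  simp only [Category.assoc]
  rw [← reassoc_of% h']
  simp

/-- The symmetric spectrum `T ∧ X`, with `(T ∧ X)_n = T ∧ X_n`. -/
def smashT {T : D} (X : SymSpectrum T) : SymSpectrum T where
  obj n := T ⊗ X.obj n
  σ n := (α_ T (X.obj n) T).hom ≫ T ◁ X.σ n
  act n γ := T ◁ X.act n γ
  act_one n := by rw [X.act_one, MonoidalCategory.whiskerLeft_id]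
  act_mul n γ δ := by rw [X.act_mul, MonoidalCategory.whiskerLeft_comp]
  act_σ n γ := by
    rw [associator_naturality_middle_assoc, ← MonoidalCategory.whiskerLeft_comp, X.act_σ,
      MonoidalCategory.whiskerLeft_comp, Category.assoc]
  twist_σ n := by
    have h := congrArg (fun f => T ◁ f) (X.twist_σ n)
    simp only [MonoidalCategory.whiskerLeft_comp, Category.assoc] at h
    simp only [comp_whiskerRight, Category.assoc]
    have e : (T ◁ X.σ n) ▷ T ≫ (α_ T (X.obj (n + 1)) T).hom =
        (α_ T (X.obj n ⊗ T) T).hom ≫ T ◁ X.σ n ▷ T := associator_naturality_middle _ _ _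
    rw [reassoc_of% e, reassoc_of% e, ← h, reassoc_of% (twistLast_smash T T (X.obj n))]

/-- The shift `sh X`, with `(sh X)_n = X_{1+n}`: the object `X_{n+1}` on which `γ ∈ Σ_n` acts as
`1 + γ`. -/
def shObj {T : D} (X : SymSpectrum T) : SymSpectrum T where
  obj n := X.obj (n + 1)
  σ n := X.σ (n + 1)
  act n γ := X.act (n + 1) (permOneAdd γ)
  act_one n := by rw [permOneAdd_one, X.act_one]
  act_mul n γ δ := by rw [permOneAdd_mul, X.act_mul]
  act_σ n γ := by rw [X.act_σ, permOneAdd_permAddOne]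
  twist_σ n := by rw [permOneAdd_lastSwap, X.twist_σ]

/-- The shift functor `sh`. -/
def sh (T : D) : SymSpectrum T ⥤ SymSpectrum T where
  obj X := shObj X
  map f :=
    { app := fun n => f.app (n + 1)
      comm := fun n => f.comm (n + 1)
      act_comm := fun n γ => f.act_comm (n + 1) (permOneAdd γ) }

/-- The components `T ∧ X_n ≅ X_n ∧ T ⟶ X_{n+1} ⟶ X_{1+n}` of `λ_X`; the last map is
`χ_{n,1}`. -/
def lamApp {T : D} (X : SymSpectrum T) (n : ℕ) : T ⊗ X.obj n ⟶ X.obj (n + 1) :=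
  (β_ T (X.obj n)).hom ≫ X.σ n ≫ X.act (n + 1) (chi n)

theorem lamApp_comm {T : D} (X : SymSpectrum T) (n : ℕ) :
    ((α_ T (X.obj n) T).hom ≫ T ◁ X.σ n) ≫ lamApp X (n + 1) =
      lamApp X n ▷ T ≫ X.σ (n + 1) := by
  have h := X.twist_σ n
  have h₁ : X.act (n + 1 + 1) (permAddOne (chi n)) =
      X.act (n + 2) (lastSwap n) ≫ X.act (n + 2) (chi (n + 1)) := by
    rw [← X.act_mul, chi_mul_lastSwap]
  have h₂ : (α_ T (X.obj n) T).hom ≫ (β_ T (X.obj n ⊗ T)).hom =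
      (β_ T (X.obj n)).hom ▷ T ≫ twistLast T (X.obj n) := by
    have := BraidedCategory.hexagon_forward T (X.obj n) T
    rw [twistLast, ← Category.assoc, ← Category.assoc, Iso.eq_comp_inv]
    simp
  unfold lamApp
  simp only [comp_whiskerRight, Category.assoc] at h ⊢
  rw [X.act_σ, h₁, BraidedCategory.braiding_naturality_right_assoc, reassoc_of% h₂,
    reassoc_of% h]

theorem lamApp_act {T : D} (X : SymSpectrum T) (n : ℕ) (γ : Equiv.Perm (Fin n)) :
    T ◁ X.act n γ ≫ lamApp X n = lamApp X n ≫ X.act (n + 1) (permOneAdd γ) := by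
  unfold lamApp
  rw [BraidedCategory.braiding_naturality_right_assoc, ← Category.assoc (X.act n γ ▷ T),
    X.act_σ]
  simp only [Category.assoc]
  rw [← X.act_mul, ← X.act_mul, chi_mul_permAddOne]

/-- The map `λ_X : T ∧ X ⟶ sh X`. -/
def lam {T : D} (X : SymSpectrum T) : smashT X ⟶ (sh T).obj X where
  app n := lamApp X n
  comm n := lamApp_comm X n
  act_comm n γ := lamApp_act X n γ

variable [MonoidalClosed D]

/-- The symmetric spectrum `Ω X = Hom(T, X)`, with `(Ω X)_n = Hom(T, X_n)`. -/
def omegaObj {T : D} (X : SymSpectrum T) : SymSpectrum T where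
  obj n := (ihom T).obj (X.obj n)
  σ n := omegaσ (X.σ n)
  act n γ := (ihom T).map (X.act n γ)
  act_one n := by rw [X.act_one, CategoryTheory.Functor.map_id]
  act_mul n γ δ := by rw [X.act_mul, Functor.map_comp]
  act_σ n γ := (omegaσ_natural (X.act_σ n γ).symm).symm
  twist_σ n := by
    rw [omegaσ_omegaσ, ← MonoidalClosed.curry_natural_left, ← MonoidalClosed.curry_natural_right]
    exact congrArg _ (omega_twist _ (X.twist_σ n))

/-- The functor `Ω = Hom(T, -)` on symmetric spectra. -/
def omega (T : D) : SymSpectrum T ⥤ SymSpectrum T where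
  obj X := omegaObj X
  map f :=
    { app := fun n => (ihom T).map (f.app n)
      comm := fun n => omegaσ_natural (f.comm n)
      act_comm := fun n γ => by
        change (ihom T).map _ ≫ (ihom T).map _ = (ihom T).map _ ≫ (ihom T).map _
        rw [← Functor.map_comp, ← Functor.map_comp, f.act_comm] }
  map_id X := SymSpectrum.hom_ext fun n => (ihom T).map_id _
  map_comp f g := SymSpectrum.hom_ext fun n => (ihom T).map_comp _ _

/-- The functor `R = Ω ∘ sh`. -/
def R (T : D) : SymSpectrum T ⥤ SymSpectrum T := sh T ⋙ omega T

/-- The map `λ̃_X : X ⟶ R X`, adjoint to `λ_X : T ∧ X ⟶ sh X`. -/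
def lamTilde {T : D} (X : SymSpectrum T) : X ⟶ (R T).obj X where
  app n := MonoidalClosed.curry (lamApp X n)
  comm n := by
    change X.σ n ≫ MonoidalClosed.curry (lamApp X (n + 1)) =
      MonoidalClosed.curry (lamApp X n) ▷ T ≫ omegaσ (X.σ (n + 1))
    rw [curry_omegaσ, ← MonoidalClosed.curry_natural_left, ← lamApp_comm]
    simp
  act_comm n γ := by
    change X.act n γ ≫ MonoidalClosed.curry (lamApp X n) =
      MonoidalClosed.curry (lamApp X n) ≫ (ihom T).map (X.act (n + 1) (permOneAdd γ))
    rw [← MonoidalClosed.curry_natural_left, ← MonoidalClosed.curry_natural_right, lamApp_act]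

/-- The iterates `R^k`, with `R^{k+1} X = R^k (R X)`. -/
def Rpow (T : D) : ℕ → (SymSpectrum T ⥤ SymSpectrum T)
  | 0 => 𝟭 _
  | k + 1 => R T ⋙ Rpow T k

/-- The sequence `X ⟶ R X ⟶ R² X ⟶ ⋯` with transition maps `R^k λ̃_X`. -/
def Rseq {T : D} (X : SymSpectrum T) : ℕ ⥤ SymSpectrum T :=
  Functor.ofSequence (X := fun k => (Rpow T k).obj X) (fun k => (Rpow T k).map (lamTilde X))

/-- The adjoint structure map `σ̃_n : X_n ⟶ Ω X_{n+1}`. -/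
def Spectrum.σTilde {T : D} (X : Spectrum T) (n : ℕ) : X.obj n ⟶ (ihom T).obj (X.obj (n + 1)) :=
  MonoidalClosed.curry ((β_ T (X.obj n)).hom ≫ X.σ n)

theorem Spectrum.σTilde_natural {T : D} {X Y : Spectrum T} (f : X ⟶ Y) (n : ℕ) :
    X.σTilde n ≫ (ihom T).map (f.app (n + 1)) = f.app n ≫ Y.σTilde n := by
  unfold Spectrum.σTilde
  rw [← MonoidalClosed.curry_natural_left, ← MonoidalClosed.curry_natural_right,
    BraidedCategory.braiding_naturality_right_assoc, ← f.comm, Category.assoc]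

/-- The iterates `Ω^k` on `D`, with `Ω^{k+1} A = Ω^k (Ω A)`. -/
def omegaPow (T : D) : ℕ → (D ⥤ D)
  | 0 => 𝟭 _
  | k + 1 => ihom T ⋙ omegaPow T k

/-- The sequence `X_n ⟶ Ω X_{n+1} ⟶ Ω² X_{n+2} ⟶ ⋯` with transition maps `Ω^k σ̃_{n+k}`, whose
colimit is `(Θ^∞ X)_n`. -/
def thetaSeq {T : D} (X : Spectrum T) (n : ℕ) : ℕ ⥤ D :=
  Functor.ofSequence (X := fun k => (omegaPow T k).obj (X.obj (n + k)))
    (fun k => (omegaPow T k).map (X.σTilde (n + k)))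

theorem thetaSeq_map_succ {T : D} (X : Spectrum T) (n k : ℕ) :
    (thetaSeq X n).map (homOfLE (Nat.le_add_right k 1)) =
      (omegaPow T k).map (X.σTilde (n + k)) :=
  Functor.ofSequence_map_homOfLE_succ _ _

/-- The map of sequences induced by a map of spectra. -/
def thetaSeqMap {T : D} {X Y : Spectrum T} (f : X ⟶ Y) (n : ℕ) : thetaSeq X n ⟶ thetaSeq Y n :=
  NatTrans.ofSequence (F := thetaSeq X n) (G := thetaSeq Y n)
    (fun k => (omegaPow T k).map (f.app (n + k))) (fun k => by
      rw [thetaSeq_map_succ, thetaSeq_map_succ]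
      change (omegaPow T k).map (X.σTilde (n + k)) ≫
          (omegaPow T k).map ((ihom T).map (f.app (n + k + 1))) =
        (omegaPow T k).map (f.app (n + k)) ≫ (omegaPow T k).map (Y.σTilde (n + k))
      rw [← Functor.map_comp, ← Functor.map_comp, Spectrum.σTilde_natural])

/-- The map `(Θ^∞ f)_n : (Θ^∞ X)_n ⟶ (Θ^∞ Y)_n`. -/
noncomputable def thetaInfMap [HasColimitsOfShape ℕ D] {T : D} {X Y : Spectrum T} (f : X ⟶ Y)
    (n : ℕ) : colimit (thetaSeq X n) ⟶ colimit (thetaSeq Y n) :=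
  colimMap (thetaSeqMap f n)

end Constructions

section Colimits

variable {D : Type u} [Category.{v} D] [MonoidalCategory D] [SymmetricCategory D]

/-- Evaluation of symmetric spectra in degree `n`. -/
def SymSpectrum.ev (T : D) (n : ℕ) : SymSpectrum T ⥤ D where
  obj X := X.obj n
  map f := f.app n

variable {J : Type w} [Category.{w} J] {T : D}

theorem cocone_app_w {F : J ⥤ SymSpectrum T} (s : Cocone F) (n : ℕ) (i j : J) (φ : i ⟶ j) :
    (F.map φ).app n ≫ (s.ι.app j).app n = (s.ι.app i).app n :=
  congrArg (fun f => SymSpectrum.Hom.app f n) (s.w φ)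

variable [HasColimitsOfShape J D]

/-- The colimit of the objects in degree `n`. -/
noncomputable def colimObj (F : J ⥤ SymSpectrum T) (n : ℕ) : D :=
  colimit (F ⋙ SymSpectrum.ev T n)

/-- The map from one of the objects in degree `n` to their colimit. -/
noncomputable def colimIncl (F : J ⥤ SymSpectrum T) (n : ℕ) (j : J) :
    (F.obj j).obj n ⟶ colimObj F n :=
  colimit.ι (F ⋙ SymSpectrum.ev T n) j

theorem colimIncl_w (F : J ⥤ SymSpectrum T) (n : ℕ) {i j : J} (f : i ⟶ j) :
    (F.map f).app n ≫ colimIncl F n j = colimIncl F n i :=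
  colimit.w (F ⋙ SymSpectrum.ev T n) f

theorem colim_ext (F : J ⥤ SymSpectrum T) (n : ℕ) {A : D} {f g : colimObj F n ⟶ A}
    (h : ∀ j, colimIncl F n j ≫ f = colimIncl F n j ≫ g) : f = g :=
  colimit.hom_ext h

theorem colim_whisker_ext [PreservesColimitsOfShape J (tensorRight T)]
    (F : J ⥤ SymSpectrum T) (n : ℕ) {A : D} {f g : colimObj F n ⊗ T ⟶ A}
    (h : ∀ j, colimIncl F n j ▷ T ≫ f = colimIncl F n j ▷ T ≫ g) : f = g :=
  (isColimitOfPreserves (tensorRight T)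
    (colimit.isColimit (F ⋙ SymSpectrum.ev T n))).hom_ext h

theorem colim_whisker₂_ext [PreservesColimitsOfShape J (tensorRight T)]
    (F : J ⥤ SymSpectrum T) (n : ℕ) {A : D} {f g : (colimObj F n ⊗ T) ⊗ T ⟶ A}
    (h : ∀ j, colimIncl F n j ▷ T ▷ T ≫ f = colimIncl F n j ▷ T ▷ T ≫ g) : f = g :=
  (isColimitOfPreserves (tensorRight T) (isColimitOfPreserves (tensorRight T)
    (colimit.isColimit (F ⋙ SymSpectrum.ev T n)))).hom_ext h

/-- The map out of the colimit in degree `n` given by a compatible family. -/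
noncomputable def colimDesc (F : J ⥤ SymSpectrum T) (n : ℕ) {A : D}
    (f : ∀ j, (F.obj j).obj n ⟶ A) (h : ∀ i j (φ : i ⟶ j), (F.map φ).app n ≫ f j = f i) :
    colimObj F n ⟶ A :=
  colimit.desc (F ⋙ SymSpectrum.ev T n)
    (Cocone.mk A { app := f, naturality := fun _ _ φ => (h _ _ φ).trans (Category.comp_id _).symm })

theorem colimIncl_desc (F : J ⥤ SymSpectrum T) (n : ℕ) {A : D}
    (f : ∀ j, (F.obj j).obj n ⟶ A) (h : ∀ i j (φ : i ⟶ j), (F.map φ).app n ≫ f j = f i)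
    (j : J) : colimIncl F n j ≫ colimDesc F n f h = f j :=
  colimit.ι_desc _ _

/-- The structure maps of the degreewise colimit. -/
noncomputable def colimσ [PreservesColimitsOfShape J (tensorRight T)]
    (F : J ⥤ SymSpectrum T) (n : ℕ) : colimObj F n ⊗ T ⟶ colimObj F (n + 1) :=
  (isColimitOfPreserves (tensorRight T)
    (colimit.isColimit (F ⋙ SymSpectrum.ev T n))).desc (Cocone.mk (colimObj F (n + 1))
    { app := fun j => (F.obj j).σ n ≫ colimIncl F (n + 1) j
      naturality := fun i j f => by
        have h : (F.map f).app n ▷ T ≫ (F.obj j).σ n ≫ colimIncl F (n + 1) j =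
            (F.obj i).σ n ≫ colimIncl F (n + 1) i := by
          rw [← Category.assoc, ← (F.map f).comm n, Category.assoc, colimIncl_w]
        exact h.trans (Category.comp_id _).symm })

theorem colimIncl_σ [PreservesColimitsOfShape J (tensorRight T)]
    (F : J ⥤ SymSpectrum T) (n : ℕ) (j : J) :
    colimIncl F n j ▷ T ≫ colimσ F n = (F.obj j).σ n ≫ colimIncl F (n + 1) j :=
  (isColimitOfPreserves (tensorRight T)
    (colimit.isColimit (F ⋙ SymSpectrum.ev T n))).fac _ j

/-- The action of `Σ_n` on the degreewise colimit. -/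
noncomputable def colimAct (F : J ⥤ SymSpectrum T) (n : ℕ) (γ : Equiv.Perm (Fin n)) :
    colimObj F n ⟶ colimObj F n :=
  colimDesc F n (fun j => (F.obj j).act n γ ≫ colimIncl F n j) (fun _ _ φ => by
    rw [← Category.assoc, ← (F.map φ).act_comm, Category.assoc, colimIncl_w])

theorem colimIncl_act (F : J ⥤ SymSpectrum T) (n : ℕ) (γ : Equiv.Perm (Fin n)) (j : J) :
    colimIncl F n j ≫ colimAct F n γ = (F.obj j).act n γ ≫ colimIncl F n j :=
  colimIncl_desc _ _ _ _ _

/-- The colimit of a diagram of symmetric spectra, formed degreewise. -/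
noncomputable def colimSpectrum [PreservesColimitsOfShape J (tensorRight T)]
    (F : J ⥤ SymSpectrum T) : SymSpectrum T where
  obj n := colimObj F n
  σ n := colimσ F n
  act n γ := colimAct F n γ
  act_one n := colim_ext F n fun j => by
    rw [colimIncl_act, (F.obj j).act_one, Category.comp_id, Category.id_comp]
  act_mul n γ δ := colim_ext F n fun j => by
    rw [colimIncl_act, ← Category.assoc, colimIncl_act, Category.assoc, colimIncl_act,
      (F.obj j).act_mul, Category.assoc]
  act_σ n γ := colim_whisker_ext F n fun j => by
    rw [← comp_whiskerRight_assoc, colimIncl_act, ← Category.assoc, colimIncl_σ, Category.assoc,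
      colimIncl_act, comp_whiskerRight_assoc, colimIncl_σ, ← Category.assoc, (F.obj j).act_σ,
      Category.assoc]
  twist_σ n := colim_whisker₂_ext F n fun j => by
    have h := (F.obj j).twist_σ n
    simp only [Category.assoc] at h
    rw [← Category.assoc, twistLast_natural, Category.assoc, ← comp_whiskerRight_assoc,
      colimIncl_σ, comp_whiskerRight_assoc, colimIncl_σ, Category.assoc,
      ← comp_whiskerRight_assoc, colimIncl_σ, comp_whiskerRight_assoc,
      reassoc_of% (colimIncl_σ F (n + 1) j), colimIncl_act]
    exact (reassoc_of% h) _

/-- The colimit cocone on `colimSpectrum F`. -/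
noncomputable def colimCocone [PreservesColimitsOfShape J (tensorRight T)]
    (F : J ⥤ SymSpectrum T) : Cocone F where
  pt := colimSpectrum F
  ι :=
    { app := fun j =>
        { app := fun n => colimIncl F n j
          comm := fun n => (colimIncl_σ F n j).symm
          act_comm := fun n γ => (colimIncl_act F n γ j).symm }
      naturality := fun _ _ f => SymSpectrum.hom_ext fun n =>
        (colimIncl_w F n f).trans (Category.comp_id _).symm }

/-- The degreewise colimit is the colimit in the category of symmetric spectra. -/
noncomputable def colimCoconeIsColimit [PreservesColimitsOfShape J (tensorRight T)]
    (F : J ⥤ SymSpectrum T) : IsColimit (colimCocone F) where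
  desc s :=
    { app := fun n => colimDesc F n (fun j => (s.ι.app j).app n) (cocone_app_w s n)
      comm := fun n => colim_whisker_ext F n fun j => by
        have h : (F.obj j).σ n ≫ (s.ι.app j).app (n + 1) = (s.ι.app j).app n ▷ T ≫ s.pt.σ n :=
          (s.ι.app j).comm n
        change _ ▷ T ≫ colimσ F n ≫ colimDesc F (n + 1) _ _ = _ ▷ T ≫ colimDesc F n _ _ ▷ T ≫ _
        rw [reassoc_of% (colimIncl_σ F n j), ← comp_whiskerRight_assoc, colimIncl_desc,
          colimIncl_desc]
        exact h
      act_comm := fun n γ => colim_ext F n fun j => by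
        have h : (F.obj j).act n γ ≫ (s.ι.app j).app n = (s.ι.app j).app n ≫ s.pt.act n γ :=
          (s.ι.app j).act_comm n γ
        change _ ≫ colimAct F n γ ≫ colimDesc F n _ _ = _ ≫ colimDesc F n _ _ ≫ _
        rw [reassoc_of% (colimIncl_act F n γ j), colimIncl_desc, ← Category.assoc,
          colimIncl_desc]
        exact h }
  fac s j := SymSpectrum.hom_ext fun n =>
    colimIncl_desc F n (A := s.pt.obj n) (fun j => (s.ι.app j).app n) (cocone_app_w s n) j
  uniq s m h := SymSpectrum.hom_ext fun n => colim_ext F n fun j => by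
    have h₁ : colimIncl F n j ≫ m.app n = (s.ι.app j).app n :=
      congrArg (fun f => SymSpectrum.Hom.app f n) (h j)
    have h₂ := colimIncl_desc F n (A := s.pt.obj n) (fun j => (s.ι.app j).app n) (cocone_app_w s n) j
    exact h₁.trans h₂.symm

theorem tensorRight_preserves (J : Type w) [Category.{w} J] [MonoidalClosed D] (T : D) :
    PreservesColimitsOfShape J (tensorRight T) :=
  preservesColimitsOfShape_of_natIso (BraidedCategory.tensorLeftIsoTensorRight T)

/-- The symmetric spectrum `R^∞ X`, the colimit of `X ⟶ R X ⟶ R² X ⟶ ⋯`. -/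
noncomputable def Rinf [MonoidalClosed D] [HasColimitsOfShape ℕ D] (X : SymSpectrum T) :
    SymSpectrum T :=
  haveI := tensorRight_preserves ℕ T
  colimSpectrum (Rseq X)

/-- The map `λ̃_X^∞ : X ⟶ R^∞ X`. -/
noncomputable def lamTildeInf [MonoidalClosed D] [HasColimitsOfShape ℕ D] (X : SymSpectrum T) :
    X ⟶ Rinf X :=
  haveI := tensorRight_preserves ℕ T
  (colimCocone (Rseq X)).ι.app 0

end Colimits

/-! ### Monoidal model categories and their homotopy categories -/

section ModelCategories

variable (D : Type u) [Category.{v} D] [MonoidalCategory D] [ModelCategory D]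

/-- The compatibility axioms of a monoidal model category: the pushout product axiom and the unit
axiom. -/
class MonoidalModel : Prop where
  cofibration_pushoutProduct {A B A' B' : D} (f : A ⟶ B) (g : A' ⟶ B') [Cofibration f]
    [Cofibration g] (sq : (curriedTensor D).PushoutObjObj f g) : Cofibration sq.ι
  weakEquivalence_pushoutProduct {A B A' B' : D} (f : A ⟶ B) (g : A' ⟶ B') [Cofibration f]
    [Cofibration g] (h : WeakEquivalence f ∨ WeakEquivalence g)
    (sq : (curriedTensor D).PushoutObjObj f g) : WeakEquivalence sq.ι
  unit {Q : D} (q : Q ⟶ 𝟙_ D) [IsCofibrant Q] [WeakEquivalence q] (X : D) [IsCofibrant X] :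
    WeakEquivalence (q ▷ X) ∧ WeakEquivalence (X ◁ q)

variable {D}

/-- The standing assumptions on the circle `T`: it is cofibrant and `- ∧ T` preserves weak
equivalences. -/
class IsCircle (T : D) : Prop where
  isCofibrant : IsCofibrant T
  weakEquivalence_whiskerRight {A B : D} (f : A ⟶ B) [WeakEquivalence f] : WeakEquivalence (f ▷ T)

variable (D) in
/-- The localization functor `D ⥤ Ho(D)`; `[A, B]` is the set of maps
`(toHo D).obj A ⟶ (toHo D).obj B`. -/
abbrev toHo : D ⥤ (weakEquivalences D).Localization := (weakEquivalences D).Q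

/-- The functor `- ∧ T`, as a functor that preserves weak equivalences. -/
def smashRightMorphism (T : D) [IsCircle T] :
    LocalizerMorphism (weakEquivalences D) (weakEquivalences D) where
  functor := tensorRight T
  map _ _ f hf := by
    have : WeakEquivalence f := ⟨hf⟩
    exact (IsCircle.weakEquivalence_whiskerRight (T := T) f).mem

/-- The map `φ ∧ T` in `Ho(D)`. -/
noncomputable def hoSmashRight (T : D) [IsCircle T] {A B : D}
    (φ : (toHo D).obj A ⟶ (toHo D).obj B) : (toHo D).obj (A ⊗ T) ⟶ (toHo D).obj (B ⊗ T) :=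
  (smashRightMorphism T).homMap (toHo D) (toHo D) φ

theorem hoSmashRight_map (T : D) [IsCircle T] {A B : D} (f : A ⟶ B) :
    hoSmashRight T ((toHo D).map f) = (toHo D).map (f ▷ T) :=
  (smashRightMorphism T).homMap_map (toHo D) (toHo D) f

theorem hoSmashRight_comp (T : D) [IsCircle T] {A B C : D}
    (φ : (toHo D).obj A ⟶ (toHo D).obj B) (ψ : (toHo D).obj B ⟶ (toHo D).obj C) :
    hoSmashRight T (φ ≫ ψ) = hoSmashRight T φ ≫ hoSmashRight T ψ :=
  (smashRightMorphism T).homMap_comp (toHo D) (toHo D) φ ψ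

variable [SymmetricCategory D] [MonoidalClosed D]

theorem weakEquivalence_whiskerLeft_of_cofibration [MonoidalModel D] (V : D) [IsCofibrant V]
    {A B : D} (f : A ⟶ B) [Cofibration f] [WeakEquivalence f] : WeakEquivalence (V ◁ f) := by
  have hA : PreservesColimitsOfShape (Discrete PEmpty.{1}) ((curriedTensor D).flip.obj A) :=
    preservesColimitsOfShape_of_natIso (BraidedCategory.tensorLeftIsoTensorRight A)
  have hB : PreservesColimitsOfShape (Discrete PEmpty.{1}) ((curriedTensor D).flip.obj B) :=
    preservesColimitsOfShape_of_natIso (BraidedCategory.tensorLeftIsoTensorRight B)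
  exact MonoidalModel.weakEquivalence_pushoutProduct (initial.to V) f (Or.inr inferInstance)
    (Functor.PushoutObjObj.ofIsInitialLeft (curriedTensor D) (initial.to V) f initialIsInitial)

theorem weakEquivalence_whiskerLeft [MonoidalModel D] (V : D) [IsCofibrant V]
    {A B : D} (f : A ⟶ B) [IsCofibrant A] [IsCofibrant B] [WeakEquivalence f] :
    WeakEquivalence (V ◁ f) := by
  obtain ⟨h⟩ : Nonempty (CofibrantBrownFactorization f) := inferInstance
  have h₁ : WeakEquivalence (V ◁ h.s ≫ V ◁ h.p) := by
    rw [← MonoidalCategory.whiskerLeft_comp, h.s_p, MonoidalCategory.whiskerLeft_id]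
    infer_instance
  have : Cofibration h.i := inferInstance
  have : WeakEquivalence (V ◁ h.s) := weakEquivalence_whiskerLeft_of_cofibration V h.s
  have : WeakEquivalence (V ◁ h.i) := weakEquivalence_whiskerLeft_of_cofibration V h.i
  have : WeakEquivalence (V ◁ h.p) := weakEquivalence_of_precomp (V ◁ h.s) (V ◁ h.p)
  rw [← h.fac, MonoidalCategory.whiskerLeft_comp]
  infer_instance

/-- The functor `V ∧ -` for a cofibrant object `V`, as a functor that preserves weak equivalences
between cofibrant objects. -/
def smashLeftMorphism [MonoidalModel D] (V : D) [IsCofibrant V] :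
    LocalizerMorphism (weakEquivalences (CofibrantObject D)) (weakEquivalences D) where
  functor := CofibrantObject.ι ⋙ tensorLeft V
  map _ _ f hf := by
    have : WeakEquivalence f.hom := ⟨hf⟩
    exact (weakEquivalence_whiskerLeft V f.hom).mem

/-- The map `V ∧ φ` in `Ho(D)`, for cofibrant objects. -/
noncomputable def hoSmashLeft [MonoidalModel D] (V : D) [IsCofibrant V] {A B : D} [IsCofibrant A]
    [IsCofibrant B] (φ : (toHo D).obj A ⟶ (toHo D).obj B) :
    (toHo D).obj (V ⊗ A) ⟶ (toHo D).obj (V ⊗ B) :=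
  (smashLeftMorphism V).homMap (X := CofibrantObject.mk A) (Y := CofibrantObject.mk B)
    (CofibrantObject.ι ⋙ toHo D) (toHo D) φ

/-- The map `φ ∧ T^n` on `(A ∧ T) ∧ T^n` in `Ho(D)`. -/
noncomputable def firstFactor (T A : D) [IsCircle T]
    (φ : (toHo D).obj (A ⊗ T) ⟶ (toHo D).obj (A ⊗ T)) :
    ∀ n, (toHo D).obj (smashPow T A (n + 1)) ⟶ (toHo D).obj (smashPow T A (n + 1))
  | 0 => φ
  | n + 1 => hoSmashRight T (firstFactor T A φ n)

instance (T : D) [IsCircle T] : IsCofibrant T := IsCircle.isCofibrant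

/-- The sign `|τ|_T` of a permutation, for a given involution `s = (-1)_T`. -/
noncomputable def permSign {T : D} (s : (toHo D).obj T ⟶ (toHo D).obj T) {n : ℕ}
    (τ : Equiv.Perm (Fin n)) : (toHo D).obj T ⟶ (toHo D).obj T :=
  if Equiv.Perm.sign τ = -1 then s else 𝟙 _

/-- A sign of `T`: an involution `(-1)_T` of `T` in `Ho(D)` such that every permutation `τ` of the
factors of `T^n` is `|τ|_T ∧ T^{n-1}` in `Ho(D)`, and `(-1)_T ∧ T = T ∧ (-1)_T`. Here `T^n` is
written `S⁰ ∧ T^n`. -/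
structure CircleSign [MonoidalModel D] (T : D) [IsCircle T] where
  hom : (toHo D).obj T ⟶ (toHo D).obj T
  hom_hom : hom ≫ hom = 𝟙 _
  perm (n : ℕ) (τ : Equiv.Perm (Fin (n + 1)))
    (φ : smashPow T (𝟙_ D) (n + 1) ⟶ smashPow T (𝟙_ D) (n + 1))
    (h : PermMap T (𝟙_ D) (n + 1) τ φ) :
    (toHo D).map φ = firstFactor T (𝟙_ D)
      ((toHo D).map (λ_ T).hom ≫ permSign hom τ ≫ (toHo D).map (λ_ T).inv) n
  twist : hoSmashRight T hom = hoSmashLeft T hom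

end ModelCategories

/-! ### Stable homotopy groups and the action of the injection monoid -/

section StableHomotopy

variable {D : Type u} [Category.{v} D] [MonoidalCategory D] [ModelCategory D]
  {T : D} [IsCircle T]

/-- A representative of an element of `π_q^V(X)`: an element of `[V ∧ T^{q+m}, X_m]` with
`q + m ≥ 1`. The exponent `q + m` is written `dim + 1`. -/
structure StableRep (q : ℤ) (V : D) (X : Spectrum T) where
  level : ℕ
  dim : ℕ
  dim_eq : (dim : ℤ) + 1 = q + level
  map : (toHo D).obj (smashPow T V (dim + 1)) ⟶ (toHo D).obj (X.obj level)

/-- The stabilization `[V ∧ T^{q+m}, X_m] ⟶ [V ∧ T^{q+m+1}, X_{m+1}]`, `a ↦ σ_m ∘ (a ∧ T)`. -/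
noncomputable def StableRep.stab {q : ℤ} {V : D} {X : Spectrum T} (r : StableRep q V X) :
    StableRep q V X where
  level := r.level + 1
  dim := r.dim + 1
  dim_eq := by have := r.dim_eq; push_cast; omega
  map := hoSmashRight T r.map ≫ (toHo D).map (X.σ r.level)

/-- The composition of a representative with a map of spectra. -/
noncomputable def StableRep.comp {q : ℤ} {V : D} {X Y : Spectrum T} (f : X ⟶ Y)
    (r : StableRep q V X) : StableRep q V Y where
  level := r.level
  dim := r.dim
  dim_eq := r.dim_eq
  map := r.map ≫ (toHo D).map (f.app r.level)

theorem StableRep.comp_stab {q : ℤ} {V : D} {X Y : Spectrum T} (f : X ⟶ Y)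
    (r : StableRep q V X) : r.stab.comp f = (r.comp f).stab := by
  have h : (hoSmashRight T r.map ≫ (toHo D).map (X.σ r.level)) ≫ (toHo D).map (f.app (r.level + 1)) =
      hoSmashRight T (r.map ≫ (toHo D).map (f.app r.level)) ≫ (toHo D).map (Y.σ r.level) := by
    rw [hoSmashRight_comp, hoSmashRight_map, Category.assoc, Category.assoc, ← Functor.map_comp,
      ← Functor.map_comp, f.comm]
  exact congrArg (StableRep.mk (r.level + 1) (r.dim + 1) r.stab.dim_eq) h

/-- The stable homotopy group `π_q^V(X) = colim_m [V ∧ T^{q+m}, X_m]`, as a set. -/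
def StablePi (q : ℤ) (V : D) (X : Spectrum T) : Type _ :=
  Quot (fun r r' : StableRep q V X => r' = r.stab)

/-- The class of a representative. -/
def StableRep.cls {q : ℤ} {V : D} {X : Spectrum T} (r : StableRep q V X) : StablePi q V X :=
  Quot.mk _ r

/-- The map `π_q^V(f)`. -/
noncomputable def StablePi.map (q : ℤ) (V : D) {X Y : Spectrum T} (f : X ⟶ Y) :
    StablePi q V X → StablePi q V Y :=
  Quot.map (StableRep.comp f) (fun r _ h => h ▸ StableRep.comp_stab f r)

theorem StablePi.map_comp (q : ℤ) (V : D) {X Y Z : Spectrum T} (f : X ⟶ Y) (g : Y ⟶ Z)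
    (x : StablePi q V X) : StablePi.map q V (f ≫ g) x = StablePi.map q V g (StablePi.map q V f x) := by
  induction x using Quot.ind with
  | mk r =>
    have h : r.map ≫ (toHo D).map (f.app r.level ≫ g.app r.level) =
        (r.map ≫ (toHo D).map (f.app r.level)) ≫ (toHo D).map (g.app r.level) := by
      rw [Functor.map_comp, Category.assoc]
    exact congrArg (fun m => Quot.mk _ (StableRep.mk r.level r.dim r.dim_eq m)) h

variable [SymmetricCategory D] [MonoidalClosed D] [MonoidalModel D]

/-- For `a ∈ [V ∧ T^{q+m}, X_m]` and `γ ∈ Σ_m`, the element `γ ∘ a ∘ (V ∧ |γ|_T ∧ T^{q+m-1})`. -/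
noncomputable def StableRep.perm (s : CircleSign T) {q : ℤ} {V : D} [IsCofibrant V]
    {X : SymSpectrum T} (r : StableRep q V X.toSpectrum) (γ : Equiv.Perm (Fin r.level)) :
    StableRep q V X.toSpectrum where
  level := r.level
  dim := r.dim
  dim_eq := r.dim_eq
  map := firstFactor T V (hoSmashLeft V (permSign s.hom γ)) r.dim ≫ r.map ≫
    (toHo D).map (X.act r.level γ)

/-- The graph of the action of the injection monoid `M` of `ℕ` on `π_q^V(X)`:
`InjAct s q V X f x y` says that `f · x = y`. If `a ∈ [V ∧ T^{q+m}, X_m]` represents `x`, then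
`f · x` is represented by `γ ∘ σ^j(a ∧ T^j) ∘ (V ∧ |γ|_T ∧ T^{q+m+j-1})`, for any `j` and any
`γ ∈ Σ_{m+j}` which agrees with `f` on the first `m` letters. -/
def InjAct (s : CircleSign T) (q : ℤ) (V : D) [IsCofibrant V] (X : SymSpectrum T) (f : ℕ ↪ ℕ)
    (x y : StablePi q V X.toSpectrum) : Prop :=
  ∃ (r : StableRep q V X.toSpectrum) (j : ℕ) (γ : Equiv.Perm (Fin (StableRep.stab^[j] r).level)),
    (∀ i : Fin (StableRep.stab^[j] r).level, (i : ℕ) < r.level → (γ i : ℕ) = f i) ∧ r.cls = x ∧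
      (StableRep.perm s (StableRep.stab^[j] r) γ).cls = y

/-- The cycle operator `d : i ↦ i + 1`. -/
def cycleOp : ℕ ↪ ℕ := ⟨(· + 1), fun _ _ h => Nat.succ.inj h⟩

variable (B : ObjectProperty (CofibrantObject D))

/-- A symmetric spectrum is semistable if `M` acts trivially on all `π_q^V(X)` with `V ∈ B`. -/
def Semistable (s : CircleSign T) (X : SymSpectrum T) : Prop :=
  ∀ V, B V → ∀ (q : ℤ) (f : ℕ ↪ ℕ) (x y : StablePi q V.obj X.toSpectrum),
    InjAct s q V.obj X f x y → y = x

/-- The cycle operator acts surjectively on all `π_q^V(X)` with `V ∈ B`. -/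
def CycleSurjective (s : CircleSign T) (X : SymSpectrum T) : Prop :=
  ∀ V, B V → ∀ (q : ℤ) (y : StablePi q V.obj X.toSpectrum), ∃ x, InjAct s q V.obj X cycleOp x y

/-- A `π^B`-stable equivalence. -/
def PiEquiv {X Y : Spectrum T} (f : X ⟶ Y) : Prop :=
  ∀ V, B V → ∀ q : ℤ, Function.Bijective (StablePi.map q V.obj f)

/-- `π̃_q^V(X)`: the natural transformations from `Hom(X, -)` to `π_q^V`, as functors on the full
subcategory of semistable symmetric spectra. -/
def TruePi (s : CircleSign T) (q : ℤ) (V : D) (X : SymSpectrum T) :=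
  { g : ∀ Y : SymSpectrum T, Semistable B s Y → (X ⟶ Y) → StablePi q V Y.toSpectrum //
    ∀ (Y Z : SymSpectrum T) (hY : Semistable B s Y) (hZ : Semistable B s Z) (k : X ⟶ Y)
      (h : Y ⟶ Z), g Z hZ (k ≫ h) = StablePi.map q V ((forgetSym T).map h) (g Y hY k) }

/-- The map `c_X : π_q^V(X) ⟶ π̃_q^V(X)`, `x ↦ (k ↦ π_q^V(k)(x))`. -/
noncomputable def trueMap (s : CircleSign T) (q : ℤ) (V : D) (X : SymSpectrum T)
    (x : StablePi q V X.toSpectrum) : TruePi B s q V X :=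
  ⟨fun _ _ k => StablePi.map q V ((forgetSym T).map k) x, fun _ _ _ _ k h =>
    (congrArg (fun f => StablePi.map q V f x) ((forgetSym T).map_comp k h)).trans
      (StablePi.map_comp q V _ _ x)⟩

end StableHomotopy

/-! ### Level structures, `Ω`-spectra and stable equivalences -/

section LevelNotions

/-- A functor `i` from pointed simplicial sets with right adjoint `j` is left Quillen: `i`
preserves cofibrations (the monomorphisms), and `j` preserves fibrations, that is, `j p` is a Kan
fibration for every fibration `p`. The second condition says that `i` preserves trivial
cofibrations. -/
structure IsLeftQuillenPair {D : Type u} [Category.{v} D] [ModelCategory D]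
    (i : PointedSSet.{w} ⥤ D) (j : D ⥤ PointedSSet.{w}) : Prop where
  cofibration {K L : PointedSSet.{w}} (f : K ⟶ L) [Mono (underlyingSSet.map f)] :
    Cofibration (i.map f)
  fibration {A B : D} (p : A ⟶ B) [Fibration p] :
    open SSet.modelCategoryQuillen in Fibration (underlyingSSet.map (j.map p))

variable {D : Type u} [Category.{v} D] [MonoidalCategory D] [ModelCategory D]

/-- The level equivalences of spectra. -/
def levelEquivalences (T : D) : MorphismProperty (Spectrum T) :=
  fun _ _ f => ∀ n, WeakEquivalence (f.app n)

/-- The level fibrations of spectra. -/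
def levelFibrations (T : D) : MorphismProperty (Spectrum T) :=
  fun _ _ f => ∀ n, Fibration (f.app n)

/-- Level fibrant spectra. -/
def Spectrum.LevelFibrant {T : D} (X : Spectrum T) : Prop := ∀ n, IsFibrant (X.obj n)

/-- The projective level model structure on spectra exists: there is a model structure whose weak
equivalences and fibrations are the level equivalences and the level fibrations. -/
def HasProjectiveLevelStructure (T : D) : Prop :=
  ∃ M : ModelCategory (Spectrum T), M.categoryWithWeakEquivalences.weakEquivalences =
    levelEquivalences T ∧ M.categoryWithFibrations.fibrations = levelFibrations T

variable [SymmetricCategory D]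

/-- The projective level model structure on symmetric spectra exists. -/
def HasSymProjectiveLevelStructure (T : D) : Prop :=
  ∃ M : ModelCategory (SymSpectrum T), M.categoryWithWeakEquivalences.weakEquivalences =
    (levelEquivalences T).inverseImage (forgetSym T) ∧
    M.categoryWithFibrations.fibrations = (levelFibrations T).inverseImage (forgetSym T)

variable [MonoidalClosed D]

/-- An `Ω`-spectrum: a level fibrant spectrum whose adjoint structure maps
`X_n ⟶ Hom(T, X_{n+1})` are weak equivalences. -/
def Spectrum.IsOmega {T : D} (X : Spectrum T) : Prop :=
  X.LevelFibrant ∧ ∀ n, WeakEquivalence (X.σTilde n)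

/-- The stable equivalences of spectra are the maps which are local with respect to all
`Ω`-spectra: `f : X ⟶ Y` is a stable equivalence if for every `Ω`-spectrum `W` composition with
`f` is a bijection `[Y, W] ⟶ [X, W]` in the level homotopy category. As `Ω`-spectra are closed
under (derived) cotensors with simplicial sets, this is the same as asking for weak equivalences
of homotopy function complexes. -/
def StableEquiv {T : D} {X Y : Spectrum T} (f : X ⟶ Y) : Prop :=
  ∀ W : Spectrum T, W.IsOmega → Function.Bijective
    (fun g : (levelEquivalences T).Q.obj Y ⟶ (levelEquivalences T).Q.obj W =>
      (levelEquivalences T).Q.map f ≫ g)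

/-- A level fibrant replacement `f'` of `f`: a commutative square from `f` to a map `f'` between
level fibrant spectra, in which the maps from `f` to `f'` are level equivalences. -/
def IsLevelFibrantReplacement {T : D} {X Y X' Y' : Spectrum T} (f : X ⟶ Y) (f' : X' ⟶ Y') : Prop :=
  X'.LevelFibrant ∧ Y'.LevelFibrant ∧ ∃ (a : X ⟶ X') (b : Y ⟶ Y'),
    levelEquivalences T a ∧ levelEquivalences T b ∧ a ≫ f' = f ≫ b

/-- Countable compositions of stable equivalences between level fibrant spectra are stable
equivalences. -/
def StableEquivCountableComp (T : D) : Prop :=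
  ∀ (F : ℕ ⥤ Spectrum T) (c : Cocone F), IsColimit c → (∀ n, (F.obj n).LevelFibrant) →
    (∀ n, StableEquiv (F.map (homOfLE (Nat.le_succ n)))) → StableEquiv (c.ι.app 0)

variable [HasColimitsOfShape ℕ D]

/-- The map `Θ^∞ f` is a level equivalence. -/
def ThetaLevelEquiv {T : D} {X Y : Spectrum T} (f : X ⟶ Y) : Prop :=
  ∀ n, WeakEquivalence (thetaInfMap f n)

/-- Stable equivalences are detected by `Θ^∞`: for every map `f`, it is equivalent that `f` is a
stable equivalence, that `Θ^∞ f'` is a level equivalence for every level fibrant replacement `f'`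
of `f`, and that this holds for some level fibrant replacement. -/
def ThetaDetectsStableEquiv (T : D) : Prop :=
  ∀ {X Y : Spectrum T} (f : X ⟶ Y),
    (StableEquiv f ↔ ∀ {X' Y' : Spectrum T} (f' : X' ⟶ Y'),
      IsLevelFibrantReplacement f f' → ThetaLevelEquiv f') ∧
    (StableEquiv f ↔ ∃ (X' Y' : Spectrum T) (f' : X' ⟶ Y'),
      IsLevelFibrantReplacement f f' ∧ ThetaLevelEquiv f')

end LevelNotions

end SemistableSpectra

/-!
Under the sign conventions in `InjAct`, the sets `[V ∧ T^{q+m}, X_m]` form a tower on which `Σ_m`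
acts in level `m`, and the permutations of newly added letters act trivially on stabilizations
(`stableTower`; the sign of `T` is what makes the transposition of two new letters act trivially).
The injection monoid `M` acts on the colimit of every such tower (`PermTower`), and two facts about
this action carry the proof. The cycle operator `d` is always injective
(`PermTower.inj_cycleOp_injective`). Moreover, if the `n`-fold shift of an element `y` is fixed by
all injections that are the identity on the first `n` letters, then `y` is fixed by all of `M`
(`PermTower.inj_eq_of_filtrationLE_shift`), since the injections `b` and `c` that agree on the first
`n` letters can be prescribed independently on the shifted ones. As every element is fixed by the
injections which are the identity on sufficiently many letters, `M` acts trivially if `d` is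
surjective, and also if a single `n` works for all elements at once.

The conditions on `λ_X` and `λ̃_X` are reformulations of the bijectivity of `d`: there are
bijections of `π_{q+1}^V(T ∧ X)` and `π_{q+1}^V(sh X)` with `π_q^V(X)`, and, for level fibrant `X`,
of `π_q^V(R X)` with `π_q^V(X)`, under which `λ_X` and `λ̃_X` become `d` (`unshiftMap_lam_suspMap`,
`unloopMap_lamTilde`). In particular `λ̃_X` is always injective on `π_q^V`, and it is bijective if
and only if it is surjective. The comparison with `π̃_q^V` is the Yoneda lemma together with the
fact that maps of spectra commute with `M`.

For `R^∞ X`, the functor `[V ∧ T^n, -]` has to commute with sequential colimits of fibrant objects.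
This follows from the cylinder `A ∧ i(Δ[1]_+)` for `A = V ∧ T^n`, which is small because `j` and
`Hom(A, -)` preserve sequential colimits (`hoSeqSmall_of_preservesColimits`). Since all maps
`R^k λ̃_X` are injective on `π_q^V`, so is `λ̃^∞_X`, and it is surjective if and only if `λ̃_X` is.

In an `Ω`-spectrum all classes of `π_q^V` come from levels at most `max (1 - q) 0`, so that it is
semistable (`semistable_of_isOmega`). Conversely, if `X` is level fibrant and semistable, then
`λ̃_X` is a stable equivalence, and `Θ^∞ λ̃_X` is a level equivalence. The functor `R R` has a
symmetry that exchanges `R λ̃_X` with `λ̃_{R X}` (`R_map_lamTilde_twistRR`); it yields isomorphisms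
under which `Θ^∞ λ̃_X` becomes `λ̃` of `R^∞ X` (`weakEquivalence_lamTilde_Rinf`), so that `R^∞ X` is
an `Ω`-spectrum. A general `X` is first replaced by a level fibrant spectrum.
-/

namespace SemistableSpectra

/-! ### Towers with an action of finite permutations -/

section PermTower

/-- A sequence of sets `A_0 ⟶ A_1 ⟶ ⋯`, given as a single type graded by `level`, on which
the permutations of `{0, …, m-1}` act in level `m`. Permutations are encoded as permutations of `ℕ`
which fix all `i ≥ m`; the value `act g r` is irrelevant when `g` moves some `i ≥ level r`. The last
axiom says that the permutations of the new letters act trivially on stabilizations. -/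
structure PermTower (S : Type*) where
  level : S → ℕ
  stab : S → S
  act : Equiv.Perm ℕ → S → S
  level_stab : ∀ r, level (stab r) = level r + 1
  level_act : ∀ g r, level (act g r) = level r
  act_mul : ∀ (g h : Equiv.Perm ℕ) (r), (∀ i, level r ≤ i → g i = i) →
    (∀ i, level r ≤ i → h i = i) → act (g * h) r = act g (act h r)
  stab_act : ∀ (g : Equiv.Perm ℕ) (r), (∀ i, level r ≤ i → g i = i) →
    stab (act g r) = act g (stab r)
  act_stab : ∀ (g : Equiv.Perm ℕ) (r) (j : ℕ), (∀ i < level r, g i = i) →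
    (∀ i, level r + j ≤ i → g i = i) → act g (stab^[j] r) = stab^[j] r

namespace PermTower

variable {S : Type*} (P : PermTower S)

/-- The colimit of the tower. -/
def Colim : Type _ := Quot (fun r r' : S => r' = P.stab r)

/-- The class of an element of the tower in the colimit. -/
def cls (r : S) : P.Colim := Quot.mk _ r

theorem cls_surjective : Function.Surjective P.cls := Quot.exists_rep

theorem cls_stab (r : S) : P.cls (P.stab r) = P.cls r :=
  (Quot.sound (r := fun r r' : S => r' = P.stab r) rfl).symm

theorem cls_iterate (j : ℕ) (r : S) : P.cls (P.stab^[j] r) = P.cls r := by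
  induction j with
  | zero => rfl
  | succ j ih => rw [Function.iterate_succ_apply', cls_stab, ih]

theorem cls_eq_iff {r r' : S} : P.cls r = P.cls r' ↔ ∃ i j, P.stab^[i] r = P.stab^[j] r' := by
  constructor
  · intro h
    induction Quot.eqvGen_exact h with
    | rel x y e => exact ⟨1, 0, e.symm⟩
    | refl x => exact ⟨0, 0, rfl⟩
    | symm x y _ ih => obtain ⟨i, j, e⟩ := ih (Quot.eqvGen_sound ‹_›); exact ⟨j, i, e.symm⟩
    | trans x y z h₁ h₂ ih₁ ih₂ =>
      obtain ⟨i, j, e⟩ := ih₁ (Quot.eqvGen_sound h₁)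
      obtain ⟨k, l, e'⟩ := ih₂ (Quot.eqvGen_sound h₂)
      refine ⟨k + i, j + l, ?_⟩
      rw [Function.iterate_add_apply, e, ← Function.iterate_add_apply, Nat.add_comm,
        Function.iterate_add_apply, e', ← Function.iterate_add_apply]
  · rintro ⟨i, j, e⟩
    rw [← P.cls_iterate i, e, cls_iterate]

theorem level_iterate (j : ℕ) (r : S) : P.level (P.stab^[j] r) = P.level r + j := by
  induction j with
  | zero => rfl
  | succ j ih => rw [Function.iterate_succ_apply', level_stab, ih]; rfl

theorem stab_iterate_act (g : Equiv.Perm ℕ) (r : S) (h : ∀ i, P.level r ≤ i → g i = i) (j : ℕ) :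
    P.stab^[j] (P.act g r) = P.act g (P.stab^[j] r) := by
  induction j with
  | zero => rfl
  | succ j ih =>
    rw [Function.iterate_succ_apply', ih, stab_act, Function.iterate_succ_apply']
    intro i hi
    rw [level_iterate] at hi
    exact h i (by omega)

/-- The graph of the action of the injection monoid on the colimit. -/
def InjRel (f : ℕ ↪ ℕ) (x y : P.Colim) : Prop :=
  ∃ (r : S) (j : ℕ) (g : Equiv.Perm ℕ), (∀ i < P.level r, g i = f i) ∧
    (∀ i, P.level r + j ≤ i → g i = i) ∧ P.cls r = x ∧ P.cls (P.act g (P.stab^[j] r)) = y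

theorem exists_perm_extending (f : ℕ ↪ ℕ) (m : ℕ) :
    ∃ (j : ℕ) (g : Equiv.Perm ℕ), (∀ i < m, g i = f i) ∧ ∀ i, m + j ≤ i → g i = i := by
  obtain ⟨j, hj⟩ : ∃ j, ∀ i < m, f i < m + j := by
    refine ⟨∑ i ∈ Finset.range m, (f i + 1), fun i hi => ?_⟩
    have := Finset.single_le_sum (f := fun i => f i + 1) (fun _ _ => Nat.zero_le _)
      (Finset.mem_range.2 hi)
    omega
  obtain ⟨g, hg⟩ := Finset.exists_equiv_extend_of_card_eq (α := Fin (m + j))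
    (t := (Finset.univ : Finset (Fin (m + j)))) (by simp)
    (s := {i : Fin (m + j) | (i : ℕ) < m})
    (f := fun i => if h : (i : ℕ) < m then ⟨f i, hj i h⟩ else i)
    (Finset.subset_univ _) (by
      intro a ha b hb h
      simp only [Finset.coe_filter, Finset.mem_univ, true_and] at ha hb
      change (a : ℕ) < m at ha
      change (b : ℕ) < m at hb
      simp only [ha, hb, dif_pos, Fin.mk.injEq] at h
      exact Fin.ext (f.injective h))
  let g' : Equiv.Perm (Fin (m + j)) :=
    g.trans (Equiv.subtypeUnivEquiv (fun x => Finset.mem_univ x))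
  refine ⟨j, g'.extendDomain Fin.equivSubtype, fun i hi => ?_, fun i hi => ?_⟩
  · have h := hg ⟨i, by omega⟩ (by simpa using hi)
    have e := Equiv.Perm.extendDomain_apply_subtype g' Fin.equivSubtype (b := i)
      (show i < m + j by omega)
    refine e.trans ?_
    change ((g ⟨i, by omega⟩ : Fin (m + j)) : ℕ) = f i
    rw [h, dif_pos hi]
  · exact Equiv.Perm.extendDomain_apply_not_subtype _ _ (by omega)

theorem injRel_total (f : ℕ ↪ ℕ) (x : P.Colim) : ∃ y, P.InjRel f x y := by
  obtain ⟨r, rfl⟩ := P.cls_surjective x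
  obtain ⟨j, g, h, h'⟩ := exists_perm_extending f (P.level r)
  exact ⟨_, r, j, g, h, h', rfl, rfl⟩

/-- The class of `g · r` depends only on the values of `g` on the letters of `r`. -/
theorem cls_act_eq {r : S} {j j' : ℕ} {g g' : Equiv.Perm ℕ}
    (h : ∀ i < P.level r, g i = g' i) (hg : ∀ i, P.level r + j ≤ i → g i = i)
    (hg' : ∀ i, P.level r + j' ≤ i → g' i = i) :
    P.cls (P.act g (P.stab^[j] r)) = P.cls (P.act g' (P.stab^[j'] r)) := by
  have e : ∀ (k : ℕ) (k' : ℕ) (g : Equiv.Perm ℕ), (∀ i, P.level r + k ≤ i → g i = i) →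
      P.cls (P.act g (P.stab^[k] r)) = P.cls (P.act g (P.stab^[k' + k] r)) := by
    intro k k' g hg
    rw [← P.cls_iterate k', stab_iterate_act, ← Function.iterate_add_apply]
    intro i hi
    rw [level_iterate] at hi
    exact hg i hi
  rw [e j j' g hg, e j' j g' hg', Nat.add_comm j j']
  congr 1
  have s : ∀ i, P.level r + (j' + j) ≤ i → g i = i := fun i hi => hg i (by omega)
  have s' : ∀ i, P.level r + (j' + j) ≤ i → g' i = i := fun i hi => hg' i (by omega)
  have s'' : ∀ i, P.level r + (j' + j) ≤ i → (g⁻¹ * g') i = i := fun i hi => by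
    rw [Equiv.Perm.mul_apply, s' i hi, Equiv.Perm.inv_eq_iff_eq, s i hi]
  have : P.act g' (P.stab^[j' + j] r) = P.act (g * (g⁻¹ * g')) (P.stab^[j' + j] r) := by
    rw [mul_inv_cancel_left]
  rw [this, act_mul, act_stab _ (g⁻¹ * g') _ _ _ s'']
  · intro i hi
    rw [Equiv.Perm.mul_apply, Equiv.Perm.inv_eq_iff_eq, h i hi]
  · intro i hi
    rw [level_iterate] at hi
    exact s i hi
  · intro i hi
    rw [level_iterate] at hi
    exact s'' i hi

theorem injRel_unique {f : ℕ ↪ ℕ} {x y y' : P.Colim} (h : P.InjRel f x y)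
    (h' : P.InjRel f x y') : y = y' := by
  obtain ⟨r, j, g, hf, hg, rfl, rfl⟩ := h
  obtain ⟨r', j', g', hf', hg', e, rfl⟩ := h'
  obtain ⟨k', k, e⟩ := P.cls_eq_iff.1 e
  -- the value computed from a representative does not change under stabilization
  have key : ∀ (r : S) (j k : ℕ) (g : Equiv.Perm ℕ), (∀ i < P.level r, g i = f i) →
      (∀ i, P.level r + j ≤ i → g i = i) → ∀ (l : ℕ) (g' : Equiv.Perm ℕ),
      (∀ i < P.level (P.stab^[k] r), g' i = f i) →
      (∀ i, P.level (P.stab^[k] r) + l ≤ i → g' i = i) →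
      P.cls (P.act g (P.stab^[j] r)) = P.cls (P.act g' (P.stab^[l] (P.stab^[k] r))) := by
    intro r j k g hf hg l g' hf' hg'
    rw [level_iterate] at hf' hg'
    rw [← Function.iterate_add_apply]
    refine P.cls_act_eq (fun i hi => ?_) hg (fun i hi => hg' i (by omega))
    rw [hf i hi, hf' i (by omega)]
  obtain ⟨l, g'', h₁, h₂⟩ := exists_perm_extending f (P.level (P.stab^[k] r))
  rw [key r j k g hf hg l g'' h₁ h₂]
  rw [← e] at h₁ h₂ ⊢
  rw [key r' j' k' g' hf' hg' l g'' h₁ h₂]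

/-- The action of an injection on the colimit. -/
noncomputable def inj (f : ℕ ↪ ℕ) (x : P.Colim) : P.Colim := (P.injRel_total f x).choose

theorem injRel_iff {f : ℕ ↪ ℕ} {x y : P.Colim} : P.InjRel f x y ↔ P.inj f x = y :=
  ⟨fun h => P.injRel_unique (P.injRel_total f x).choose_spec h,
    fun h => h ▸ (P.injRel_total f x).choose_spec⟩

theorem inj_cls {f : ℕ ↪ ℕ} {r : S} {j : ℕ} {g : Equiv.Perm ℕ} (hf : ∀ i < P.level r, g i = f i)
    (hg : ∀ i, P.level r + j ≤ i → g i = i) :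
    P.inj f (P.cls r) = P.cls (P.act g (P.stab^[j] r)) :=
  P.injRel_iff.1 ⟨r, j, g, hf, hg, rfl, rfl⟩

theorem inj_inj (f f' : ℕ ↪ ℕ) (x : P.Colim) : P.inj f (P.inj f' x) = P.inj (f'.trans f) x := by
  obtain ⟨r, rfl⟩ := P.cls_surjective x
  obtain ⟨j, g', hf', hg'⟩ := exists_perm_extending f' (P.level r)
  rw [P.inj_cls hf' hg']
  have hl : P.level (P.act g' (P.stab^[j] r)) = P.level r + j := by rw [level_act, level_iterate]
  obtain ⟨k, g, hf, hg⟩ := exists_perm_extending f (P.level (P.act g' (P.stab^[j] r)))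
  rw [P.inj_cls hf hg]
  rw [hl] at hf hg
  have s : ∀ i, P.level (P.stab^[j] r) ≤ i → g' i = i := fun i hi => by
    rw [level_iterate] at hi
    exact hg' i hi
  have lt : ∀ i < P.level r + j, g' i < P.level r + j := fun i hi => by
    by_contra hc
    have := g'.injective (hg' (g' i) (by omega))
    omega
  rw [stab_iterate_act _ _ _ s, ← Function.iterate_add_apply, ← act_mul]
  · refine (P.inj_cls (fun i hi => ?_) (fun i hi => ?_)).symm
    · rw [Equiv.Perm.mul_apply, hf _ (lt i (by omega)), hf' i hi]
      rfl
    · rw [Equiv.Perm.mul_apply, hg' i (by omega), hg i (by omega)]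
  · intro i hi
    rw [level_iterate] at hi
    exact hg i (by omega)
  · intro i hi
    rw [level_iterate] at hi
    exact hg' i (by omega)

theorem inj_congr_of_level (f f' : ℕ ↪ ℕ) (r : S) (h : ∀ i < P.level r, f i = f' i) :
    P.inj f (P.cls r) = P.inj f' (P.cls r) := by
  obtain ⟨j, g, hf, hg⟩ := exists_perm_extending f (P.level r)
  rw [P.inj_cls hf hg, P.inj_cls (fun i hi => (hf i hi).trans (h i hi)) hg]

theorem inj_of_level (f : ℕ ↪ ℕ) (r : S) (h : ∀ i < P.level r, f i = i) :
    P.inj f (P.cls r) = P.cls r := by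
  rw [P.inj_cls (g := 1) (j := 0) (fun i hi => (h i hi).symm) (fun _ _ => rfl)]
  exact congrArg P.cls (P.act_stab 1 r 0 (fun _ _ => rfl) (fun _ _ => rfl))

/-- An element has filtration at most `n` if it is fixed by all injections which are the identity
on `{0, …, n-1}`. -/
def FiltrationLE (n : ℕ) (x : P.Colim) : Prop :=
  ∀ f : ℕ ↪ ℕ, (∀ i < n, f i = i) → P.inj f x = x

theorem filtrationLE_cls (r : S) : P.FiltrationLE (P.level r) (P.cls r) :=
  fun f h => P.inj_of_level f r h

theorem FiltrationLE.inj_congr {n : ℕ} {x : P.Colim} (hx : P.FiltrationLE n x) {f f' : ℕ ↪ ℕ}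
    (h : ∀ i < n, f i = f' i) : P.inj f x = P.inj f' x := by
  obtain ⟨r, rfl⟩ := P.cls_surjective x
  obtain ⟨_, g, hg, _⟩ := exists_perm_extending f (max n (P.level r))
  obtain ⟨_, g', hg', _⟩ := exists_perm_extending f' (max n (P.level r))
  have e : P.inj f (P.cls r) = P.inj g.toEmbedding (P.cls r) :=
    P.inj_congr_of_level _ _ _ fun i hi => (hg i (lt_max_of_lt_right hi)).symm
  have e' : P.inj f' (P.cls r) = P.inj g'.toEmbedding (P.cls r) :=
    P.inj_congr_of_level _ _ _ fun i hi => (hg' i (lt_max_of_lt_right hi)).symm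
  have e'' : P.inj (g⁻¹ * g').toEmbedding (P.cls r) = P.cls r := hx _ fun i hi => by
    change g⁻¹ (g' i) = i
    rw [Equiv.Perm.inv_eq_iff_eq, hg i (lt_max_of_lt_left hi), hg' i (lt_max_of_lt_left hi), h i hi]
  rw [e, e']
  conv_lhs => rw [← e'']
  rw [inj_inj]
  congr 1
  ext i
  exact g.apply_symm_apply (g' i)

/-- The shift `i ↦ i + n`. -/
def shiftEmb (n : ℕ) : ℕ ↪ ℕ := addRightEmbedding n

/-- An element `y` for which the `n`-fold shift of `y` has filtration at most `n` is fixed by all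
injections. -/
theorem inj_eq_of_filtrationLE_shift {n : ℕ} {y : P.Colim}
    (h : P.FiltrationLE n (P.inj (shiftEmb n) y)) (f : ℕ ↪ ℕ) : P.inj f y = y := by
  obtain ⟨r, rfl⟩ := P.cls_surjective y
  set N := P.level r with hN
  obtain ⟨M, hM, hNM⟩ : ∃ M, (∀ i < N, f i < M) ∧ N ≤ M := by
    refine ⟨N + ∑ i ∈ Finset.range N, (f i + 1), fun i hi => ?_, Nat.le_add_right _ _⟩
    have := Finset.single_le_sum (f := fun i => f i + 1) (fun _ _ => Nat.zero_le _)
      (Finset.mem_range.2 hi)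
    omega
  -- an injection which is `a` on the shifted letters and agrees with `i ↦ M + i` on the first `n`
  have ext : ∀ a : ℕ ↪ ℕ, (∀ i < N, a i < M) → ∃ b : ℕ ↪ ℕ, (∀ i < n, b i = M + i) ∧
      ∀ i < N, b (i + n) = a i := by
    intro a ha
    refine ⟨⟨fun i => if i < n then M + i else if i < n + N then a (i - n) else M + i, ?_⟩, ?_, ?_⟩
    · intro i i' hii
      have h₁ := ha (i - n)
      have h₂ := ha (i' - n)
      have h₃ : a (i - n) = a (i' - n) → i - n = i' - n := fun h => a.injective h
      dsimp only at hii
      split_ifs at hii <;> omega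
    · intro i hi
      exact if_pos hi
    · intro i hi
      change (if i + n < n then M + (i + n) else if i + n < n + N then a (i + n - n)
        else M + (i + n)) = _
      rw [if_neg (by omega), if_pos (by omega), Nat.add_sub_cancel]
  obtain ⟨b, hb, hb'⟩ := ext (Function.Embedding.refl ℕ) (fun i hi => lt_of_lt_of_le hi hNM)
  obtain ⟨c, hc, hc'⟩ := ext f hM
  have e := FiltrationLE.inj_congr P h (f := b) (f' := c) fun i hi => by rw [hb i hi, hc i hi]
  rw [inj_inj, inj_inj] at e
  rw [P.inj_congr_of_level ((shiftEmb n).trans b) (Function.Embedding.refl ℕ) r hb',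
    P.inj_congr_of_level ((shiftEmb n).trans c) f r hc', P.inj_of_level (Function.Embedding.refl ℕ) r
      (fun _ _ => rfl)] at e
  exact e.symm

theorem inj_eq_of_bounded_filtration (n : ℕ) (h : ∀ x, P.FiltrationLE n x) (f : ℕ ↪ ℕ)
    (x : P.Colim) : P.inj f x = x :=
  P.inj_eq_of_filtrationLE_shift (h _) f

/-- If the cycle operator is surjective, then so are all shifts, and every element is a shift of one
to which `inj_eq_of_filtrationLE_shift` applies. -/
theorem inj_eq_of_surjective (h : Function.Surjective (P.inj cycleOp)) (f : ℕ ↪ ℕ)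
    (x : P.Colim) : P.inj f x = x := by
  have hs : ∀ n, Function.Surjective (P.inj (shiftEmb n)) := by
    intro n
    induction n with
    | zero =>
      intro x
      obtain ⟨r, rfl⟩ := P.cls_surjective x
      exact ⟨_, P.inj_of_level _ r (fun _ _ => rfl)⟩
    | succ n ih =>
      intro x
      obtain ⟨y, rfl⟩ := h x
      obtain ⟨z, rfl⟩ := ih y
      exact ⟨z, (P.inj_inj cycleOp (shiftEmb n) z).symm⟩
  obtain ⟨r, rfl⟩ := P.cls_surjective x
  obtain ⟨y, hy⟩ := hs (P.level r) (P.cls r)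
  have hy' := P.inj_eq_of_filtrationLE_shift (y := y) (by rw [hy]; exact P.filtrationLE_cls r)
  rw [← hy, hy' (shiftEmb (P.level r)), hy' f]

theorem inj_cycleOp_injective : Function.Injective (P.inj cycleOp) := by
  intro x y h
  obtain ⟨r, rfl⟩ := P.cls_surjective x
  obtain ⟨r', rfl⟩ := P.cls_surjective y
  let N := P.level r + P.level r'
  -- a left inverse of the cycle operator on the first `N` letters
  let b : ℕ ↪ ℕ := ⟨fun i => if i = 0 then N else if i ≤ N then i - 1 else i, fun i i' hii => by
    dsimp only at hii
    split_ifs at hii <;> omega⟩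
  have hb : ∀ i < N, b (i + 1) = i := fun i hi => by
    change (if i + 1 = 0 then N else if i + 1 ≤ N then i + 1 - 1 else i + 1) = i
    rw [if_neg (by omega), if_pos (by omega), Nat.add_sub_cancel]
  have e := congrArg (P.inj b) h
  rwa [inj_inj, inj_inj, P.inj_of_level _ r (fun i hi => hb i (by omega)),
    P.inj_of_level _ r' (fun i hi => hb i (by omega))] at e

variable {P} {S' : Type*} {P' : PermTower S'}

/-- Maps of towers commute with the action of the injection monoid. -/
theorem map_inj (F : S → S') (hl : ∀ r, P'.level (F r) = P.level r)
    (hs : ∀ r, F (P.stab r) = P'.stab (F r)) (ha : ∀ g r, F (P.act g r) = P'.act g (F r))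
    (F' : P.Colim → P'.Colim) (hF : ∀ r, F' (P.cls r) = P'.cls (F r)) (f : ℕ ↪ ℕ)
    (x : P.Colim) : F' (P.inj f x) = P'.inj f (F' x) := by
  obtain ⟨r, rfl⟩ := P.cls_surjective x
  obtain ⟨j, g, hf, hg⟩ := exists_perm_extending f (P.level r)
  have hs' : F (P.stab^[j] r) = P'.stab^[j] (F r) :=
    Function.Semiconj.iterate_right (f := F) hs j r
  rw [P.inj_cls hf hg, hF, hF, ha, hs', P'.inj_cls (by rwa [hl]) (by rwa [hl])]

end PermTower

end PermTower

/-! ### Smash products in the homotopy category -/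

section HomotopySmash

variable {D : Type u} [Category.{v} D] [ModelCategory D]

instance isIso_toHo_map {A B : D} (f : A ⟶ B) [hf : WeakEquivalence f] : IsIso ((toHo D).map f) :=
  Localization.inverts (toHo D) (weakEquivalences D) f hf.mem

/-- Maps out of a cofibrant object in `Ho(D)` are left fractions. -/
theorem exists_left_fraction {A : D} [IsCofibrant A] {B : D}
    (φ : (toHo D).obj A ⟶ (toHo D).obj B) :
    ∃ (B' : D) (g : A ⟶ B') (i : B ⟶ B'), Cofibration i ∧ WeakEquivalence i ∧
      φ ≫ (toHo D).map i = (toHo D).map g := by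
  obtain ⟨g, hg⟩ := map_surjective_of_isLocalization (toHo D) A (FibrantObject.HoCat.resolutionObj B)
    (φ ≫ (toHo D).map (FibrantObject.HoCat.iResolutionObj B))
  exact ⟨_, g, FibrantObject.HoCat.iResolutionObj B, inferInstance, inferInstance, hg.symm⟩

variable [MonoidalCategory D]

instance (T : D) [IsCircle T] {A B : D} (f : A ⟶ B) [WeakEquivalence f] :
    WeakEquivalence (f ▷ T) :=
  IsCircle.weakEquivalence_whiskerRight f

@[simp] theorem hoSmashRight_id (T : D) [IsCircle T] (A : D) :
    hoSmashRight T (𝟙 ((toHo D).obj A)) = 𝟙 _ :=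
  (smashRightMorphism T).homMap_id (toHo D) (toHo D) A

theorem hoSmashRight_fraction (T : D) [IsCircle T] {A B B' : D}
    {φ : (toHo D).obj A ⟶ (toHo D).obj B} {g : A ⟶ B'} {i : B ⟶ B'}
    (h : φ ≫ (toHo D).map i = (toHo D).map g) :
    hoSmashRight T φ ≫ (toHo D).map (i ▷ T) = (toHo D).map (g ▷ T) := by
  rw [← hoSmashRight_map, ← hoSmashRight_comp, h, hoSmashRight_map]

variable [SymmetricCategory D] [MonoidalClosed D] [MonoidalModel D]

theorem cofibration_whiskerLeft (V : D) [IsCofibrant V] {A B : D} (f : A ⟶ B) [Cofibration f] :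
    Cofibration (V ◁ f) := by
  have hA : PreservesColimitsOfShape (Discrete PEmpty.{1}) ((curriedTensor D).flip.obj A) :=
    preservesColimitsOfShape_of_natIso (BraidedCategory.tensorLeftIsoTensorRight A)
  have hB : PreservesColimitsOfShape (Discrete PEmpty.{1}) ((curriedTensor D).flip.obj B) :=
    preservesColimitsOfShape_of_natIso (BraidedCategory.tensorLeftIsoTensorRight B)
  exact MonoidalModel.cofibration_pushoutProduct (initial.to V) f
    (Functor.PushoutObjObj.ofIsInitialLeft (curriedTensor D) (initial.to V) f initialIsInitial)

instance isCofibrant_tensor (A B : D) [IsCofibrant A] [IsCofibrant B] : IsCofibrant (A ⊗ B) := by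
  rw [isCofibrant_iff_of_isInitial (A ◁ initial.to B)
    (initialIsInitial.isInitialObj (tensorLeft A) (⊥_ D))]
  exact cofibration_whiskerLeft A _

instance isCofibrant_smashPow (T V : D) [IsCircle T] [IsCofibrant V] :
    ∀ n, IsCofibrant (smashPow T V n)
  | 0 => inferInstanceAs (IsCofibrant V)
  | n + 1 =>
    have := isCofibrant_smashPow T V n
    inferInstanceAs (IsCofibrant (smashPow T V n ⊗ T))

theorem hoSmashLeft_map (V : D) [IsCofibrant V] {A B : D} [IsCofibrant A] [IsCofibrant B]
    (f : A ⟶ B) : hoSmashLeft V ((toHo D).map f) = (toHo D).map (V ◁ f) :=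
  (smashLeftMorphism V).homMap_map (X := CofibrantObject.mk A) (Y := CofibrantObject.mk B)
    (CofibrantObject.ι ⋙ toHo D) (toHo D) (CofibrantObject.homMk f)

theorem hoSmashLeft_comp (V : D) [IsCofibrant V] {A B C : D} [IsCofibrant A] [IsCofibrant B]
    [IsCofibrant C] (φ : (toHo D).obj A ⟶ (toHo D).obj B) (ψ : (toHo D).obj B ⟶ (toHo D).obj C) :
    hoSmashLeft V (φ ≫ ψ) = hoSmashLeft V φ ≫ hoSmashLeft V ψ :=
  (smashLeftMorphism V).homMap_comp (X := CofibrantObject.mk A) (Y := CofibrantObject.mk B)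
    (Z := CofibrantObject.mk C) (CofibrantObject.ι ⋙ toHo D) (toHo D) φ ψ

theorem hoSmashLeft_id (V : D) [IsCofibrant V] (A : D) [IsCofibrant A] :
    hoSmashLeft V (𝟙 ((toHo D).obj A)) = 𝟙 _ :=
  (smashLeftMorphism V).homMap_id (X := CofibrantObject.mk A)
    (CofibrantObject.ι ⋙ toHo D) (toHo D)

theorem hoSmashLeft_fraction (V : D) [IsCofibrant V] {A B B' : D} [IsCofibrant A] [IsCofibrant B]
    [IsCofibrant B'] {φ : (toHo D).obj A ⟶ (toHo D).obj B} {g : A ⟶ B'} {i : B ⟶ B'}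
    (h : φ ≫ (toHo D).map i = (toHo D).map g) :
    hoSmashLeft V φ ≫ (toHo D).map (V ◁ i) = (toHo D).map (V ◁ g) := by
  rw [← hoSmashLeft_map, ← hoSmashLeft_comp, h, hoSmashLeft_map]

theorem hoSmashLeft_natural {V W : D} [IsCofibrant V] [IsCofibrant W] (f : V ⟶ W) {A B : D}
    [IsCofibrant A] [IsCofibrant B] (φ : (toHo D).obj A ⟶ (toHo D).obj B) :
    (toHo D).map (f ▷ A) ≫ hoSmashLeft W φ = hoSmashLeft V φ ≫ (toHo D).map (f ▷ B) := by
  obtain ⟨B', g, i, _, _, h⟩ := exists_left_fraction φ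
  have : IsCofibrant B' := isCofibrant_of_cofibration i
  have := weakEquivalence_whiskerLeft W i
  rw [← cancel_mono ((toHo D).map (W ◁ i)), Category.assoc, hoSmashLeft_fraction W h,
    Category.assoc, ← Functor.map_comp, ← Functor.map_comp, ← whisker_exchange,
    ← whisker_exchange, Functor.map_comp, Functor.map_comp, ← hoSmashLeft_fraction V h,
    Category.assoc]

theorem hoSmashLeft_smashRight (T : D) [IsCircle T] (V : D) [IsCofibrant V] {A B : D}
    [IsCofibrant A] [IsCofibrant B] (φ : (toHo D).obj A ⟶ (toHo D).obj B) :
    (toHo D).map (α_ V A T).hom ≫ hoSmashLeft V (hoSmashRight T φ) =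
      hoSmashRight T (hoSmashLeft V φ) ≫ (toHo D).map (α_ V B T).hom := by
  obtain ⟨B', g, i, _, _, h⟩ := exists_left_fraction φ
  have : IsCofibrant B' := isCofibrant_of_cofibration i
  have := weakEquivalence_whiskerLeft V (i ▷ T)
  rw [← cancel_mono ((toHo D).map (V ◁ i ▷ T)), Category.assoc,
    hoSmashLeft_fraction V (hoSmashRight_fraction T h), Category.assoc, ← Functor.map_comp,
    ← Functor.map_comp, ← associator_naturality_middle, ← associator_naturality_middle,
    Functor.map_comp, Functor.map_comp, ← hoSmashRight_fraction T (hoSmashLeft_fraction V h),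
    Category.assoc]

theorem hoSmashLeft_smashLeft (V W : D) [IsCofibrant V] [IsCofibrant W] {A B : D}
    [IsCofibrant A] [IsCofibrant B] (φ : (toHo D).obj A ⟶ (toHo D).obj B) :
    (toHo D).map (α_ V W A).hom ≫ hoSmashLeft V (hoSmashLeft W φ) =
      hoSmashLeft (V ⊗ W) φ ≫ (toHo D).map (α_ V W B).hom := by
  obtain ⟨B', g, i, _, _, h⟩ := exists_left_fraction φ
  have : IsCofibrant B' := isCofibrant_of_cofibration i
  have := weakEquivalence_whiskerLeft W i
  have := weakEquivalence_whiskerLeft V (W ◁ i)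
  rw [← cancel_mono ((toHo D).map (V ◁ W ◁ i)), Category.assoc,
    hoSmashLeft_fraction V (hoSmashLeft_fraction W h), Category.assoc, ← Functor.map_comp,
    ← Functor.map_comp, ← associator_naturality_right, ← associator_naturality_right,
    Functor.map_comp, Functor.map_comp, ← hoSmashLeft_fraction (V ⊗ W) h, Category.assoc]

end HomotopySmash

/-! ### The sign in the homotopy category -/

section Sign

variable {D : Type u} [Category.{v} D] [MonoidalCategory D] [ModelCategory D]
  [SymmetricCategory D] [MonoidalClosed D] [MonoidalModel D] {T : D} [IsCircle T]
  (s : CircleSign T)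

namespace CircleSign

open CofibrantObject.HoCat in
/-- The map `A ∧ (-1)_T` on `A ∧ T` in `Ho(D)`, for an arbitrary object `A`: it is computed on a
cofibrant resolution of `A`, which is harmless since `- ∧ T` preserves weak equivalences. -/
noncomputable def smashSign (A : D) : (toHo D).obj (A ⊗ T) ⟶ (toHo D).obj (A ⊗ T) :=
  inv ((toHo D).map (pResolutionObj A ▷ T)) ≫ hoSmashLeft (resolutionObj A) s.hom ≫
    (toHo D).map (pResolutionObj A ▷ T)

open CofibrantObject.HoCat in
theorem smashSign_resolution (A : D) : (toHo D).map (pResolutionObj A ▷ T) ≫ s.smashSign A =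
    hoSmashLeft (resolutionObj A) s.hom ≫ (toHo D).map (pResolutionObj A ▷ T) := by
  simp [smashSign]

open CofibrantObject.HoCat in
theorem smashSign_natural_map {A B : D} (f : A ⟶ B) :
    (toHo D).map (f ▷ T) ≫ s.smashSign B = s.smashSign A ≫ (toHo D).map (f ▷ T) := by
  rw [← cancel_epi ((toHo D).map (pResolutionObj A ▷ T)), ← Category.assoc, ← Category.assoc,
    smashSign_resolution, ← Functor.map_comp, ← comp_whiskerRight, ← resolutionMap_fac,
    comp_whiskerRight, Functor.map_comp, Category.assoc, smashSign_resolution, ← Category.assoc,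
    hoSmashLeft_natural, Category.assoc, Category.assoc, ← Functor.map_comp, ← Functor.map_comp,
    ← comp_whiskerRight, ← comp_whiskerRight, resolutionMap_fac]

/-- `A ∧ (-1)_T` is natural for maps in `Ho(D)`, as these are fractions out of a cofibrant resolution
of `A`. -/
theorem smashSign_natural {A B : D} (φ : (toHo D).obj A ⟶ (toHo D).obj B) :
    hoSmashRight T φ ≫ s.smashSign B = s.smashSign A ≫ hoSmashRight T φ := by
  let p := CofibrantObject.HoCat.pResolutionObj A
  obtain ⟨B', g, i, _, _, h⟩ := exists_left_fraction ((toHo D).map p ≫ φ)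
  have h' := hoSmashRight_fraction T h
  rw [hoSmashRight_comp, hoSmashRight_map] at h'
  rw [← cancel_mono ((toHo D).map (i ▷ T)), ← cancel_epi ((toHo D).map (p ▷ T)), Category.assoc,
    ← smashSign_natural_map, reassoc_of% h', smashSign_natural_map, ← h', Category.assoc,
    ← Category.assoc, ← smashSign_natural_map]
  simp only [Category.assoc]

theorem smashSign_eq (V : D) [IsCofibrant V] : s.smashSign V = hoSmashLeft V s.hom := by
  rw [← cancel_epi ((toHo D).map (CofibrantObject.HoCat.pResolutionObj V ▷ T)),
    smashSign_resolution, hoSmashLeft_natural]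

@[simp]
theorem smashSign_smashSign (A : D) : s.smashSign A ≫ s.smashSign A = 𝟙 _ := by
  rw [← cancel_epi ((toHo D).map (CofibrantObject.HoCat.pResolutionObj A ▷ T)),
    ← Category.assoc, smashSign_resolution, Category.assoc, smashSign_resolution,
    ← Category.assoc, ← hoSmashLeft_comp, s.hom_hom, hoSmashLeft_id, Category.id_comp,
    Category.comp_id]

@[simp]
theorem smashSign_smashSign_assoc (A : D) {Z : (weakEquivalences D).Localization}
    (h : (toHo D).obj (A ⊗ T) ⟶ Z) : s.smashSign A ≫ s.smashSign A ≫ h = h := by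
  rw [← Category.assoc, smashSign_smashSign, Category.id_comp]

/-- The axiom on permutations of a sign, for the transposition in `Σ_2`. -/
theorem map_braiding : (toHo D).map (β_ T T).hom = hoSmashRight T s.hom := by
  have h := s.perm 1 (lastSwap 0) _ (PermMap.swap 0)
  have hs : Equiv.Perm.sign (lastSwap 0) = -1 := Equiv.Perm.sign_swap (by decide)
  have e : (λ_ T).hom ▷ T ≫ (β_ T T).hom = twistLast T (𝟙_ D) ≫ (λ_ T).hom ▷ T := by
    simp only [twistLast]
    monoidal
  have h' : firstFactor T (𝟙_ D) ((toHo D).map (λ_ T).hom ≫ permSign s.hom (lastSwap 0) ≫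
      (toHo D).map (λ_ T).inv) 1 = hoSmashRight T ((toHo D).map (λ_ T).hom ≫ s.hom ≫
      (toHo D).map (λ_ T).inv) := by
    rw [permSign, if_pos hs]
    rfl
  have h'' : (toHo D).map (twistLast T (𝟙_ D)) = hoSmashRight T ((toHo D).map (λ_ T).hom ≫
      s.hom ≫ (toHo D).map (λ_ T).inv) := h.trans h'
  rw [hoSmashRight_comp, hoSmashRight_comp, hoSmashRight_map, hoSmashRight_map] at h''
  rw [← cancel_epi ((toHo D).map ((λ_ T).hom ▷ T)), ← Functor.map_comp, e, Functor.map_comp, h'',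
    Category.assoc, Category.assoc, ← Functor.map_comp, ← comp_whiskerRight, Iso.inv_hom_id,
    id_whiskerRight, CategoryTheory.Functor.map_id, Category.comp_id]

theorem map_twistLast_of_isCofibrant (A : D) [IsCofibrant A] :
    (toHo D).map (twistLast T A) = hoSmashRight T (s.smashSign A) ∧
      (toHo D).map (twistLast T A) = s.smashSign (A ⊗ T) := by
  have h := hoSmashLeft_map A (β_ T T).hom
  constructor
  · rw [smashSign_eq, twistLast, Functor.map_comp, Functor.map_comp, ← h, map_braiding,
      ← Category.assoc, hoSmashLeft_smashRight, Category.assoc, ← Functor.map_comp,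
      Iso.hom_inv_id, CategoryTheory.Functor.map_id, Category.comp_id]
  · rw [smashSign_eq, twistLast, Functor.map_comp, Functor.map_comp, ← h, map_braiding, s.twist,
      ← Category.assoc, hoSmashLeft_smashLeft, Category.assoc, ← Functor.map_comp,
      Iso.hom_inv_id, CategoryTheory.Functor.map_id, Category.comp_id]

theorem map_twistLast_eq_smashRight (A : D) :
    (toHo D).map (twistLast T A) = hoSmashRight T (s.smashSign A) := by
  let p := CofibrantObject.HoCat.pResolutionObj A
  rw [← cancel_epi ((toHo D).map (p ▷ T ▷ T)), ← Functor.map_comp, twistLast_natural,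
    Functor.map_comp, (s.map_twistLast_of_isCofibrant _).1, ← hoSmashRight_map T (p ▷ T),
    ← hoSmashRight_comp, ← hoSmashRight_comp, smashSign_natural_map]

/-- The symmetry of the last two factors of `A ∧ T ∧ T` is the sign of the last factor. -/
theorem map_twistLast (A : D) : (toHo D).map (twistLast T A) = s.smashSign (A ⊗ T) := by
  let p := CofibrantObject.HoCat.pResolutionObj A
  rw [← cancel_epi ((toHo D).map (p ▷ T ▷ T)), ← Functor.map_comp, twistLast_natural,
    Functor.map_comp, (s.map_twistLast_of_isCofibrant _).2, smashSign_natural_map]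

/-- The sign of the next to last factor of `A ∧ T ∧ T` is that of the last factor. -/
theorem hoSmashRight_smashSign (A : D) :
    hoSmashRight T (s.smashSign A) = s.smashSign (A ⊗ T) := by
  rw [← map_twistLast_eq_smashRight, map_twistLast]

/-- The map `A ∧ u` on `A ∧ T` in `Ho(D)`, for a unit `u = ±1`. -/
noncomputable def smashUnit (A : D) (u : ℤˣ) : (toHo D).obj (A ⊗ T) ⟶ (toHo D).obj (A ⊗ T) :=
  if u = -1 then s.smashSign A else 𝟙 _

@[simp] theorem smashUnit_one (A : D) : s.smashUnit A 1 = 𝟙 _ := if_neg (by decide)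

theorem smashUnit_neg_one (A : D) : s.smashUnit A (-1) = s.smashSign A := if_pos rfl

theorem smashUnit_mul (A : D) (u u' : ℤˣ) :
    s.smashUnit A u ≫ s.smashUnit A u' = s.smashUnit A (u * u') := by
  rcases Int.units_eq_one_or u with rfl | rfl <;> rcases Int.units_eq_one_or u' with rfl | rfl <;>
    simp [smashUnit_neg_one]

theorem smashUnit_mul_assoc (A : D) (u u' : ℤˣ) {Z : (weakEquivalences D).Localization}
    (h : (toHo D).obj (A ⊗ T) ⟶ Z) :
    s.smashUnit A u ≫ s.smashUnit A u' ≫ h = s.smashUnit A (u * u') ≫ h := by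
  rw [← Category.assoc, smashUnit_mul]

theorem hoSmashRight_smashUnit (A : D) (u : ℤˣ) :
    hoSmashRight T (s.smashUnit A u) = s.smashUnit (A ⊗ T) u := by
  rcases Int.units_eq_one_or u with rfl | rfl <;>
    simp [smashUnit_neg_one, hoSmashRight_smashSign]

theorem firstFactor_permSign (V : D) [IsCofibrant V] {m : ℕ} (γ : Equiv.Perm (Fin m)) (n : ℕ) :
    firstFactor T V (hoSmashLeft V (permSign s.hom γ)) n =
      s.smashUnit (smashPow T V n) (Equiv.Perm.sign γ) := by
  induction n with
  | zero =>
    change hoSmashLeft V (permSign s.hom γ) = s.smashUnit V _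
    rcases Int.units_eq_one_or (Equiv.Perm.sign γ) with h | h <;> rw [permSign, h]
    · rw [if_neg (by decide), smashUnit_one, hoSmashLeft_id]
    · rw [if_pos rfl, smashUnit_neg_one, smashSign_eq]
  | succ n ih =>
    change hoSmashRight T (firstFactor T V _ n) = s.smashUnit (smashPow T V n ⊗ T) _
    exact (congrArg (hoSmashRight T) ih).trans (s.hoSmashRight_smashUnit _ _)

end CircleSign

end Sign

/-! ### The action of the injection monoid on stable homotopy groups -/

section Restriction

/-- The permutation of `{0, …, n-1}` given by a permutation of `ℕ` which fixes all `i ≥ n`; the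
identity for other permutations of `ℕ`. -/
noncomputable def permRestrict (n : ℕ) (g : Equiv.Perm ℕ) : Equiv.Perm (Fin n) :=
  open Classical in
  if h : ∀ i, n ≤ i → g i = i then
    Fin.equivSubtype.symm.permCongr (g.subtypePerm (p := (· < n)) fun i => by
      constructor
      · intro hi
        by_contra hc
        rw [h i (not_lt.1 hc)] at hi
        exact hc hi
      · intro hi
        by_contra hc
        exact absurd (g.injective (h (g i) (not_lt.1 hc))) (by omega))
  else 1

theorem permRestrict_apply {n : ℕ} {g : Equiv.Perm ℕ} (h : ∀ i, n ≤ i → g i = i) (i : Fin n) :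
    (permRestrict n g i : ℕ) = g i := by
  rw [permRestrict, dif_pos h]
  rfl

theorem permRestrict_one (n : ℕ) : permRestrict n 1 = 1 := by
  ext i
  rw [permRestrict_apply (fun _ _ => rfl)]
  rfl

theorem permRestrict_mul {n : ℕ} {g h : Equiv.Perm ℕ} (hg : ∀ i, n ≤ i → g i = i)
    (hh : ∀ i, n ≤ i → h i = i) : permRestrict n (g * h) = permRestrict n g * permRestrict n h := by
  ext i
  rw [permRestrict_apply, Equiv.Perm.mul_apply, Equiv.Perm.mul_apply, permRestrict_apply hg,
    permRestrict_apply hh]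
  intro i hi
  rw [Equiv.Perm.mul_apply, hh i hi, hg i hi]

theorem permRestrict_succ {n : ℕ} {g : Equiv.Perm ℕ} (h : ∀ i, n ≤ i → g i = i) :
    permRestrict (n + 1) g = permAddOne (permRestrict n g) := by
  ext i
  rw [permRestrict_apply fun i hi => h i (by omega)]
  refine Fin.lastCases ?_ (fun i => ?_) i
  · rw [permAddOne_last]
    exact h _ le_rfl
  · rw [permAddOne_castSucc]
    exact (permRestrict_apply h i).symm

theorem permRestrict_swap (n : ℕ) : permRestrict (n + 2) (Equiv.swap n (n + 1)) = lastSwap n := by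
  ext i
  rw [permRestrict_apply fun i hi => Equiv.swap_apply_of_ne_of_ne (by omega) (by omega)]
  refine Fin.lastCases ?_ (fun i => Fin.lastCases ?_ (fun i => ?_) i) i
  · rw [lastSwap_last]
    exact Equiv.swap_apply_right _ _
  · rw [lastSwap_castSucc_last]
    exact Equiv.swap_apply_left _ _
  · rw [lastSwap_castSucc_castSucc]
    exact Equiv.swap_apply_of_ne_of_ne (by simp; omega) (by simp; omega)

theorem permRestrict_extendDomain {n : ℕ} (γ : Equiv.Perm (Fin n)) :
    permRestrict n (γ.extendDomain Fin.equivSubtype) = γ := by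
  ext i
  rw [permRestrict_apply fun i hi =>
    Equiv.Perm.extendDomain_apply_not_subtype _ _ (not_lt.2 hi)]
  exact Equiv.Perm.extendDomain_apply_subtype γ Fin.equivSubtype i.2

@[simp] theorem sign_permAddOne {n : ℕ} (γ : Equiv.Perm (Fin n)) :
    Equiv.Perm.sign (permAddOne γ) = Equiv.Perm.sign γ := by
  rw [permAddOne, Equiv.Perm.sign_permCongr, Equiv.optionCongr_sign]

end Restriction

section OfSwap

/-- A tower in which the transposition of two new letters acts trivially is a `PermTower`, since
these transpositions generate the permutations of the new letters. -/
def PermTower.ofSwap {S : Type*} (level : S → ℕ) (stab : S → S) (act : Equiv.Perm ℕ → S → S)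
    (level_stab : ∀ r, level (stab r) = level r + 1)
    (level_act : ∀ g r, level (act g r) = level r)
    (act_one : ∀ r, act 1 r = r)
    (act_mul : ∀ (g h : Equiv.Perm ℕ) (r), (∀ i, level r ≤ i → g i = i) →
      (∀ i, level r ≤ i → h i = i) → act (g * h) r = act g (act h r))
    (stab_act : ∀ (g : Equiv.Perm ℕ) (r), (∀ i, level r ≤ i → g i = i) →
      stab (act g r) = act g (stab r))
    (act_swap : ∀ r, act (Equiv.swap (level r) (level r + 1)) (stab (stab r)) = stab (stab r)) :
    PermTower S where
  level := level
  stab := stab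
  act := act
  level_stab := level_stab
  level_act := level_act
  act_mul := act_mul
  stab_act := stab_act
  act_stab := by
    have hl : ∀ (j : ℕ) (r : S), level (stab^[j] r) = level r + j := by
      intro j r
      induction j with
      | zero => rfl
      | succ j ih => rw [Function.iterate_succ_apply', level_stab, ih]; rfl
    have hs : ∀ (r : S) (k l : ℕ), act (Equiv.swap (level r + k) (level r + k + 1))
        (stab^[l + (k + 2)] r) = stab^[l + (k + 2)] r := by
      intro r k l
      induction l with
      | zero =>
        have := act_swap (stab^[k] r)
        rwa [hl, ← Function.iterate_succ_apply' stab, ← Function.iterate_succ_apply' stab,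
          show k.succ.succ = 0 + (k + 2) by omega] at this
      | succ l ih =>
        rw [show l + 1 + (k + 2) = (l + (k + 2)) + 1 by omega, Function.iterate_succ_apply',
          ← stab_act, ih]
        intro i hi
        rw [hl] at hi
        exact Equiv.swap_apply_of_ne_of_ne (by omega) (by omega)
    intro g r j
    induction j generalizing g with
    | zero =>
      intro h h'
      have : g = 1 := by
        ext i
        rcases lt_or_ge i (level r) with hi | hi
        exacts [h i hi, h' i hi]
      rw [this, act_one]
    | succ j ih =>
      -- move the image of the last letter to the end by transpositions of adjacent letters
      have key : ∀ (d : ℕ) (g : Equiv.Perm ℕ), g (level r + j) + d = level r + j →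
          (∀ i < level r, g i = i) → (∀ i, level r + (j + 1) ≤ i → g i = i) →
          act g (stab^[j + 1] r) = stab^[j + 1] r := by
        intro d
        induction d with
        | zero =>
          intro g hd h h'
          have h'' : ∀ i, level r + j ≤ i → g i = i := fun i hi => by
            rcases hi.eq_or_lt with rfl | hi
            exacts [hd, h' i (by omega)]
          rw [Function.iterate_succ_apply', ← stab_act, ih g h h'']
          intro i hi
          rw [hl] at hi
          exact h'' i hi
        | succ d ihd =>
          intro g hd h h'
          set p := g (level r + j) with hp
          have hmp : level r ≤ p := by
            by_contra hc
            have := g.injective ((h p (not_le.1 hc)).trans hp)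
            omega
          obtain ⟨k, hk⟩ := Nat.exists_eq_add_of_le hmp
          have hsw : ∀ i, i ≠ p → i ≠ p + 1 → Equiv.swap p (p + 1) i = i :=
            fun i h₁ h₂ => Equiv.swap_apply_of_ne_of_ne h₁ h₂
          have e : g = Equiv.swap p (p + 1) * (Equiv.swap p (p + 1) * g) := by
            rw [← mul_assoc, Equiv.swap_mul_self, one_mul]
          have s₂ : ∀ i, level r + (j + 1) ≤ i → (Equiv.swap p (p + 1) * g) i = i :=
            fun i hi => by
              rw [Equiv.Perm.mul_apply, h' i hi, hsw i (by omega) (by omega)]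
          have a₂ : act (Equiv.swap p (p + 1) * g) (stab^[j + 1] r) = stab^[j + 1] r := by
            refine ihd _ ?_ (fun i hi => ?_) s₂
            · rw [Equiv.Perm.mul_apply, ← hp, Equiv.swap_apply_left]
              omega
            · rw [Equiv.Perm.mul_apply, h i hi, hsw i (by omega) (by omega)]
          rw [e, act_mul, a₂]
          · have := hs r k (j + 1 - (k + 2))
            rwa [← hk, Nat.sub_add_cancel (by omega)] at this
          · intro i hi
            rw [hl] at hi
            exact hsw i (by omega) (by omega)
          · intro i hi
            rw [hl] at hi
            exact s₂ i hi
      intro h h'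
      refine key (level r + j - g (level r + j)) g (Nat.add_sub_of_le ?_) h h'
      by_contra hc
      have := g.injective (h' (g (level r + j)) (by omega))
      omega

end OfSwap

section StableTower

variable {D : Type u} [Category.{v} D] [MonoidalCategory D] [ModelCategory D] {T : D}

theorem StableRep.ext_map {q : ℤ} {V : D} {X : Spectrum T} {l d : ℕ} {h : (d : ℤ) + 1 = q + l}
    {f g : (toHo D).obj (smashPow T V d ⊗ T) ⟶ (toHo D).obj (X.obj l)} (e : f = g) :
    (StableRep.mk l d h f : StableRep q V X) = StableRep.mk l d h g := by rw [e]

variable [IsCircle T]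

theorem StablePi.map_id (q : ℤ) (V : D) (X : Spectrum T) (x : StablePi q V X) :
    StablePi.map q V (𝟙 X) x = x := by
  induction x using Quot.ind with
  | mk r =>
    refine congrArg (Quot.mk _) ?_
    refine (StableRep.ext_map (g := r.map) ?_).trans rfl
    exact (congrArg (r.map ≫ ·) ((toHo D).map_id _)).trans (Category.comp_id _)

variable [SymmetricCategory D] [MonoidalClosed D] [MonoidalModel D]
  (s : CircleSign T)

theorem smashUnit_mul_act (X : SymSpectrum T) {A : D} {m : ℕ}
    (a : (toHo D).obj (A ⊗ T) ⟶ (toHo D).obj (X.obj m)) (u u' : ℤˣ) (γ δ : Equiv.Perm (Fin m)) :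
    s.smashUnit A (u * u') ≫ a ≫ (toHo D).map (X.act m (γ * δ)) =
      s.smashUnit A u ≫ (s.smashUnit A u' ≫ a ≫ (toHo D).map (X.act m δ)) ≫
        (toHo D).map (X.act m γ) := by
  rw [X.act_mul, ← s.smashUnit_mul, Functor.map_comp]
  simp only [Category.assoc]

theorem smashUnit_stab (X : SymSpectrum T) {A : D} {m : ℕ}
    (a : (toHo D).obj (A ⊗ T) ⟶ (toHo D).obj (X.obj m)) (u : ℤˣ) (γ : Equiv.Perm (Fin m)) :
    hoSmashRight T (s.smashUnit A u ≫ a ≫ (toHo D).map (X.act m γ)) ≫ (toHo D).map (X.σ m) =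
      s.smashUnit (A ⊗ T) u ≫ (hoSmashRight T a ≫ (toHo D).map (X.σ m)) ≫
        (toHo D).map (X.act (m + 1) (permAddOne γ)) := by
  rw [hoSmashRight_comp, hoSmashRight_comp, hoSmashRight_map, s.hoSmashRight_smashUnit]
  simp only [Category.assoc]
  rw [← Functor.map_comp, X.act_σ, Functor.map_comp]

/-- The transposition of two new letters acts trivially: its action on `X_{m+2}` is the symmetry of
`T ∧ T`, which is the sign and cancels with the sign in the action. -/
theorem smashSign_stab_stab (X : SymSpectrum T) {A : D} {m : ℕ}
    (a : (toHo D).obj (A ⊗ T) ⟶ (toHo D).obj (X.obj m)) :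
    s.smashSign ((A ⊗ T) ⊗ T) ≫
      (hoSmashRight T (hoSmashRight T a ≫ (toHo D).map (X.σ m)) ≫ (toHo D).map (X.σ (m + 1))) ≫
        (toHo D).map (X.act (m + 2) (lastSwap m)) =
      hoSmashRight T (hoSmashRight T a ≫ (toHo D).map (X.σ m)) ≫ (toHo D).map (X.σ (m + 1)) := by
  have h : (toHo D).map (X.σ m ▷ T) ≫ (toHo D).map (X.σ (m + 1)) ≫
      (toHo D).map (X.act (m + 2) (lastSwap m)) = s.smashSign (X.obj m ⊗ T) ≫
        (toHo D).map (X.σ m ▷ T) ≫ (toHo D).map (X.σ (m + 1)) := by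
    rw [← s.map_twistLast]
    simp only [← Functor.map_comp]
    rw [X.twist_σ, Category.assoc]
  rw [hoSmashRight_comp, hoSmashRight_map]
  simp only [Category.assoc]
  rw [h, ← Category.assoc (hoSmashRight T (hoSmashRight T a)), s.smashSign_natural, Category.assoc,
    s.smashSign_smashSign_assoc]

theorem StableRep.perm_eq {q : ℤ} {V : D} [IsCofibrant V] {X : SymSpectrum T}
    (r : StableRep q V X.toSpectrum) (γ : Equiv.Perm (Fin r.level)) :
    StableRep.perm s r γ = StableRep.mk r.level r.dim r.dim_eq
      (s.smashUnit (smashPow T V r.dim) (Equiv.Perm.sign γ) ≫ r.map ≫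
        (toHo D).map (X.act r.level γ)) := by
  have h := s.firstFactor_permSign V γ r.dim
  exact StableRep.ext_map (congrArg (· ≫ r.map ≫ (toHo D).map (X.act r.level γ)) h)

/-- The sets `[V ∧ T^{q+m}, X_m]` with the action of `Σ_m` twisted by the sign. -/
noncomputable def stableTower (q : ℤ) (V : D) [IsCofibrant V] (X : SymSpectrum T) :
    PermTower (StableRep q V X.toSpectrum) :=
  PermTower.ofSwap (fun r => r.level) StableRep.stab
    (fun g r => r.perm s (permRestrict r.level g)) (fun _ => rfl) (fun _ _ => rfl)
    (fun r => by
      rw [permRestrict_one, StableRep.perm_eq]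
      refine (StableRep.ext_map (g := r.map) ?_).trans rfl
      rw [X.act_one, Equiv.Perm.sign_one, s.smashUnit_one, CategoryTheory.Functor.map_id]
      exact (Category.id_comp _).trans (Category.comp_id _))
    (fun g h r hg hh => by
      rw [permRestrict_mul hg hh, StableRep.perm_eq, StableRep.perm_eq, StableRep.perm_eq]
      refine StableRep.ext_map ?_
      rw [Equiv.Perm.sign_mul]
      exact smashUnit_mul_act s X r.map _ _ _ _)
    (fun g r h => by
      rw [StableRep.perm_eq, StableRep.perm_eq]
      refine StableRep.ext_map ?_
      change _ = s.smashUnit (smashPow T V r.dim ⊗ T) (Equiv.Perm.sign (permRestrict (r.level + 1) g)) ≫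
        (hoSmashRight T r.map ≫ (toHo D).map (X.σ r.level)) ≫
        (toHo D).map (X.act (r.level + 1) (permRestrict (r.level + 1) g))
      rw [permRestrict_succ h, sign_permAddOne]
      exact smashUnit_stab s X r.map _ _)
    (fun r => by
      rw [StableRep.perm_eq]
      refine (StableRep.ext_map (g := r.stab.stab.map) ?_).trans rfl
      change s.smashUnit ((smashPow T V r.dim ⊗ T) ⊗ T)
        (Equiv.Perm.sign (permRestrict (r.level + 2) (Equiv.swap r.level (r.level + 1)))) ≫
        (hoSmashRight T (hoSmashRight T r.map ≫ (toHo D).map (X.σ r.level)) ≫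
          (toHo D).map (X.σ (r.level + 1))) ≫
        (toHo D).map (X.act (r.level + 2)
          (permRestrict (r.level + 2) (Equiv.swap r.level (r.level + 1)))) = _
      rw [permRestrict_swap, lastSwap, Equiv.Perm.sign_swap (by simp [Fin.ext_iff]),
        s.smashUnit_neg_one]
      exact smashSign_stab_stab s X r.map)

theorem stableTower_act {q : ℤ} {V : D} [IsCofibrant V] {X : SymSpectrum T} (g : Equiv.Perm ℕ)
    (r : StableRep q V X.toSpectrum) :
    (stableTower s q V X).act g r = r.perm s (permRestrict r.level g) := rfl

theorem injAct_iff {q : ℤ} {V : D} [IsCofibrant V] {X : SymSpectrum T} {f : ℕ ↪ ℕ}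
    {x y : StablePi q V X.toSpectrum} :
    InjAct s q V X f x y ↔ (stableTower s q V X).inj f x = y := by
  refine Iff.trans ?_ (PermTower.injRel_iff (stableTower s q V X))
  have hl : ∀ (j : ℕ) (r : StableRep q V X.toSpectrum), (StableRep.stab^[j] r).level = r.level + j :=
    (stableTower s q V X).level_iterate
  constructor
  · rintro ⟨r, j, γ, h, rfl, rfl⟩
    refine ⟨r, j, γ.extendDomain Fin.equivSubtype, fun i hi => ?_, fun i hi => ?_, rfl, ?_⟩
    · have hi' : i < (StableRep.stab^[j] r).level := by
        rw [hl]
        exact Nat.lt_add_right j hi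
      exact (Equiv.Perm.extendDomain_apply_subtype γ Fin.equivSubtype hi').trans (h ⟨i, hi'⟩ hi)
    · refine Equiv.Perm.extendDomain_apply_not_subtype _ _ ?_
      rw [hl, not_lt]
      exact hi
    · exact congrArg (fun δ => (StableRep.perm s (StableRep.stab^[j] r) δ).cls)
        (permRestrict_extendDomain γ)
  · rintro ⟨r, j, g, h, h', rfl, rfl⟩
    refine ⟨r, j, permRestrict _ g, fun i hi => ?_, rfl, rfl⟩
    rw [permRestrict_apply]
    · exact h i hi
    · intro i hi
      rw [hl] at hi
      exact h' i hi

variable {B : ObjectProperty (CofibrantObject D)}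

instance isCofibrant_obj (V : CofibrantObject D) : IsCofibrant V.obj := V.property

theorem semistable_iff {X : SymSpectrum T} : Semistable B s X ↔ ∀ V, B V → ∀ (q : ℤ) (f : ℕ ↪ ℕ)
    (x : StablePi q V.obj X.toSpectrum), (stableTower s q V.obj X).inj f x = x := by
  simp only [Semistable, injAct_iff]
  exact ⟨fun h V hV q f x => h V hV q f x _ rfl, fun h V hV q f x y e => e ▸ h V hV q f x⟩

theorem semistable_iff_cycleSurjective {X : SymSpectrum T} :
    Semistable B s X ↔ CycleSurjective B s X := by
  rw [semistable_iff]
  simp only [CycleSurjective, injAct_iff]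
  exact ⟨fun h V hV q y => ⟨y, h V hV q _ y⟩,
    fun h V hV q => (stableTower s q V.obj X).inj_eq_of_surjective (h V hV q)⟩

theorem smashUnit_act_comp {X Y : SymSpectrum T} (k : X ⟶ Y) {A : D} {m : ℕ}
    (a : (toHo D).obj (A ⊗ T) ⟶ (toHo D).obj (X.obj m)) (u : ℤˣ) (γ : Equiv.Perm (Fin m)) :
    (s.smashUnit A u ≫ a ≫ (toHo D).map (X.act m γ)) ≫ (toHo D).map (k.app m) =
      s.smashUnit A u ≫ (a ≫ (toHo D).map (k.app m)) ≫ (toHo D).map (Y.act m γ) := by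
  simp only [Category.assoc]
  rw [← Functor.map_comp, ← Functor.map_comp, k.act_comm]

theorem stablePi_map_inj {q : ℤ} {V : D} [IsCofibrant V] {X Y : SymSpectrum T} (k : X ⟶ Y)
    (f : ℕ ↪ ℕ) (x : StablePi q V X.toSpectrum) :
    StablePi.map q V ((forgetSym T).map k) ((stableTower s q V X).inj f x) =
      (stableTower s q V Y).inj f (StablePi.map q V ((forgetSym T).map k) x) := by
  refine PermTower.map_inj (P := stableTower s q V X) (P' := stableTower s q V Y)
    (StableRep.comp ((forgetSym T).map k)) (fun _ => rfl) (fun r => StableRep.comp_stab _ r)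
    (fun g r => ?_) _ (fun _ => rfl) f x
  refine Eq.trans ?_ (StableRep.perm_eq s (StableRep.comp ((forgetSym T).map k) r) _).symm
  rw [stableTower_act, StableRep.perm_eq]
  exact StableRep.ext_map (smashUnit_act_comp s k r.map _ _)

/-- A symmetric spectrum whose stable homotopy groups inject into those of a semistable one is
semistable. -/
theorem Semistable.of_injective {X Y : SymSpectrum T} (k : X ⟶ Y) (hY : Semistable B s Y)
    (hk : ∀ V, B V → ∀ q : ℤ, Function.Injective (StablePi.map q V.obj ((forgetSym T).map k))) :
    Semistable B s X := by
  rw [semistable_iff] at hY ⊢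
  intro V hV q f x
  apply hk V hV q
  rw [stablePi_map_inj, hY V hV]

theorem Semistable.of_surjective {X Y : SymSpectrum T} (k : X ⟶ Y) (hX : Semistable B s X)
    (hk : ∀ V, B V → ∀ q : ℤ, Function.Surjective (StablePi.map q V.obj ((forgetSym T).map k))) :
    Semistable B s Y := by
  rw [semistable_iff] at hX ⊢
  intro V hV q f y
  obtain ⟨x, rfl⟩ := hk V hV q y
  rw [← stablePi_map_inj, hX V hV]

/-- For semistable `X`, natural transformations are determined by their value on the identity of `X`.
Conversely, `x` and `f · x` have the same image under `c_X`, as maps to semistable spectra commute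
with the action. -/
theorem semistable_iff_trueMap_bijective {X : SymSpectrum T} :
    Semistable B s X ↔ ∀ V, B V → ∀ q : ℤ, Function.Bijective (trueMap B s q V.obj X) := by
  constructor
  · intro h V hV q
    constructor
    · intro x y e
      have e' := congrFun (congrFun (congrFun (congrArg Subtype.val e) X) h) (𝟙 X)
      have hid : (forgetSym T).map (𝟙 X) = 𝟙 X.toSpectrum := (forgetSym T).map_id X
      change StablePi.map q V.obj ((forgetSym T).map (𝟙 X)) x =
        StablePi.map q V.obj ((forgetSym T).map (𝟙 X)) y at e'
      rwa [hid, StablePi.map_id, StablePi.map_id] at e'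
    · intro g
      refine ⟨g.1 X h (𝟙 X), Subtype.ext (funext fun Y => funext fun hY => funext fun k => ?_)⟩
      change StablePi.map q V.obj ((forgetSym T).map k) (g.1 X h (𝟙 X)) = g.1 Y hY k
      rw [← g.2 X Y h hY (𝟙 X) k, Category.id_comp]
  · intro h
    rw [semistable_iff]
    intro V hV q f x
    refine (h V hV q).1 (Subtype.ext (funext fun Y => funext fun hY => funext fun k => ?_))
    change StablePi.map q V.obj ((forgetSym T).map k) _ = StablePi.map q V.obj ((forgetSym T).map k) x
    rw [stablePi_map_inj, (semistable_iff s).1 hY V hV]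

end StableTower

/-! ### The map from the smash product with the circle to the shift -/

section LamPiEquiv

/-- A map of towers is bijective on colimits if it is injective up to stabilization and hits all
stabilizations. -/
theorem PermTower.bijective_of_reps {S S' : Type*} {P : PermTower S} {P' : PermTower S'} (F : S → S')
    (hs : ∀ r, F (P.stab r) = P'.stab (F r)) (F' : P.Colim → P'.Colim)
    (hF : ∀ r, F' (P.cls r) = P'.cls (F r)) (hi : ∀ r r', F r = F r' → P.cls r = P.cls r')
    (hsurj : ∀ r', ∃ r, F r = P'.stab r') : Function.Bijective F' := by
  have hs' : ∀ j r, F (P.stab^[j] r) = P'.stab^[j] (F r) := fun j r =>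
    Function.Semiconj.iterate_right (f := F) hs j r
  constructor
  · intro x y h
    obtain ⟨r, rfl⟩ := P.cls_surjective x
    obtain ⟨r', rfl⟩ := P.cls_surjective y
    rw [hF, hF] at h
    obtain ⟨i, j, e⟩ := P'.cls_eq_iff.1 h
    rw [← hs', ← hs'] at e
    rw [← P.cls_iterate i r, ← P.cls_iterate j r', hi _ _ e]
  · intro y
    obtain ⟨r', rfl⟩ := P'.cls_surjective y
    obtain ⟨r, hr⟩ := hsurj r'
    exact ⟨P.cls r, by rw [hF, hr, P'.cls_stab]⟩

theorem sign_chi (n : ℕ) : Equiv.Perm.sign (chi n) = (-1) ^ n := by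
  rw [chi, sign_finRotate, Nat.add_sub_cancel]

section Braiding

variable {D : Type u} [Category.{v} D] [MonoidalCategory D] [SymmetricCategory D]

theorem braiding_tensor_right_eq (T Y : D) :
    (β_ (Y ⊗ T) T).hom = twistLast T Y ≫ (β_ Y T).hom ▷ T ≫ (α_ T Y T).hom := by
  rw [← cancel_epi (α_ Y T T).inv, twistLast]
  have := BraidedCategory.hexagon_reverse Y T T
  rw [← cancel_mono (α_ T Y T).inv]
  simp only [Category.assoc] at this ⊢
  rw [this]
  simp

end Braiding

variable {D : Type u} [Category.{v} D] [MonoidalCategory D] [ModelCategory D]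
  [SymmetricCategory D] [MonoidalClosed D] [MonoidalModel D] {T : D} [IsCircle T]
  (s : CircleSign T)

theorem hoSmashRight_twistLast {C Y : D} (c : (toHo D).obj C ⟶ (toHo D).obj (Y ⊗ T)) :
    hoSmashRight T c ≫ (toHo D).map (twistLast T Y) = s.smashUnit C (-1) ≫ hoSmashRight T c := by
  rw [s.map_twistLast, s.smashSign_natural, s.smashUnit_neg_one]

/-- The map `[V ∧ T^p, X_m] ⟶ [V ∧ T^{p+1}, T ∧ X_m]`, `a ↦ ± T ∧ a`; the sign `(-1)^m` makes it
compatible with stabilization. -/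
noncomputable def suspRep {q : ℤ} {V : D} {X : SymSpectrum T} (r : StableRep q V X.toSpectrum) :
    StableRep (q + 1) V (smashT X).toSpectrum where
  level := r.level
  dim := r.dim + 1
  dim_eq := by have := r.dim_eq; push_cast; omega
  map := s.smashUnit (smashPow T V r.dim ⊗ T) ((-1) ^ r.level) ≫ hoSmashRight T r.map ≫
    (toHo D).map (β_ (X.obj r.level) T).hom

theorem suspRep_stab_map {X : SymSpectrum T} {A : D} {m : ℕ}
    (a : (toHo D).obj (A ⊗ T) ⟶ (toHo D).obj (X.obj m)) :
    s.smashUnit ((A ⊗ T) ⊗ T) ((-1) ^ (m + 1)) ≫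
      hoSmashRight T (hoSmashRight T a ≫ (toHo D).map (X.σ m)) ≫
        (toHo D).map (β_ (X.obj (m + 1)) T).hom =
    hoSmashRight T (s.smashUnit (A ⊗ T) ((-1) ^ m) ≫ hoSmashRight T a ≫
      (toHo D).map (β_ (X.obj m) T).hom) ≫ (toHo D).map ((smashT X).σ m) := by
  change _ = _ ≫ (toHo D).map ((α_ T (X.obj m) T).hom ≫ T ◁ X.σ m)
  simp only [hoSmashRight_comp, hoSmashRight_map, Category.assoc, s.hoSmashRight_smashUnit]
  rw [← Functor.map_comp, BraidedCategory.braiding_naturality_left, braiding_tensor_right_eq]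
  simp only [Functor.map_comp, Category.assoc]
  rw [reassoc_of% (hoSmashRight_twistLast s (hoSmashRight T a)), s.smashUnit_mul_assoc, pow_succ,
    mul_assoc, Int.units_mul_self, mul_one]

theorem suspRep_stab {q : ℤ} {V : D} {X : SymSpectrum T} (r : StableRep q V X.toSpectrum) :
    suspRep s r.stab = (suspRep s r).stab :=
  StableRep.ext_map (suspRep_stab_map s r.map)

/-- The map `[V ∧ T^p, T ∧ X_m] ⟶ [V ∧ T^p, X_{m+1}]`, up to the same sign as in `suspRep`. -/
noncomputable def desuspRep {q : ℤ} {V : D} {X : SymSpectrum T}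
    (r : StableRep (q + 1) V (smashT X).toSpectrum) : StableRep q V X.toSpectrum where
  level := r.level + 1
  dim := r.dim
  dim_eq := by have := r.dim_eq; push_cast; omega
  map := s.smashUnit (smashPow T V r.dim) ((-1) ^ r.level) ≫ r.map ≫
    (toHo D).map ((β_ T (X.obj r.level)).hom ≫ X.σ r.level)

theorem desuspRep_suspRep_map {X : SymSpectrum T} {A : D} {m : ℕ} (u : ℤˣ)
    (a : (toHo D).obj A ⟶ (toHo D).obj (X.obj m)) :
    s.smashUnit A u ≫ (s.smashUnit A u ≫ hoSmashRight T a ≫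
      (toHo D).map (β_ (X.obj m) T).hom) ≫ (toHo D).map ((β_ T (X.obj m)).hom ≫ X.σ m) =
    hoSmashRight T a ≫ (toHo D).map (X.σ m) := by
  simp only [Category.assoc]
  rw [← Functor.map_comp, SymmetricCategory.symmetry_assoc, s.smashUnit_mul_assoc,
    Int.units_mul_self, s.smashUnit_one, Category.id_comp]

theorem desuspRep_suspRep {q : ℤ} {V : D} {X : SymSpectrum T} (r : StableRep q V X.toSpectrum) :
    desuspRep s (suspRep s r) = r.stab :=
  StableRep.ext_map (desuspRep_suspRep_map s _ r.map)

theorem suspRep_desuspRep_map {X : SymSpectrum T} {A : D} {m : ℕ}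
    (b : (toHo D).obj (A ⊗ T) ⟶ (toHo D).obj (T ⊗ X.obj m)) :
    s.smashUnit (A ⊗ T) ((-1) ^ (m + 1)) ≫ hoSmashRight T (s.smashUnit A ((-1) ^ m) ≫ b ≫
      (toHo D).map ((β_ T (X.obj m)).hom ≫ X.σ m)) ≫ (toHo D).map (β_ (X.obj (m + 1)) T).hom =
    hoSmashRight T b ≫ (toHo D).map ((smashT X).σ m) := by
  change _ = _ ≫ (toHo D).map ((α_ T (X.obj m) T).hom ≫ T ◁ X.σ m)
  simp only [hoSmashRight_comp, hoSmashRight_map, Functor.map_comp, Category.assoc,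
    s.hoSmashRight_smashUnit]
  rw [← Functor.map_comp (toHo D) (X.σ m ▷ T), BraidedCategory.braiding_naturality_left,
    braiding_tensor_right_eq]
  simp only [Functor.map_comp, Category.assoc]
  have h := hoSmashRight_twistLast s (b ≫ (toHo D).map (β_ T (X.obj m)).hom)
  simp only [hoSmashRight_comp, hoSmashRight_map, Category.assoc] at h
  rw [reassoc_of% h, s.smashUnit_mul_assoc, s.smashUnit_mul_assoc, pow_succ,
    mul_right_comm (_ ^ m), Int.units_mul_self, one_mul, Int.units_mul_self, s.smashUnit_one,
    Category.id_comp, ← Functor.map_comp_assoc, ← comp_whiskerRight, SymmetricCategory.symmetry,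
    id_whiskerRight, CategoryTheory.Functor.map_id, Category.id_comp]

theorem suspRep_desuspRep {q : ℤ} {V : D} {X : SymSpectrum T}
    (r : StableRep (q + 1) V (smashT X).toSpectrum) : suspRep s (desuspRep s r) = r.stab :=
  StableRep.ext_map (suspRep_desuspRep_map s r.map)

/-- The suspension map `π_q^V(X) ⟶ π_{q+1}^V(T ∧ X)`. -/
noncomputable def suspMap (q : ℤ) (V : D) (X : SymSpectrum T) :
    StablePi q V X.toSpectrum → StablePi (q + 1) V (smashT X).toSpectrum :=
  Quot.map (suspRep s) fun r _ h => h ▸ suspRep_stab s r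

theorem suspMap_bijective (q : ℤ) (V : D) [IsCofibrant V] (X : SymSpectrum T) :
    Function.Bijective (suspMap s q V X) := by
  refine PermTower.bijective_of_reps (P := stableTower s q V X)
    (P' := stableTower s (q + 1) V (smashT X)) (suspRep s) (suspRep_stab s) _ (fun _ => rfl)
    (fun r r' h => ?_) fun r' => ⟨_, suspRep_desuspRep s r'⟩
  have h' := congrArg (desuspRep s) h
  rw [desuspRep_suspRep, desuspRep_suspRep] at h'
  rw [← PermTower.cls_stab, ← PermTower.cls_stab _ r']
  exact congrArg _ h'

/-- A representative for `sh X` in level `m` is one for `X` in level `m + 1`. -/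
def unshiftRep {q : ℤ} {V : D} {X : SymSpectrum T} (r : StableRep (q + 1) V ((sh T).obj X).toSpectrum) :
    StableRep q V X.toSpectrum where
  level := r.level + 1
  dim := r.dim
  dim_eq := by have := r.dim_eq; push_cast; omega
  map := r.map

/-- The inverse of `unshiftRep`, up to stabilization. -/
noncomputable def shiftRep {q : ℤ} {V : D} {X : SymSpectrum T} (r : StableRep q V X.toSpectrum) :
    StableRep (q + 1) V ((sh T).obj X).toSpectrum where
  level := r.level
  dim := r.dim + 1
  dim_eq := by have := r.dim_eq; push_cast; omega
  map := r.stab.map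

/-- The bijection `π_{q+1}^V(sh X) ⟶ π_q^V(X)`. -/
noncomputable def unshiftMap (q : ℤ) (V : D) (X : SymSpectrum T) :
    StablePi (q + 1) V ((sh T).obj X).toSpectrum → StablePi q V X.toSpectrum :=
  Quot.map unshiftRep fun _ _ h => h ▸ rfl

theorem unshiftMap_bijective (s : CircleSign T) (q : ℤ) (V : D) [IsCofibrant V] (X : SymSpectrum T) :
    Function.Bijective (unshiftMap q V X) := by
  refine PermTower.bijective_of_reps (P := stableTower s (q + 1) V ((sh T).obj X))
    (P' := stableTower s q V X) unshiftRep (fun _ => rfl) _ (fun _ => rfl)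
    (fun r r' h => ?_) fun r' => ⟨shiftRep r', rfl⟩
  rw [← PermTower.cls_stab, ← PermTower.cls_stab _ r']
  exact congrArg ((stableTower s (q + 1) V ((sh T).obj X)).cls ∘ shiftRep) h

theorem inj_cycleOp_cls {q : ℤ} {V : D} [IsCofibrant V] {X : SymSpectrum T}
    (r : StableRep q V X.toSpectrum) :
    (stableTower s q V X).inj cycleOp r.cls = (StableRep.perm s r.stab (chi r.level)).cls := by
  refine (injAct_iff s).1 ⟨r, 1, chi r.level, fun i hi => ?_, rfl, rfl⟩
  exact congrArg Fin.val (chi_castSucc (⟨i, hi⟩ : Fin r.level))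

theorem lam_suspRep_map {X : SymSpectrum T} {A : D} {m : ℕ}
    (a : (toHo D).obj A ⟶ (toHo D).obj (X.obj m)) :
    (s.smashUnit A ((-1) ^ m) ≫ hoSmashRight T a ≫ (toHo D).map (β_ (X.obj m) T).hom) ≫
      (toHo D).map (lamApp X m) =
    s.smashUnit A (Equiv.Perm.sign (chi m)) ≫ (hoSmashRight T a ≫ (toHo D).map (X.σ m)) ≫
      (toHo D).map (X.act (m + 1) (chi m)) := by
  rw [sign_chi]
  simp only [Category.assoc, lamApp]
  rw [← Functor.map_comp, SymmetricCategory.symmetry_assoc, Functor.map_comp]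

/-- Under the identifications of `π_{q+1}^V(T ∧ X)` and `π_{q+1}^V(sh X)` with `π_q^V(X)`, the map
`λ_X` becomes the cycle operator. -/
theorem unshiftMap_lam_suspMap (q : ℤ) (V : D) [IsCofibrant V] (X : SymSpectrum T)
    (x : StablePi q V X.toSpectrum) :
    unshiftMap q V X (StablePi.map (q + 1) V ((forgetSym T).map (lam X)) (suspMap s q V X x)) =
      (stableTower s q V X).inj cycleOp x := by
  obtain ⟨r, rfl⟩ := (stableTower s q V X).cls_surjective x
  refine Eq.trans ?_ ((inj_cycleOp_cls s r).trans
    (congrArg StableRep.cls (StableRep.perm_eq s r.stab (chi r.level)))).symm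
  exact congrArg StableRep.cls (StableRep.ext_map (lam_suspRep_map s r.map))

variable {B : ObjectProperty (CofibrantObject D)}

theorem semistable_iff_inj_cycleOp_surjective {X : SymSpectrum T} :
    Semistable B s X ↔ ∀ V, B V → ∀ q : ℤ,
      Function.Surjective ((stableTower s q V.obj X).inj cycleOp) := by
  rw [semistable_iff_cycleSurjective]
  simp only [CycleSurjective, injAct_iff]
  rfl

theorem semistable_iff_piEquiv_lam {X : SymSpectrum T} :
    Semistable B s X ↔ PiEquiv B ((forgetSym T).map (lam X)) := by
  rw [semistable_iff_inj_cycleOp_surjective]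
  have key : ∀ (V : CofibrantObject D) (q : ℤ),
      Function.Surjective ((stableTower s q V.obj X).inj cycleOp) ↔
        Function.Bijective (StablePi.map (q + 1) V.obj ((forgetSym T).map (lam X))) := by
    intro V q
    have h : (unshiftMap q V.obj X ∘ StablePi.map (q + 1) V.obj ((forgetSym T).map (lam X))) ∘
        suspMap s q V.obj X = (stableTower s q V.obj X).inj cycleOp :=
      funext (unshiftMap_lam_suspMap s q V.obj X)
    rw [← Function.Bijective.of_comp_iff' (unshiftMap_bijective s q V.obj X),
      ← Function.Bijective.of_comp_iff _ (suspMap_bijective s q V.obj X), h]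
    exact ⟨fun h => ⟨PermTower.inj_cycleOp_injective _, h⟩, fun h => h.2⟩
  constructor
  · intro h V hV q
    obtain ⟨q, rfl⟩ : ∃ q', q = q' + 1 := ⟨q - 1, by omega⟩
    exact (key V q).1 (h V hV q)
  · intro h V hV q
    exact (key V q).2 (h V hV (q + 1))

end LamPiEquiv

/-! ### The derived adjunction between smash product and loops -/

section DerivedAdjunction

section

variable {D : Type u} [Category.{v} D] [MonoidalCategory D] [SymmetricCategory D] [MonoidalClosed D]

/-- The evaluation `Hom(T, Z) ∧ T ⟶ Z`. -/
def evalRight (T Z : D) : (ihom T).obj Z ⊗ T ⟶ Z :=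
  (β_ ((ihom T).obj Z) T).hom ≫ (ihom.ev T).app Z

/-- The adjoint `A ⟶ Hom(T, Z)` of a map `A ∧ T ⟶ Z`. -/
def curryRight {T A Z : D} (f : A ⊗ T ⟶ Z) : A ⟶ (ihom T).obj Z :=
  MonoidalClosed.curry ((β_ T A).hom ≫ f)

theorem whiskerRight_curry_evalRight {T A Z : D} (f : T ⊗ A ⟶ Z) :
    MonoidalClosed.curry f ▷ T ≫ evalRight T Z = (β_ A T).hom ≫ f := by
  rw [evalRight, BraidedCategory.braiding_naturality_left_assoc,
    MonoidalClosed.whiskerLeft_curry_ihom_ev_app]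

theorem curryRight_evalRight {T A Z : D} (f : A ⊗ T ⟶ Z) :
    curryRight f ▷ T ≫ evalRight T Z = f := by
  rw [curryRight, whiskerRight_curry_evalRight, SymmetricCategory.symmetry_assoc]

theorem evalRight_curryRight {T A Z : D} (f : A ⟶ (ihom T).obj Z) :
    curryRight (f ▷ T ≫ evalRight T Z) = f := by
  rw [curryRight, evalRight, BraidedCategory.braiding_naturality_left_assoc,
    SymmetricCategory.symmetry_assoc, ← MonoidalClosed.uncurry_eq, MonoidalClosed.curry_uncurry]

theorem evalRight_natural (T : D) {Z W : D} (f : Z ⟶ W) :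
    (ihom T).map f ▷ T ≫ evalRight T W = evalRight T Z ≫ f := by
  rw [evalRight, BraidedCategory.braiding_naturality_left_assoc, ihom.ev_naturality, evalRight,
    Category.assoc]

theorem curryRight_natural {T A Z W : D} (f : A ⊗ T ⟶ Z) (g : Z ⟶ W) :
    curryRight (f ≫ g) = curryRight f ≫ (ihom T).map g := by
  rw [curryRight, curryRight, ← MonoidalClosed.curry_natural_right, Category.assoc]

/-- The structure map of `Ω X`, in terms of evaluation. -/
theorem omegaσ_evalRight {T A B : D} (σ : A ⊗ T ⟶ B) :
    omegaσ σ ▷ T ≫ evalRight T B =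
      twistLast T ((ihom T).obj A) ≫ evalRight T A ▷ T ≫ σ := by
  rw [omegaσ, whiskerRight_curry_evalRight, braiding_tensor_right_eq, evalRight,
    comp_whiskerRight]
  simp only [Category.assoc, Iso.hom_inv_id_assoc]

end

variable {D : Type u} [Category.{v} D] [MonoidalCategory D] [ModelCategory D]
  [SymmetricCategory D] [MonoidalClosed D] [MonoidalModel D]

theorem fibration_ihom_map (V : D) [IsCofibrant V] {Z W : D} (p : Z ⟶ W) [Fibration p] :
    Fibration ((ihom V).map p) := by
  rw [fibration_iff, ← trivialCofibrations_rlp]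
  intro A B i hi
  obtain ⟨_, _⟩ := (mem_trivialCofibrations_iff i).1 hi
  rw [← (ihom.adjunction V).hasLiftingProperty_iff]
  have : Cofibration ((tensorLeft V).map i) := cofibration_whiskerLeft V i
  have : WeakEquivalence ((tensorLeft V).map i) := weakEquivalence_whiskerLeft_of_cofibration V i
  infer_instance

theorem weakEquivalence_ihom_map (V : D) [IsCofibrant V] {Z W : D} (p : Z ⟶ W) [Fibration p]
    [WeakEquivalence p] : WeakEquivalence ((ihom V).map p) := by
  have : trivialFibrations D ((ihom V).map p) := by
    rw [← cofibrations_rlp]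
    intro A B i hi
    have : Cofibration i := ⟨hi⟩
    rw [← (ihom.adjunction V).hasLiftingProperty_iff]
    have : Cofibration ((tensorLeft V).map i) := cofibration_whiskerLeft V i
    infer_instance
  exact ((mem_trivialFibrations_iff _).1 this).2

theorem isFibrant_ihom (V : D) [IsCofibrant V] (Z : D) [IsFibrant Z] :
    IsFibrant ((ihom V).obj Z) := by
  have : PreservesLimitsOfSize.{0, 0} (ihom V) := (ihom.adjunction V).rightAdjoint_preservesLimits
  rw [isFibrant_iff_of_isTerminal ((ihom V).map (terminal.from Z))
    (terminalIsTerminal.isTerminalObj (ihom V) _)]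
  exact fibration_ihom_map V _

theorem map_eq_of_rightHomotopyRel_evalRight (T : D) [IsCofibrant T] {A Z : D} [IsFibrant Z]
    {f g : A ⟶ (ihom T).obj Z}
    (h : RightHomotopyRel (f ▷ T ≫ evalRight T Z) (g ▷ T ≫ evalRight T Z)) :
    (toHo D).map f = (toHo D).map g := by
  obtain ⟨P, _, ⟨h⟩⟩ := h.exists_good_pathObject
  -- a path object of `Z` is mapped by `Hom(T, -)` to a path object of `Hom(T, Z)`
  have : WeakEquivalence ((ihom T).map P.ι) := by
    have := weakEquivalence_ihom_map T P.p₀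
    have : WeakEquivalence ((ihom T).map P.ι ≫ (ihom T).map P.p₀) := by
      rw [← Functor.map_comp, P.ι_p₀, CategoryTheory.Functor.map_id]
      infer_instance
    exact weakEquivalence_of_postcomp _ ((ihom T).map P.p₀)
  have e : (toHo D).map ((ihom T).map P.p₀) = (toHo D).map ((ihom T).map P.p₁) := by
    rw [← cancel_epi ((toHo D).map ((ihom T).map P.ι)), ← Functor.map_comp, ← Functor.map_comp,
      ← Functor.map_comp, ← Functor.map_comp, P.ι_p₀, P.ι_p₁]
  have hf : f = curryRight h.h ≫ (ihom T).map P.p₀ := by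
    rw [← curryRight_natural, h.h₀, evalRight_curryRight]
  have hg : g = curryRight h.h ≫ (ihom T).map P.p₁ := by
    rw [← curryRight_natural, h.h₁, evalRight_curryRight]
  refine (congrArg _ hf).trans (Eq.trans ?_ (congrArg _ hg).symm)
  rw [Functor.map_comp, Functor.map_comp, e]

/-- The derived adjunction `[A, Hom(T, Z)] ≅ [A ∧ T, Z]` for cofibrant `A` and fibrant `Z`. -/
theorem hoSmashRight_evalRight_bijective (T : D) [IsCircle T] (A Z : D) [IsCofibrant A]
    [IsFibrant Z] : Function.Bijective (fun φ : (toHo D).obj A ⟶ (toHo D).obj ((ihom T).obj Z) =>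
      hoSmashRight T φ ≫ (toHo D).map (evalRight T Z)) := by
  have := isFibrant_ihom T Z
  constructor
  · intro φ ψ h
    obtain ⟨f, rfl⟩ := map_surjective_of_isLocalization (toHo D) _ _ φ
    obtain ⟨g, rfl⟩ := map_surjective_of_isLocalization (toHo D) _ _ ψ
    dsimp only at h
    rw [hoSmashRight_map, hoSmashRight_map, ← Functor.map_comp, ← Functor.map_comp,
      ← RightHomotopyRel.iff_map_eq] at h
    exact map_eq_of_rightHomotopyRel_evalRight T h
  · intro φ
    obtain ⟨f, rfl⟩ := map_surjective_of_isLocalization (toHo D) _ _ φ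
    refine ⟨(toHo D).map (curryRight f), ?_⟩
    dsimp only
    rw [hoSmashRight_map, ← Functor.map_comp, curryRight_evalRight]

end DerivedAdjunction

/-! ### The functor `R` and `Ω`-spectra -/

section LoopShift

variable {D : Type u} [Category.{v} D] [MonoidalCategory D] [ModelCategory D]
  [SymmetricCategory D] [MonoidalClosed D] [MonoidalModel D] {T : D} [IsCircle T]
  (s : CircleSign T)

/-- The map `[V ∧ T^p, Hom(T, X_{m+1})] ⟶ [V ∧ T^{p+1}, X_{m+1}]` given by evaluation, up to the sign
`(-1)^m`, which makes it compatible with stabilization. -/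
noncomputable def unloopRep {q : ℤ} {V : D} {X : SymSpectrum T}
    (r : StableRep q V ((R T).obj X).toSpectrum) : StableRep q V X.toSpectrum where
  level := r.level + 1
  dim := r.dim + 1
  dim_eq := by have := r.dim_eq; push_cast; omega
  map := s.smashUnit (smashPow T V r.dim ⊗ T) ((-1) ^ r.level) ≫ hoSmashRight T r.map ≫
    (toHo D).map (evalRight T (X.obj (r.level + 1)))

theorem unloopRep_stab_map {X : SymSpectrum T} {A : D} {m : ℕ}
    (a : (toHo D).obj (A ⊗ T) ⟶ (toHo D).obj ((ihom T).obj (X.obj (m + 1)))) :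
    s.smashUnit ((A ⊗ T) ⊗ T) ((-1) ^ (m + 1)) ≫
      hoSmashRight T (hoSmashRight T a ≫ (toHo D).map (omegaσ (X.σ (m + 1)))) ≫
        (toHo D).map (evalRight T (X.obj (m + 2))) =
    hoSmashRight T (s.smashUnit (A ⊗ T) ((-1) ^ m) ≫ hoSmashRight T a ≫
      (toHo D).map (evalRight T (X.obj (m + 1)))) ≫ (toHo D).map (X.σ (m + 1)) := by
  simp only [hoSmashRight_comp, hoSmashRight_map, Category.assoc, s.hoSmashRight_smashUnit]
  rw [← Functor.map_comp, omegaσ_evalRight]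
  simp only [Functor.map_comp]
  rw [reassoc_of% (hoSmashRight_twistLast s (hoSmashRight T a)), s.smashUnit_mul_assoc, pow_succ,
    mul_assoc, Int.units_mul_self, mul_one]

theorem unloopRep_stab {q : ℤ} {V : D} {X : SymSpectrum T}
    (r : StableRep q V ((R T).obj X).toSpectrum) :
    unloopRep s r.stab = (unloopRep s r).stab :=
  StableRep.ext_map (unloopRep_stab_map s r.map)

/-- The comparison map `π_q^V(R X) ⟶ π_q^V(X)`. -/
noncomputable def unloopMap (q : ℤ) (V : D) (X : SymSpectrum T) :
    StablePi q V ((R T).obj X).toSpectrum → StablePi q V X.toSpectrum :=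
  Quot.map (unloopRep s) fun r _ h => h ▸ unloopRep_stab s r

theorem smashUnit_cancel {A Z : D} {u : ℤˣ} {φ ψ : (toHo D).obj (A ⊗ T) ⟶ (toHo D).obj Z}
    (h : s.smashUnit A u ≫ φ = s.smashUnit A u ≫ ψ) : φ = ψ := by
  have h' := congrArg (s.smashUnit A u ≫ ·) h
  simpa only [s.smashUnit_mul_assoc, Int.units_mul_self, s.smashUnit_one, Category.id_comp] using h'

theorem unloopMap_bijective (q : ℤ) (V : D) [IsCofibrant V] {X : SymSpectrum T}
    (hX : X.LevelFibrant) : Function.Bijective (unloopMap s q V X) := by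
  refine PermTower.bijective_of_reps (P := stableTower s q V ((R T).obj X))
    (P' := stableTower s q V X) (unloopRep s) (unloopRep_stab s) _ (fun _ => rfl)
    (fun r r' h => ?_) fun r' => ?_
  · refine congrArg _ ?_
    obtain ⟨l, d, e, a⟩ := r
    obtain ⟨l', d', e', a'⟩ := r'
    have hl : l = l' := Nat.succ.inj (congrArg StableRep.level h)
    have hd : d = d' := Nat.succ.inj (congrArg StableRep.dim h)
    subst hl hd
    have := hX (l + 1)
    refine StableRep.ext_map ((hoSmashRight_evalRight_bijective T (smashPow T V (d + 1))
      (X.obj (l + 1))).1 (smashUnit_cancel s (A := smashPow T V (d + 1)) (u := (-1) ^ l) ?_))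
    exact eq_of_heq (StableRep.mk.inj h).2.2
  · obtain ⟨l, d, e, a⟩ := r'
    have := hX (l + 1)
    obtain ⟨b, hb⟩ := (hoSmashRight_evalRight_bijective T (smashPow T V (d + 1))
      (X.obj (l + 1))).2 (s.smashUnit (smashPow T V (d + 1)) ((-1) ^ l) ≫
        hoSmashRight T a ≫ (toHo D).map (X.σ l))
    refine ⟨⟨l, d, e, b⟩, StableRep.ext_map ?_⟩
    refine (congrArg (s.smashUnit (smashPow T V (d + 1)) ((-1) ^ l) ≫ ·) hb).trans ?_
    dsimp only
    rw [s.smashUnit_mul_assoc, Int.units_mul_self, s.smashUnit_one, Category.id_comp]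
    rfl

theorem unloopMap_natural {q : ℤ} {V : D} {X Y : SymSpectrum T} (f : X ⟶ Y)
    (x : StablePi q V ((R T).obj X).toSpectrum) :
    unloopMap s q V Y (StablePi.map q V ((forgetSym T).map ((R T).map f)) x) =
      StablePi.map q V ((forgetSym T).map f) (unloopMap s q V X x) := by
  induction x using Quot.ind with
  | mk r =>
    refine congrArg (Quot.mk _) (StableRep.ext_map ?_)
    have h : ∀ {A : D} (a : (toHo D).obj A ⟶ (toHo D).obj ((ihom T).obj (X.obj (r.level + 1))))
        (u : ℤˣ), s.smashUnit A u ≫ hoSmashRight T (a ≫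
          (toHo D).map ((ihom T).map (f.app (r.level + 1)))) ≫
            (toHo D).map (evalRight T (Y.obj (r.level + 1))) =
        (s.smashUnit A u ≫ hoSmashRight T a ≫
          (toHo D).map (evalRight T (X.obj (r.level + 1)))) ≫
            (toHo D).map (f.app (r.level + 1)) := fun a u => by
      rw [hoSmashRight_comp, hoSmashRight_map, Category.assoc, ← Functor.map_comp,
        evalRight_natural, Functor.map_comp]
      simp only [Category.assoc]
    exact h r.map _

theorem lamTilde_unloopRep_map {X : SymSpectrum T} {A : D} {m : ℕ}
    (a : (toHo D).obj A ⟶ (toHo D).obj (X.obj m)) :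
    s.smashUnit A ((-1) ^ m) ≫ hoSmashRight T (a ≫
      (toHo D).map (MonoidalClosed.curry (lamApp X m))) ≫
        (toHo D).map (evalRight T (X.obj (m + 1))) =
    s.smashUnit A (Equiv.Perm.sign (chi m)) ≫ (hoSmashRight T a ≫ (toHo D).map (X.σ m)) ≫
      (toHo D).map (X.act (m + 1) (chi m)) := by
  rw [sign_chi, hoSmashRight_comp, hoSmashRight_map, Category.assoc, ← Functor.map_comp,
    whiskerRight_curry_evalRight, lamApp, SymmetricCategory.symmetry_assoc, Functor.map_comp,
    Category.assoc]

/-- Under the comparison of `π_q^V(R X)` with `π_q^V(X)`, the map `λ̃_X` becomes the cycle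
operator. -/
theorem unloopMap_lamTilde (q : ℤ) (V : D) [IsCofibrant V] (X : SymSpectrum T)
    (x : StablePi q V X.toSpectrum) :
    unloopMap s q V X (StablePi.map q V ((forgetSym T).map (lamTilde X)) x) =
      (stableTower s q V X).inj cycleOp x := by
  obtain ⟨r, rfl⟩ := (stableTower s q V X).cls_surjective x
  refine Eq.trans ?_ ((inj_cycleOp_cls s r).trans
    (congrArg StableRep.cls (StableRep.perm_eq s r.stab (chi r.level)))).symm
  exact congrArg StableRep.cls (StableRep.ext_map (lamTilde_unloopRep_map s r.map))

theorem lamTilde_injective (s : CircleSign T) (q : ℤ) (V : D) [IsCofibrant V] (X : SymSpectrum T) :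
    Function.Injective (StablePi.map q V ((forgetSym T).map (lamTilde X))) := by
  intro x y h
  apply (stableTower s q V X).inj_cycleOp_injective
  rw [← unloopMap_lamTilde, ← unloopMap_lamTilde, h]

variable {B : ObjectProperty (CofibrantObject D)}

theorem semistable_iff_lamTilde_surjective {X : SymSpectrum T} (hX : X.LevelFibrant) :
    Semistable B s X ↔ ∀ V, B V → ∀ q : ℤ,
      Function.Surjective (StablePi.map q V.obj ((forgetSym T).map (lamTilde X))) := by
  rw [semistable_iff_inj_cycleOp_surjective]
  refine forall_congr' fun V => forall_congr' fun _ => forall_congr' fun q => ?_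
  have h : unloopMap s q V.obj X ∘ StablePi.map q V.obj ((forgetSym T).map (lamTilde X)) =
      (stableTower s q V.obj X).inj cycleOp := funext (unloopMap_lamTilde s q V.obj X)
  have h' := Function.Surjective.of_comp_iff' (unloopMap_bijective s q V.obj hX)
    (StablePi.map q V.obj ((forgetSym T).map (lamTilde X)))
  rw [h] at h'
  exact h'

theorem semistable_iff_piEquiv_lamTilde {X : SymSpectrum T} (hX : X.LevelFibrant) :
    Semistable B s X ↔ PiEquiv B ((forgetSym T).map (lamTilde X)) := by
  rw [semistable_iff_lamTilde_surjective s hX]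
  exact ⟨fun h V hV q => ⟨lamTilde_injective s q V.obj X, h V hV q⟩,
    fun h V hV q => (h V hV q).2⟩

theorem R_levelFibrant {X : SymSpectrum T} (hX : X.LevelFibrant) :
    ((R T).obj X).LevelFibrant := fun n =>
  have := hX (n + 1)
  isFibrant_ihom T (X.obj (n + 1))

theorem R_map_injective (s : CircleSign T) {q : ℤ} {V : D} [IsCofibrant V] {X Y : SymSpectrum T}
    (hX : X.LevelFibrant) (f : X ⟶ Y)
    (hf : Function.Injective (StablePi.map q V ((forgetSym T).map f))) :
    Function.Injective (StablePi.map q V ((forgetSym T).map ((R T).map f))) := by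
  intro x y h
  apply (unloopMap_bijective s q V hX).1
  apply hf
  rw [← unloopMap_natural, ← unloopMap_natural, h]

theorem R_map_surjective (s : CircleSign T) {q : ℤ} {V : D} [IsCofibrant V] {X Y : SymSpectrum T}
    (hX : X.LevelFibrant) (hY : Y.LevelFibrant) (f : X ⟶ Y)
    (hf : Function.Surjective (StablePi.map q V ((forgetSym T).map f))) :
    Function.Surjective (StablePi.map q V ((forgetSym T).map ((R T).map f))) := by
  intro y
  obtain ⟨x, hx⟩ := hf (unloopMap s q V Y y)
  obtain ⟨x, rfl⟩ := (unloopMap_bijective s q V hX).2 x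
  refine ⟨x, (unloopMap_bijective s q V hY).1 ?_⟩
  rw [unloopMap_natural, hx]

/-- In an `Ω`-spectrum, the stabilization maps `[A, X_m] ⟶ [A ∧ T, X_{m+1}]` are surjective. -/
theorem stab_surjective_of_isOmega {X : Spectrum T} (hX : X.IsOmega) (A : D) [IsCofibrant A]
    (m : ℕ) : Function.Surjective (fun a : (toHo D).obj A ⟶ (toHo D).obj (X.obj m) =>
      hoSmashRight T a ≫ (toHo D).map (X.σ m)) := by
  intro b
  have := hX.1 (m + 1)
  have := hX.2 m
  obtain ⟨a, rfl⟩ := (hoSmashRight_evalRight_bijective T A (X.obj (m + 1))).2 b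
  refine ⟨a ≫ inv ((toHo D).map (X.σTilde m)), ?_⟩
  have h : X.σ m = X.σTilde m ▷ T ≫ evalRight T (X.obj (m + 1)) :=
    (curryRight_evalRight (X.σ m)).symm
  dsimp only
  rw [h, Functor.map_comp, ← hoSmashRight_map, ← Category.assoc, ← hoSmashRight_comp,
    Category.assoc, IsIso.inv_hom_id, Category.comp_id]

/-- A symmetric `Ω`-spectrum is semistable, because its stable homotopy groups have bounded
filtration. -/
theorem semistable_of_isOmega {X : SymSpectrum T} (hX : X.IsOmega) : Semistable B s X := by
  rw [semistable_iff]
  intro V _ q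
  refine (stableTower s q V.obj X).inj_eq_of_bounded_filtration (1 - q).toNat fun x => ?_
  -- every class has a representative in a level which is at most `max (1 - q) 0`
  have key : ∀ (m : ℕ) (r : StableRep q V.obj X.toSpectrum), r.level ≤ m →
      ∃ r' : StableRep q V.obj X.toSpectrum, r'.level ≤ (1 - q).toNat ∧ r'.cls = r.cls := by
    intro m
    induction m with
    | zero => exact fun r hr => ⟨r, hr.trans (Nat.zero_le _), rfl⟩
    | succ m ih =>
      intro r hr
      rcases le_or_gt r.level (1 - q).toNat with h | h
      · exact ⟨r, h, rfl⟩
      · obtain ⟨l, d, e, b⟩ := r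
        dsimp only at h hr
        obtain ⟨l, rfl⟩ : ∃ l', l = l' + 1 := ⟨l - 1, by omega⟩
        obtain ⟨d, rfl⟩ : ∃ d', d = d' + 1 := ⟨d - 1, by push_cast at e; omega⟩
        obtain ⟨a, ha⟩ := stab_surjective_of_isOmega hX (smashPow T V.obj (d + 1)) l b
        let r' : StableRep q V.obj X.toSpectrum := ⟨l, d, by push_cast at e; omega, a⟩
        obtain ⟨r'', h₁, h₂⟩ := ih r' (by change l ≤ m; omega)
        refine ⟨r'', h₁, h₂.trans (((stableTower s q V.obj X).cls_stab r').symm.trans ?_)⟩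
        exact congrArg StableRep.cls (StableRep.ext_map ha)
  obtain ⟨r, rfl⟩ := (stableTower s q V.obj X).cls_surjective x
  obtain ⟨r', h, e⟩ := key r.level r le_rfl
  intro f hf
  refine (congrArg _ e.symm).trans (Eq.trans ?_ e)
  exact (stableTower s q V.obj X).inj_of_level f r' fun i hi => hf i (lt_of_lt_of_le hi h)

end LoopShift

/-! ### Small objects and simplicial cylinders -/

section Small

open Simplicial Opposite

/-- An object `P` is sequentially small if `Hom(P, -)` commutes with sequential colimits: maps from
`P` to a sequential colimit factor through a finite stage, and maps to a finite stage which agree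
in the colimit agree at a later stage. -/
def SeqSmall {C : Type u} [Category.{v} C] (P : C) : Prop :=
  ∀ (F : ℕ ⥤ C) (c : Cocone F), Nonempty (IsColimit c) →
    (∀ f : P ⟶ c.pt, ∃ (k : ℕ) (g : P ⟶ F.obj k), g ≫ c.ι.app k = f) ∧
    ∀ (k : ℕ) (f g : P ⟶ F.obj k), f ≫ c.ι.app k = g ≫ c.ι.app k →
      ∃ (m : ℕ) (h : k ⟶ m), f ≫ F.map h = g ≫ F.map h

theorem SeqSmall.leftAdjoint {C : Type u} [Category.{v} C] {C' : Type*} [Category* C']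
    {L : C ⥤ C'} {R : C' ⥤ C} (adj : L ⊣ R) [PreservesColimitsOfShape ℕ R] {P : C}
    (hP : SeqSmall P) : SeqSmall (L.obj P) := by
  rintro F c ⟨hc⟩
  obtain ⟨h₁, h₂⟩ := hP (F ⋙ R) (R.mapCocone c) ⟨isColimitOfPreserves R hc⟩
  constructor
  · intro f
    obtain ⟨k, g, hg⟩ := h₁ (adj.homEquiv _ _ f)
    refine ⟨k, (adj.homEquiv _ _).symm g, (adj.homEquiv _ _).injective ?_⟩
    refine (adj.homEquiv_naturality_right _ _).trans ?_
    rw [Equiv.apply_symm_apply]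
    exact hg
  · intro k f g h
    obtain ⟨m, φ, e⟩ := h₂ k (adj.homEquiv _ _ f) (adj.homEquiv _ _ g) (by
      have := congrArg (adj.homEquiv _ _) h
      rwa [adj.homEquiv_naturality_right, adj.homEquiv_naturality_right] at this)
    refine ⟨m, φ, (adj.homEquiv _ _).injective ?_⟩
    rwa [adj.homEquiv_naturality_right, adj.homEquiv_naturality_right]

theorem seqSmall_stdSimplex (n : ℕ) : SeqSmall (Δ[n] : SSet.{w}) := by
  rintro F c ⟨hc⟩
  have hc' : IsColimit (((evaluation _ _).obj (op ⦋n⦌)).mapCocone c) := isColimitOfPreserves _ hc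
  constructor
  · intro f
    obtain ⟨k, y, hy⟩ := Types.jointly_surjective _ hc' (SSet.yonedaEquiv f)
    refine ⟨k, SSet.yonedaEquiv.symm y, SSet.yonedaEquiv.injective ?_⟩
    rw [SSet.yonedaEquiv_comp, Equiv.apply_symm_apply]
    exact hy
  · intro k f g h
    have h' := congrArg SSet.yonedaEquiv h
    rw [SSet.yonedaEquiv_comp, SSet.yonedaEquiv_comp] at h'
    obtain ⟨m, φ, e⟩ := (Types.FilteredColimit.isColimit_eq_iff' hc' _ _).1 h'
    refine ⟨m, φ, SSet.yonedaEquiv.injective ?_⟩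
    rw [SSet.yonedaEquiv_comp, SSet.yonedaEquiv_comp]
    exact e

/-- The colimit cocone of a sequence of pointed sets: the colimit of the underlying sets, pointed
by the image of the base points. -/
noncomputable def pointedColimitCocone (F : ℕ ⥤ Pointed.{w}) : Cocone F where
  pt := ⟨colimit (F ⋙ forget Pointed.{w}), colimit.ι (F ⋙ forget Pointed.{w}) 0 (F.obj 0).point⟩
  ι :=
    { app := fun k => ⟨colimit.ι (F ⋙ forget Pointed.{w}) k, by
        have h := ConcreteCategory.congr_hom
          (colimit.w (F ⋙ forget Pointed.{w}) (homOfLE (Nat.zero_le k))) (F.obj 0).point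
        refine Eq.trans ?_ h
        exact congrArg _ (F.map (homOfLE (Nat.zero_le k))).map_point.symm⟩
      naturality := fun k l f => Pointed.Hom.ext (funext fun x =>
        ConcreteCategory.congr_hom (colimit.w (F ⋙ forget Pointed.{w}) f) x) }

/-- `pointedColimitCocone` is a colimit. -/
noncomputable def pointedColimitCoconeIsColimit (F : ℕ ⥤ Pointed.{w}) :
    IsColimit (pointedColimitCocone F) where
  desc s := ⟨colimit.desc (F ⋙ forget Pointed.{w}) ((forget Pointed.{w}).mapCocone s),
    (ConcreteCategory.congr_hom (colimit.ι_desc ((forget Pointed.{w}).mapCocone s) 0)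
      (F.obj 0).point).trans (s.ι.app 0).map_point⟩
  fac s k := Pointed.Hom.ext (funext fun x =>
    ConcreteCategory.congr_hom (colimit.ι_desc ((forget Pointed.{w}).mapCocone s) k) x)
  uniq s m h := Pointed.Hom.ext (by
    have : (forget Pointed.{w}).map m =
        colimit.desc (F ⋙ forget Pointed.{w}) ((forget Pointed.{w}).mapCocone s) := by
      refine colimit.hom_ext fun k => ?_
      rw [colimit.ι_desc]
      exact congrArg (forget Pointed.{w}).map (h k)
    exact funext fun x => ConcreteCategory.congr_hom this x)

instance : HasColimitsOfShape ℕ Pointed.{w} :=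
  ⟨fun F => ⟨⟨pointedColimitCocone F, pointedColimitCoconeIsColimit F⟩⟩⟩

instance : PreservesColimitsOfShape ℕ (forget Pointed.{w}) :=
  ⟨fun {F} => preservesColimit_of_preserves_colimit_cocone (pointedColimitCoconeIsColimit F)
    (IsColimit.ofIsoColimit (colimit.isColimit (F ⋙ forget Pointed.{w}))
      (Cocone.ext (Iso.refl _) (fun _ => Category.comp_id _)))⟩

instance : PreservesColimitsOfShape ℕ underlyingSSet.{w} :=
  whiskeringRight_preservesColimitsOfShape (forget Pointed.{w})

/-- The functor `K ↦ K_+` which adds a disjoint base point. -/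
def plus : SSet.{w} ⥤ PointedSSet.{w} :=
  (Functor.whiskeringRight SimplexCategoryᵒᵖ (Type w) Pointed.{w}).obj typeToPointed

/-- Adding a base point is left adjoint to forgetting the base point. -/
def plusAdj : plus.{w} ⊣ underlyingSSet.{w} :=
  typeToPointedForgetAdjunction.whiskerRight SimplexCategoryᵒᵖ

theorem mono_underlyingSSet_plus {K L : SSet.{w}} (f : K ⟶ L) [Mono f] :
    Mono (underlyingSSet.map (plus.map f)) := by
  rw [NatTrans.mono_iff_mono_app]
  intro n
  rw [mono_iff_injective]
  have : Function.Injective (f.app n) := (mono_iff_injective _).1 inferInstance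
  exact Option.map_injective this

/-- The unit `S⁰` of pointed simplicial sets is a point with a disjoint base point added. -/
def plusPointIso : plus.{w}.obj ((Functor.const _).obj PUnit.{w + 1}) ≅ 𝟙_ PointedSSet.{w} :=
  NatIso.ofComponents (fun _ => Iso.refl zeroSphere) (fun f => Pointed.Hom.ext (funext fun x => by
    cases x <;> rfl))

theorem stdSimplex_δ_disjoint (n : SimplexCategoryᵒᵖ) (x y : (Δ[0] : SSet.{w}).obj n) :
    (SSet.stdSimplex.δ (0 : Fin 2)).app n x ≠ (SSet.stdSimplex.δ (1 : Fin 2)).app n y := by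
  intro h
  have h' := congrArg (fun z : (Δ[1] : SSet.{w}).obj n => SSet.stdSimplex.asOrderHom z 0) h
  exact absurd h' (by
    rw [SSet.stdSimplex.δ_zero_eq_const, SSet.stdSimplex.δ_one_eq_const]
    change ¬ ((1 : Fin 2) = 0)
    decide)

theorem mono_coprodDesc_δ :
    Mono (coprod.desc (SSet.stdSimplex.δ (0 : Fin 2)) (SSet.stdSimplex.δ (1 : Fin 2)) :
      (Δ[0] : SSet.{w}) ⨿ Δ[0] ⟶ Δ[1]) := by
  rw [NatTrans.mono_iff_mono_app]
  intro n
  rw [mono_iff_injective]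
  have hs : ∀ z : ((Δ[0] : SSet.{w}) ⨿ Δ[0]).obj n, (∃ x, z = (coprod.inl : Δ[0] ⟶ _).app n x) ∨
      ∃ x, z = (coprod.inr : Δ[0] ⟶ (Δ[0] : SSet.{w}) ⨿ Δ[0]).app n x := by
    intro z
    have hc := isColimitOfPreserves ((evaluation _ (Type w)).obj n)
      (colimit.isColimit (pair (Δ[0] : SSet.{w}) Δ[0]))
    obtain ⟨⟨j⟩, y, hy⟩ := Types.jointly_surjective _ hc z
    cases j
    exacts [Or.inl ⟨y, hy.symm⟩, Or.inr ⟨y, hy.symm⟩]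
  have hl : ∀ x, (coprod.desc (SSet.stdSimplex.δ (0 : Fin 2)) (SSet.stdSimplex.δ (1 : Fin 2)) :
      (Δ[0] : SSet.{w}) ⨿ Δ[0] ⟶ Δ[1]).app n ((coprod.inl : Δ[0] ⟶ _).app n x) =
      (SSet.stdSimplex.δ (0 : Fin 2)).app n x := fun x => ConcreteCategory.congr_hom
        (NatTrans.congr_app (coprod.inl_desc (SSet.stdSimplex.δ (0 : Fin 2)) _) n) x
  have hr : ∀ x, (coprod.desc (SSet.stdSimplex.δ (0 : Fin 2)) (SSet.stdSimplex.δ (1 : Fin 2)) :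
      (Δ[0] : SSet.{w}) ⨿ Δ[0] ⟶ Δ[1]).app n ((coprod.inr : Δ[0] ⟶ _).app n x) =
      (SSet.stdSimplex.δ (1 : Fin 2)).app n x := fun x => ConcreteCategory.congr_hom
        (NatTrans.congr_app (coprod.inr_desc _ (SSet.stdSimplex.δ (1 : Fin 2))) n) x
  have hu : ∀ x y : (Δ[0] : SSet.{w}).obj n, x = y := fun x y => by
    apply SSet.stdSimplex.objEquiv.injective
    exact SimplexCategory.isTerminalZero.hom_ext _ _
  intro z z' h
  obtain ⟨x, rfl⟩ | ⟨x, rfl⟩ := hs z <;> obtain ⟨y, rfl⟩ | ⟨y, rfl⟩ := hs z'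
  · rw [hu x y]
  · rw [hl, hr] at h
    exact absurd h (stdSimplex_δ_disjoint n x y)
  · rw [hl, hr] at h
    exact absurd h.symm (stdSimplex_δ_disjoint n y x)
  · rw [hu x y]

open SSet.modelCategoryQuillen in
/-- A Kan fibration has the lifting property for `Δ[0] ⟶ Δ[1]`, the inclusion of a horn. -/
theorem hasLiftingProperty_δ_one {K L : SSet.{w}} (p : K ⟶ L) [Fibration p] :
    HasLiftingProperty (SSet.stdSimplex.δ (1 : Fin 2) : (Δ[0] : SSet.{w}) ⟶ Δ[1]) p where
  sq_hasLift {f g} sq := by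
    have hf : SSet.horn.IsCompatible (i := (0 : Fin 2))
      (fun (j : Fin 2) (_ : j ≠ 0) => f) := trivial
    obtain ⟨φ, h₁, h₂⟩ := hf.exists_lift p g (fun j hj => by
      obtain rfl := Fin.eq_one_of_ne_zero j hj
      exact sq.w)
    exact ⟨⟨⟨φ, h₁ 1 (by decide), h₂⟩⟩⟩

end Small

section Compactness

theorem preservesColimits_ihom_smashPow {D : Type u} [Category.{v} D] [MonoidalCategory D]
    [MonoidalClosed D] (T A : D) [PreservesColimitsOfShape ℕ (ihom T)]
    [PreservesColimitsOfShape ℕ (ihom A)] :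
    ∀ n, PreservesColimitsOfShape ℕ (ihom (smashPow T A n)) := by
  intro n
  induction n with
  | zero => exact inferInstanceAs (PreservesColimitsOfShape ℕ (ihom A))
  | succ n _ =>
    have e : ihom (smashPow T A n) ⋙ ihom T ≅ ihom (smashPow T A n ⊗ T) :=
      Adjunction.rightAdjointUniq
        (((ihom.adjunction T).comp (ihom.adjunction (smashPow T A n))).ofNatIsoLeft
          (tensorLeftTensor _ _).symm) (ihom.adjunction _)
    exact preservesColimitsOfShape_of_natIso e

open Simplicial

variable {D : Type u} [Category.{v} D] [ModelCategory D]

/-- The derived version of `SeqSmall`: `[A, -]` commutes with those sequential colimits in which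
all objects, including the colimit, are fibrant. -/
def HoSeqSmall (A : D) : Prop :=
  ∀ (F : ℕ ⥤ D) (c : Cocone F), Nonempty (IsColimit c) → (∀ n, IsFibrant (F.obj n)) →
    IsFibrant c.pt →
    (∀ f : (toHo D).obj A ⟶ (toHo D).obj c.pt,
      ∃ (k : ℕ) (g : (toHo D).obj A ⟶ (toHo D).obj (F.obj k)), g ≫ (toHo D).map (c.ι.app k) = f) ∧
    ∀ (k : ℕ) (f g : (toHo D).obj A ⟶ (toHo D).obj (F.obj k)),
      f ≫ (toHo D).map (c.ι.app k) = g ≫ (toHo D).map (c.ι.app k) →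
        ∃ (m : ℕ) (h : k ⟶ m), f ≫ (toHo D).map (F.map h) = g ≫ (toHo D).map (F.map h)

theorem HoSeqSmall.of_iso {A A' : D} (e : A ≅ A') (hA : HoSeqSmall A) : HoSeqSmall A' := by
  intro F c hc hF hc'
  obtain ⟨h₁, h₂⟩ := hA F c hc hF hc'
  constructor
  · intro f
    obtain ⟨k, g, hg⟩ := h₁ ((toHo D).map e.hom ≫ f)
    refine ⟨k, (toHo D).map e.inv ≫ g, ?_⟩
    rw [Category.assoc, hg, ← Functor.map_comp_assoc, e.inv_hom_id, CategoryTheory.Functor.map_id,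
      Category.id_comp]
  · intro k f g h
    obtain ⟨m, φ, e'⟩ := h₂ k ((toHo D).map e.hom ≫ f) ((toHo D).map e.hom ≫ g) (by
      rw [Category.assoc, Category.assoc, h])
    refine ⟨m, φ, ?_⟩
    rwa [Category.assoc, Category.assoc, cancel_epi] at e'

/-- An object is small in the homotopy category if it has a cylinder which is small. -/
theorem hoSeqSmall_of_cylinder {A : D} [IsCofibrant A] (hA : SeqSmall A) (Q : Cylinder A)
    [Q.IsGood] (hQ : SeqSmall Q.I) : HoSeqSmall A := by
  intro F c hc hF hc'
  constructor
  · intro φ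
    obtain ⟨f, rfl⟩ := map_surjective_of_isLocalization (toHo D) _ _ φ
    obtain ⟨k, g, rfl⟩ := (hA F c hc).1 f
    exact ⟨k, (toHo D).map g, (Functor.map_comp _ _ _).symm⟩
  · intro k φ ψ h
    have := hF k
    obtain ⟨f, rfl⟩ := map_surjective_of_isLocalization (toHo D) _ _ φ
    obtain ⟨g, rfl⟩ := map_surjective_of_isLocalization (toHo D) _ _ ψ
    rw [← Functor.map_comp, ← Functor.map_comp,
      ← LeftHomotopyRel.iff_map_eq (toHo D) A c.pt] at h
    have H := h.leftHomotopy Q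
    -- the homotopy in the colimit comes from a map to a finite stage `l`
    obtain ⟨l, H', hH'⟩ := (hQ F c hc).1 H.h
    obtain ⟨m, a, b, -⟩ : ∃ (m : ℕ) (_ : k ⟶ m) (_ : l ⟶ m), True :=
      ⟨max k l, homOfLE (le_max_left _ _), homOfLE (le_max_right _ _), trivial⟩
    have e₀ : (f ≫ F.map a) ≫ c.ι.app m = (Q.i₀ ≫ H' ≫ F.map b) ≫ c.ι.app m := by
      rw [Category.assoc, c.w, Category.assoc, Category.assoc, c.w, hH', H.h₀]
    have e₁ : (g ≫ F.map a) ≫ c.ι.app m = (Q.i₁ ≫ H' ≫ F.map b) ≫ c.ι.app m := by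
      rw [Category.assoc, c.w, Category.assoc, Category.assoc, c.w, hH', H.h₁]
    obtain ⟨m₀, φ₀, e₀⟩ := (hA F c hc).2 m _ _ e₀
    obtain ⟨m₁, φ₁, e₁⟩ := (hA F c hc).2 m _ _ e₁
    obtain ⟨n, α, β, -⟩ : ∃ (n : ℕ) (_ : m₀ ⟶ n) (_ : m₁ ⟶ n), True :=
      ⟨max m₀ m₁, homOfLE (le_max_left _ _), homOfLE (le_max_right _ _), trivial⟩
    have hi : (toHo D).map Q.i₀ = (toHo D).map Q.i₁ := by
      rw [← cancel_mono ((toHo D).map Q.π), ← Functor.map_comp, ← Functor.map_comp, Q.i₀_π, Q.i₁_π]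
    have E₀ : f ≫ F.map (a ≫ φ₀ ≫ α) = Q.i₀ ≫ H' ≫ F.map (b ≫ φ₀ ≫ α) := by
      simpa only [Category.assoc, Functor.map_comp] using congrArg (· ≫ F.map α) e₀
    have E₁ : g ≫ F.map (a ≫ φ₀ ≫ α) = Q.i₁ ≫ H' ≫ F.map (b ≫ φ₀ ≫ α) := by
      rw [Subsingleton.elim (φ₀ ≫ α) (φ₁ ≫ β)]
      simpa only [Category.assoc, Functor.map_comp] using congrArg (· ≫ F.map β) e₁
    refine ⟨n, a ≫ φ₀ ≫ α, ?_⟩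
    rw [← Functor.map_comp, ← Functor.map_comp, E₀, E₁, Functor.map_comp, hi, ← Functor.map_comp]

theorem cofibration_coprodDesc_map {C : Type*} [Category* C] (G : C ⥤ D) {K L : C} (a b : K ⟶ L)
    [HasBinaryCoproduct K K] [PreservesColimit (pair K K) G] [Cofibration (G.map (coprod.desc a b))] :
    Cofibration (coprod.desc (G.map a) (G.map b)) := by
  have h : coprod.desc (G.map a) (G.map b) = coprodComparison G K K ≫ G.map (coprod.desc a b) := by
    refine coprod.hom_ext ?_ ?_
    · rw [coprod.inl_desc, coprodComparison_inl_assoc, ← Functor.map_comp, coprod.inl_desc]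
    · rw [coprod.inr_desc, coprodComparison_inr_assoc, ← Functor.map_comp, coprod.inr_desc]
  rw [h, cofibration_iff]
  exact (MorphismProperty.cancel_left_of_respectsIso (cofibrations D) _ _).2
    ((cofibration_iff _).1 inferInstance)

variable [MonoidalCategory D] [SymmetricCategory D] [MonoidalClosed D] [MonoidalModel D]
  (i : PointedSSet.{w} ⥤ D) (j : D ⥤ PointedSSet.{w})

/-- The functor `K ↦ A ∧ i(K_+)` from simplicial sets to `D`. -/
def simplicialTensor (A : D) : SSet.{w} ⥤ D := plus ⋙ i ⋙ tensorLeft A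

variable {i j} (adj : i ⊣ j)

/-- The right adjoint of `K ↦ A ∧ i(K_+)` takes `Z` to the underlying simplicial set of
`j Hom(A, Z)`. -/
def simplicialTensorAdj (A : D) :
    simplicialTensor i A ⊣ (ihom A ⋙ j) ⋙ underlyingSSet.{w} :=
  plusAdj.comp (adj.comp (ihom.adjunction A))

theorem cofibration_simplicialTensor (hij : IsLeftQuillenPair i j) (A : D) [IsCofibrant A]
    {K L : SSet.{w}} (f : K ⟶ L) [Mono f] : Cofibration ((simplicialTensor i A).map f) := by
  have := mono_underlyingSSet_plus f
  have := hij.cofibration (plus.map f)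
  exact cofibration_whiskerLeft A _

theorem weakEquivalence_simplicialTensor_δ_one (adj : i ⊣ j) (hij : IsLeftQuillenPair i j) (A : D)
    [IsCofibrant A] : WeakEquivalence ((simplicialTensor i A).map
      (SSet.stdSimplex.δ (1 : Fin 2) : (Δ[0] : SSet.{w}) ⟶ Δ[1])) := by
  have h : trivialCofibrations D
      (i.map (plus.map (SSet.stdSimplex.δ (1 : Fin 2) : (Δ[0] : SSet.{w}) ⟶ Δ[1]))) := by
    rw [← fibrations_llp]
    intro Y Z p hp
    have : Fibration p := ⟨hp⟩
    rw [adj.hasLiftingProperty_iff, plusAdj.hasLiftingProperty_iff]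
    have := hij.fibration p
    exact hasLiftingProperty_δ_one _
  obtain ⟨_, _⟩ := (mem_trivialCofibrations_iff _).1 h
  exact weakEquivalence_whiskerLeft_of_cofibration A _

/-- As `i` is monoidal, `A ∧ i(Δ[0]_+)` is `A`. -/
noncomputable def simplicialTensorPointIso [i.Monoidal] (A : D) :
    (simplicialTensor i A).obj (Δ[0] : SSet.{w}) ≅ A :=
  (simplicialTensor i A).mapIso (SSet.stdSimplex.isTerminalObj₀.uniqueUpToIso
    (Functor.isTerminalConst _ Types.isTerminalPUnit)) ≪≫
    whiskerLeftIso A (i.mapIso plusPointIso) ≪≫ whiskerLeftIso A (Functor.Monoidal.εIso i).symm ≪≫ ρ_ A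

/-- The cylinder `A ∧ i(Δ[1]_+)` on `A ≅ A ∧ i(Δ[0]_+)`. -/
noncomputable def simplicialCylinder (hij : IsLeftQuillenPair i j) (A : D) [IsCofibrant A] :
    Cylinder ((simplicialTensor i A).obj (Δ[0] : SSet.{w})) where
  toPrecylinder := Precylinder.map
    { I := (Δ[1] : SSet.{w})
      i₀ := SSet.stdSimplex.δ (0 : Fin 2)
      i₁ := SSet.stdSimplex.δ (1 : Fin 2)
      π := SSet.stdSimplex.isTerminalObj₀.from _
      i₀_π := SSet.stdSimplex.isTerminalObj₀.hom_ext _ _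
      i₁_π := SSet.stdSimplex.isTerminalObj₀.hom_ext _ _ } (simplicialTensor i A)
  weakEquivalence_π := by
    have := weakEquivalence_simplicialTensor_δ_one adj hij A
    have h : WeakEquivalence ((simplicialTensor i A).map
        (SSet.stdSimplex.δ (1 : Fin 2) : (Δ[0] : SSet.{w}) ⟶ Δ[1]) ≫
          (simplicialTensor i A).map (SSet.stdSimplex.isTerminalObj₀.from _)) := by
      rw [← Functor.map_comp, SSet.stdSimplex.isTerminalObj₀.hom_ext (_ ≫ _) (𝟙 Δ[0]),
        CategoryTheory.Functor.map_id]
      infer_instance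
    exact weakEquivalence_of_precomp ((simplicialTensor i A).map
      (SSet.stdSimplex.δ (1 : Fin 2) : (Δ[0] : SSet.{w}) ⟶ Δ[1])) ((simplicialTensor i A).map
      (SSet.stdSimplex.isTerminalObj₀.from (Δ[1] : SSet.{w})))

theorem simplicialCylinder_isGood (hij : IsLeftQuillenPair i j) (A : D) [IsCofibrant A] :
    (simplicialCylinder adj hij A).IsGood where
  cofibration_i := by
    have : PreservesColimitsOfSize.{0, 0} (simplicialTensor i A) :=
      (simplicialTensorAdj adj A).leftAdjoint_preservesColimits
    have := mono_coprodDesc_δ.{w}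
    have := cofibration_simplicialTensor hij A (coprod.desc (SSet.stdSimplex.δ (0 : Fin 2))
      (SSet.stdSimplex.δ (1 : Fin 2)) : (Δ[0] : SSet.{w}) ⨿ Δ[0] ⟶ Δ[1])
    exact cofibration_coprodDesc_map (simplicialTensor i A) _ _

/-- The functor `[A, -]` commutes with sequential colimits of fibrant objects if `Hom(A, -)` and
`j` preserve sequential colimits. -/
theorem hoSeqSmall_of_preservesColimits (adj : i ⊣ j) [i.Monoidal] (hij : IsLeftQuillenPair i j)
    [PreservesColimitsOfShape ℕ j] (A : D) [IsCofibrant A] [PreservesColimitsOfShape ℕ (ihom A)] :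
    HoSeqSmall A := by
  have := simplicialCylinder_isGood adj hij A
  have : IsCofibrant ((simplicialTensor i A).obj (Δ[0] : SSet.{w})) :=
    isCofibrant_of_cofibration (simplicialTensorPointIso A).inv
  refine HoSeqSmall.of_iso (simplicialTensorPointIso A) (hoSeqSmall_of_cylinder
    ((seqSmall_stdSimplex 0).leftAdjoint (simplicialTensorAdj adj A))
    (simplicialCylinder adj hij A) ?_)
  exact (seqSmall_stdSimplex 1).leftAdjoint (simplicialTensorAdj adj A)

end Compactness

/-! ### Stable homotopy groups of sequential colimits -/

section SequentialColimits

variable {D : Type u} [Category.{v} D] [MonoidalCategory D] [ModelCategory D]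
  {T : D}

theorem stab_iterate_comp [IsCircle T] {q : ℤ} {V : D} {X Y : Spectrum T} (f : X ⟶ Y) (n : ℕ)
    (r : StableRep q V X) : StableRep.stab^[n] (r.comp f) = (StableRep.stab^[n] r).comp f := by
  induction n generalizing r with
  | zero => rfl
  | succ n ih => rw [Function.iterate_succ_apply, Function.iterate_succ_apply,
      ← StableRep.comp_stab, ih]

variable [SymmetricCategory D] [HasColimitsOfShape ℕ D]
  [PreservesColimitsOfShape ℕ (tensorRight T)]

/-- A sequence of level fibrant symmetric spectra, whose colimit is also level fibrant. -/
structure FibrantSeq (F : ℕ ⥤ SymSpectrum T) : Prop where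
  obj (k : ℕ) : (F.obj k).LevelFibrant
  colim : (colimSpectrum F).LevelFibrant

variable {F : ℕ ⥤ SymSpectrum T} (hF : FibrantSeq F) {q : ℤ} {V : D}
  (hV : ∀ n, HoSeqSmall (smashPow T V n))

include hF hV

theorem exists_stablePi_colimSpectrum [IsCircle T]
    (y : StablePi q V (colimSpectrum F).toSpectrum) :
    ∃ (k : ℕ) (x : StablePi q V (F.obj k).toSpectrum),
      StablePi.map q V ((forgetSym T).map ((colimCocone F).ι.app k)) x = y := by
  induction y using Quot.ind with
  | mk r =>
    obtain ⟨k, g, hg⟩ := (hV (r.dim + 1) (F ⋙ SymSpectrum.ev T r.level) (colimit.cocone _)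
      ⟨colimit.isColimit _⟩ (fun k => hF.obj k r.level) (hF.colim r.level)).1 r.map
    exact ⟨k, StableRep.cls ⟨r.level, r.dim, r.dim_eq, g⟩, congrArg (Quot.mk _)
      (StableRep.ext_map hg)⟩

theorem exists_comp_eq {k : ℕ} (r r' : StableRep q V (F.obj k).toSpectrum)
    (h : r.comp ((forgetSym T).map ((colimCocone F).ι.app k)) =
      r'.comp ((forgetSym T).map ((colimCocone F).ι.app k))) :
    ∃ (m : ℕ) (φ : k ⟶ m), r.comp ((forgetSym T).map (F.map φ)) =
      r'.comp ((forgetSym T).map (F.map φ)) := by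
  obtain ⟨l, d, e, a⟩ := r
  obtain ⟨l', d', e', a'⟩ := r'
  have hl : l = l' := congrArg StableRep.level h
  have hd : d = d' := congrArg StableRep.dim h
  subst hl hd
  obtain ⟨m, φ, hφ⟩ := (hV (d + 1) (F ⋙ SymSpectrum.ev T l) (colimit.cocone _)
      ⟨colimit.isColimit _⟩ (fun k => hF.obj k l) (hF.colim l)).2 k a a'
      (eq_of_heq (StableRep.mk.inj h).2.2)
  exact ⟨m, φ, StableRep.ext_map hφ⟩

theorem stablePi_map_colimCocone_injective [MonoidalClosed D] [MonoidalModel D] [IsCircle T]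
    (s : CircleSign T) [IsCofibrant V]
    (hinj : ∀ k, Function.Injective
      (StablePi.map q V ((forgetSym T).map (F.map (homOfLE (Nat.le_add_right k 1)))))) (k : ℕ) :
    Function.Injective (StablePi.map q V ((forgetSym T).map ((colimCocone F).ι.app k))) := by
  have hinj' : ∀ (n : ℕ) (φ : k ⟶ k + n),
      Function.Injective (StablePi.map q V ((forgetSym T).map (F.map φ))) := by
    intro n
    induction n with
    | zero =>
      intro φ x y h
      rw [Subsingleton.elim φ (𝟙 k), F.map_id, CategoryTheory.Functor.map_id] at h
      exact (StablePi.map_id q V _ x).symm.trans (h.trans (StablePi.map_id q V _ y))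
    | succ n ih =>
      intro φ x y h
      rw [Subsingleton.elim φ (homOfLE (Nat.le_add_right k n) ≫ homOfLE (Nat.le_add_right _ 1)),
        F.map_comp, CategoryTheory.Functor.map_comp, StablePi.map_comp, StablePi.map_comp] at h
      exact ih _ (hinj _ h)
  intro x y h
  obtain ⟨r, rfl⟩ := (stableTower s q V (F.obj k)).cls_surjective x
  obtain ⟨r', rfl⟩ := (stableTower s q V (F.obj k)).cls_surjective y
  obtain ⟨a, b, e⟩ := (stableTower s q V (colimSpectrum F)).cls_eq_iff.1 h
  obtain ⟨m, φ, e'⟩ := exists_comp_eq hF hV (StableRep.stab^[a] r) (StableRep.stab^[b] r')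
    ((stab_iterate_comp _ a r).symm.trans (e.trans (stab_iterate_comp _ b r')))
  obtain ⟨n, rfl⟩ := Nat.exists_eq_add_of_le (leOfHom φ)
  apply hinj' n φ
  refine (stableTower s q V (F.obj (k + n))).cls_eq_iff.2 ⟨a, b, ?_⟩
  exact (stab_iterate_comp _ a r).trans (e'.trans (stab_iterate_comp _ b r').symm)

end SequentialColimits

/-! ### The spectrum `R^∞ X` -/

section RInfinity

theorem Rseq_map_succ {D : Type u} [Category.{v} D] [MonoidalCategory D] [SymmetricCategory D]
    [MonoidalClosed D] {T : D} (X : SymSpectrum T) (k : ℕ) :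
    (Rseq X).map (homOfLE (Nat.le_add_right k 1)) = (Rpow T k).map (lamTilde X) :=
  Functor.ofSequence_map_homOfLE_succ _ _

variable {D : Type u} [Category.{v} D] [MonoidalCategory D] [ModelCategory D]
  [SymmetricCategory D] [MonoidalClosed D] [MonoidalModel D] {T : D} [IsCircle T]

theorem Rpow_levelFibrant (k : ℕ) {X : SymSpectrum T} (hX : X.LevelFibrant) :
    ((Rpow T k).obj X).LevelFibrant := by
  induction k generalizing X with
  | zero => exact hX
  | succ k ih => exact ih (R_levelFibrant hX)

theorem Rpow_map_injective (s : CircleSign T) (k : ℕ) {q : ℤ} {V : D} [IsCofibrant V]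
    {X Y : SymSpectrum T} (hX : X.LevelFibrant) (f : X ⟶ Y)
    (hf : Function.Injective (StablePi.map q V ((forgetSym T).map f))) :
    Function.Injective (StablePi.map q V ((forgetSym T).map ((Rpow T k).map f))) := by
  induction k generalizing X Y with
  | zero => exact hf
  | succ k ih => exact ih (R_levelFibrant hX) _ (R_map_injective s hX f hf)

theorem Rpow_map_surjective (s : CircleSign T) (k : ℕ) {q : ℤ} {V : D} [IsCofibrant V]
    {X Y : SymSpectrum T} (hX : X.LevelFibrant) (hY : Y.LevelFibrant) (f : X ⟶ Y)
    (hf : Function.Surjective (StablePi.map q V ((forgetSym T).map f))) :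
    Function.Surjective (StablePi.map q V ((forgetSym T).map ((Rpow T k).map f))) := by
  induction k generalizing X Y with
  | zero => exact hf
  | succ k ih =>
    exact ih (R_levelFibrant hX) (R_levelFibrant hY) _ (R_map_surjective s hX hY f hf)

variable [HasColimitsOfShape ℕ D]

theorem Rinf_levelFibrant
    (hfib : ∀ F : ℕ ⥤ D, (∀ n, IsFibrant (F.obj n)) → IsFibrant (colimit F))
    {X : SymSpectrum T} (hX : X.LevelFibrant) : (Rinf X).LevelFibrant := fun n =>
  hfib (Rseq X ⋙ SymSpectrum.ev T n) fun k => Rpow_levelFibrant k hX n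

variable (s : CircleSign T)
  (hfib : ∀ F : ℕ ⥤ D, (∀ n, IsFibrant (F.obj n)) → IsFibrant (colimit F))
  {X : SymSpectrum T} (hX : X.LevelFibrant)

include s hfib hX

theorem Rseq_ι_injective {q : ℤ} {V : D} [IsCofibrant V]
    (hV : ∀ n, HoSeqSmall (smashPow T V n)) (k : ℕ) :
    haveI := tensorRight_preserves ℕ T
    Function.Injective
      (StablePi.map q V ((forgetSym T).map ((colimCocone (Rseq X)).ι.app k))) := by
  have := tensorRight_preserves ℕ T
  refine stablePi_map_colimCocone_injective (F := Rseq X)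
    ⟨fun k => Rpow_levelFibrant k hX, Rinf_levelFibrant hfib hX⟩ hV s (fun k => ?_) k
  rw [Rseq_map_succ]
  exact Rpow_map_injective s k hX _ (lamTilde_injective s q V X)

theorem lamTildeInf_injective {q : ℤ} {V : D} [IsCofibrant V]
    (hV : ∀ n, HoSeqSmall (smashPow T V n)) :
    Function.Injective (StablePi.map q V ((forgetSym T).map (lamTildeInf X))) :=
  Rseq_ι_injective s hfib hX hV 0

theorem lamTildeInf_surjective_iff {q : ℤ} {V : D} [IsCofibrant V]
    (hV : ∀ n, HoSeqSmall (smashPow T V n)) :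
    Function.Surjective (StablePi.map q V ((forgetSym T).map (lamTildeInf X))) ↔
      Function.Surjective (StablePi.map q V ((forgetSym T).map (lamTilde X))) := by
  have := tensorRight_preserves ℕ T
  have hw : ∀ {k l : ℕ} (φ : k ⟶ l) (x : StablePi q V ((Rseq X).obj k).toSpectrum),
      StablePi.map q V ((forgetSym T).map ((colimCocone (Rseq X)).ι.app l))
        (StablePi.map q V ((forgetSym T).map ((Rseq X).map φ)) x) =
      StablePi.map q V ((forgetSym T).map ((colimCocone (Rseq X)).ι.app k)) x := fun φ x => by
    rw [← StablePi.map_comp, ← CategoryTheory.Functor.map_comp, Cocone.w]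
  constructor
  · intro h y
    obtain ⟨x, hx⟩ := h (StablePi.map q V ((forgetSym T).map ((colimCocone (Rseq X)).ι.app 1)) y)
    refine ⟨x, Rseq_ι_injective s hfib hX hV 1 (Eq.trans ?_ hx)⟩
    have := hw (homOfLE (Nat.le_add_right 0 1)) x
    rw [Rseq_map_succ] at this
    exact this
  · intro h y
    obtain ⟨k, y, rfl⟩ := exists_stablePi_colimSpectrum (F := Rseq X)
      ⟨fun k => Rpow_levelFibrant k hX, Rinf_levelFibrant hfib hX⟩ hV y
    have hs : ∃ x, StablePi.map q V
        ((forgetSym T).map ((Rseq X).map (homOfLE (Nat.zero_le k)))) x = y := by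
      induction k with
      | zero =>
        refine ⟨y, ?_⟩
        rw [Subsingleton.elim (homOfLE (Nat.zero_le 0)) (𝟙 0), CategoryTheory.Functor.map_id,
          CategoryTheory.Functor.map_id]
        exact StablePi.map_id q V _ y
      | succ k ih =>
        have hk := Rpow_map_surjective s k hX (R_levelFibrant hX) (lamTilde X) h
        rw [← Rseq_map_succ] at hk
        obtain ⟨z, rfl⟩ := hk y
        obtain ⟨x, rfl⟩ := ih z
        refine ⟨x, ?_⟩
        rw [Subsingleton.elim (homOfLE (Nat.zero_le (k + 1)))
          (homOfLE (Nat.zero_le k) ≫ homOfLE (Nat.le_add_right k 1)),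
          CategoryTheory.Functor.map_comp, CategoryTheory.Functor.map_comp, StablePi.map_comp]
        rfl
    obtain ⟨x, rfl⟩ := hs
    exact ⟨x, (hw (homOfLE (Nat.zero_le k)) x).symm⟩

variable {B : ObjectProperty (CofibrantObject D)}
  (hB : ∀ V, B V → ∀ n, HoSeqSmall (smashPow T V.obj n))

include hB

theorem semistable_iff_piEquiv_lamTildeInf :
    Semistable B s X ↔ PiEquiv B ((forgetSym T).map (lamTildeInf X)) := by
  rw [semistable_iff_lamTilde_surjective s hX]
  refine forall_congr' fun V => forall_congr' fun hV => forall_congr' fun q => ?_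
  rw [← lamTildeInf_surjective_iff s hfib hX (hB V hV)]
  exact ⟨fun h => ⟨lamTildeInf_injective s hfib hX (hB V hV), h⟩, fun h => h.2⟩

theorem semistable_iff_semistable_Rinf :
    Semistable B s X ↔ Semistable B s (Rinf X) := by
  constructor
  · intro h
    exact h.of_surjective s (lamTildeInf X) fun V hV q =>
      ((semistable_iff_piEquiv_lamTildeInf s hfib hX hB).1 h V hV q).2
  · intro h
    exact Semistable.of_injective s (lamTildeInf X) h fun V hV q =>
      lamTildeInf_injective s hfib hX (hB V hV)

end RInfinity

/-! ### The symmetry of the functor `R ∘ R` -/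

section DoubleLoops

variable {D : Type u} [Category.{v} D] [MonoidalCategory D] [SymmetricCategory D]

theorem twistLast_twistLast (T A : D) : twistLast T A ≫ twistLast T A = 𝟙 _ := by
  simp only [twistLast, Category.assoc, Iso.inv_hom_id_assoc]
  rw [← MonoidalCategory.whiskerLeft_comp_assoc, SymmetricCategory.symmetry,
    MonoidalCategory.whiskerLeft_id, Category.id_comp, Iso.hom_inv_id]

/-- The braid relation for the symmetries of the last two and of the first two of three factors
`T`. -/
theorem twistLast_braid (T A : D) :
    twistLast T A ▷ T ≫ twistLast T (A ⊗ T) ≫ twistLast T A ▷ T =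
      twistLast T (A ⊗ T) ≫ twistLast T A ▷ T ≫ twistLast T (A ⊗ T) := by
  -- all three factors are moved to the right of `A`, where this is the Yang-Baxter equation
  have h := congrArg (A ◁ ·) (BraidedCategory.yang_baxter T T T)
  simp only [MonoidalCategory.whiskerLeft_comp] at h
  have h₁ : twistLast T A ▷ T ≫ (α_ (A ⊗ T) T T).hom ≫ (α_ A T (T ⊗ T)).hom =
      (α_ (A ⊗ T) T T).hom ≫ (α_ A T (T ⊗ T)).hom ≫ A ◁ (α_ T T T).inv ≫
        A ◁ (β_ T T).hom ▷ T ≫ A ◁ (α_ T T T).hom := by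
    simp only [twistLast]
    monoidal
  have h₂ : twistLast T (A ⊗ T) ≫ (α_ (A ⊗ T) T T).hom ≫ (α_ A T (T ⊗ T)).hom =
      (α_ (A ⊗ T) T T).hom ≫ (α_ A T (T ⊗ T)).hom ≫ A ◁ T ◁ (β_ T T).hom := by
    simp only [twistLast]
    monoidal
  rw [← cancel_mono ((α_ (A ⊗ T) T T).hom ≫ (α_ A T (T ⊗ T)).hom)]
  simp only [Category.assoc]
  rw [h₁, reassoc_of% h₂, reassoc_of% h₁, h₂, reassoc_of% h₁, reassoc_of% h₂, h]

theorem swap_mul_chi (n : ℕ) :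
    Equiv.swap (0 : Fin (n + 2)) 1 * chi (n + 1) = permOneAdd (chi n) := by
  ext i
  refine Fin.lastCases ?_ (fun i => ?_) i
  · rw [Equiv.Perm.mul_apply, chi_last, Equiv.swap_apply_left, ← Fin.succ_last, permOneAdd_succ,
      chi_last]
    rfl
  · rw [Equiv.Perm.mul_apply, chi_castSucc]
    refine Fin.cases ?_ (fun i => ?_) i
    · rw [Fin.castSucc_zero, permOneAdd_zero]
      exact congrArg Fin.val (Equiv.swap_apply_right _ _)
    · rw [Fin.castSucc_succ, permOneAdd_succ, chi_castSucc, Equiv.swap_apply_of_ne_of_ne]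
      · exact Fin.succ_ne_zero _
      · exact fun h => Fin.succ_ne_zero i (Fin.succ_injective _ h)

theorem swap_mul_permOneAdd (n : ℕ) (γ : Equiv.Perm (Fin n)) :
    Equiv.swap (0 : Fin (n + 2)) 1 * permOneAdd (permOneAdd γ) =
      permOneAdd (permOneAdd γ) * Equiv.swap (0 : Fin (n + 2)) 1 := by
  have h0 : permOneAdd (permOneAdd γ) 0 = 0 := permOneAdd_zero _
  have h1 : permOneAdd (permOneAdd γ) 1 = 1 := by
    rw [← Fin.succ_zero_eq_one, permOneAdd_succ, permOneAdd_zero]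
  rw [Equiv.mul_swap_eq_swap_mul, h0, h1]

theorem permAddOne_swap (n : ℕ) :
    permAddOne (Equiv.swap (0 : Fin (n + 2)) 1) = Equiv.swap (0 : Fin (n + 3)) 1 := by
  ext i
  refine Fin.lastCases ?_ (fun i => ?_) i
  · rw [permAddOne_last, Equiv.swap_apply_of_ne_of_ne] <;> simp [Fin.ext_iff]
  · rw [permAddOne_castSucc]
    exact congrArg Fin.val ((Fin.castSucc_injective (n + 2)).swap_apply (0 : Fin (n + 2)) 1 i).symm

theorem SymSpectrum.act_permOneAdd_swap {T : D} (X : SymSpectrum T) (n : ℕ)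
    (γ : Equiv.Perm (Fin n)) :
    X.act (n + 2) (permOneAdd (permOneAdd γ)) ≫ X.act (n + 2) (Equiv.swap 0 1) =
      X.act (n + 2) (Equiv.swap 0 1) ≫ X.act (n + 2) (permOneAdd (permOneAdd γ)) := by
  rw [← X.act_mul, ← X.act_mul, swap_mul_permOneAdd]

theorem SymSpectrum.act_swap_act_swap {T : D} (X : SymSpectrum T) (n : ℕ) :
    X.act (n + 2) (Equiv.swap 0 1) ≫ X.act (n + 2) (Equiv.swap 0 1) = 𝟙 _ := by
  rw [← X.act_mul, Equiv.swap_mul_self, X.act_one]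

variable [MonoidalClosed D]

/-- The evaluation of both variables, `(Hom(T, Hom(T, Z)) ∧ T) ∧ T ⟶ Z`. -/
def evalTwice (T Z : D) : ((ihom T).obj ((ihom T).obj Z) ⊗ T) ⊗ T ⟶ Z :=
  evalRight T ((ihom T).obj Z) ▷ T ≫ evalRight T Z

theorem curryRight_injective {T A Z : D} {f g : A ⟶ (ihom T).obj Z}
    (h : f ▷ T ≫ evalRight T Z = g ▷ T ≫ evalRight T Z) : f = g := by
  rw [← evalRight_curryRight f, h, evalRight_curryRight]

theorem evalTwice_ext {T A Z : D} {f g : A ⟶ (ihom T).obj ((ihom T).obj Z)}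
    (h : f ▷ T ▷ T ≫ evalTwice T Z = g ▷ T ▷ T ≫ evalTwice T Z) : f = g := by
  apply curryRight_injective
  apply curryRight_injective
  simpa only [comp_whiskerRight, Category.assoc, evalTwice] using h

theorem evalTwice_natural (T : D) {Z W : D} (f : Z ⟶ W) :
    (ihom T).map ((ihom T).map f) ▷ T ▷ T ≫ evalTwice T W = evalTwice T Z ≫ f := by
  rw [evalTwice, ← comp_whiskerRight_assoc, evalRight_natural, comp_whiskerRight_assoc,
    evalRight_natural, evalTwice, Category.assoc]

/-- The map `Hom(T, Hom(T, Z)) ⟶ Hom(T, Hom(T, Z))` which exchanges the two variables. -/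
def loopTwist (T Z : D) : (ihom T).obj ((ihom T).obj Z) ⟶ (ihom T).obj ((ihom T).obj Z) :=
  curryRight (curryRight (twistLast T _ ≫ evalTwice T Z))

theorem loopTwist_evalTwice (T Z : D) : loopTwist T Z ▷ T ▷ T ≫ evalTwice T Z =
    twistLast T _ ≫ evalTwice T Z := by
  conv_lhs => rw [evalTwice, loopTwist]
  rw [← comp_whiskerRight_assoc, curryRight_evalRight, curryRight_evalRight]

theorem loopTwist_loopTwist (T Z : D) : loopTwist T Z ≫ loopTwist T Z = 𝟙 _ := by
  apply evalTwice_ext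
  rw [comp_whiskerRight, comp_whiskerRight, Category.assoc, loopTwist_evalTwice,
    ← Category.assoc, twistLast_natural, Category.assoc, loopTwist_evalTwice, ← Category.assoc,
    twistLast_twistLast, id_whiskerRight, id_whiskerRight]

theorem loopTwist_natural (T : D) {Z W : D} (f : Z ⟶ W) :
    (ihom T).map ((ihom T).map f) ≫ loopTwist T W =
      loopTwist T Z ≫ (ihom T).map ((ihom T).map f) := by
  apply evalTwice_ext
  rw [comp_whiskerRight, comp_whiskerRight, comp_whiskerRight, comp_whiskerRight, Category.assoc,
    Category.assoc, loopTwist_evalTwice, ← Category.assoc, twistLast_natural, Category.assoc,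
    evalTwice_natural, ← Category.assoc, ← Category.assoc, loopTwist_evalTwice]

theorem omegaσ_omegaσ_evalTwice {T A B : D} (s : A ⊗ T ⟶ B) :
    omegaσ (omegaσ s) ▷ T ▷ T ≫ evalTwice T B =
      twistLast T _ ▷ T ≫ twistLast T _ ≫ evalTwice T A ▷ T ≫ s := by
  rw [evalTwice, ← comp_whiskerRight_assoc, omegaσ_evalRight]
  simp only [comp_whiskerRight, Category.assoc]
  rw [omegaσ_evalRight, ← Category.assoc (evalRight T _ ▷ T ▷ T), twistLast_natural,
    evalTwice, comp_whiskerRight, Category.assoc, Category.assoc]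

theorem loopTwist_omegaσ {T A B : D} (s : A ⊗ T ⟶ B) :
    omegaσ (omegaσ s) ≫ loopTwist T B = loopTwist T A ▷ T ≫ omegaσ (omegaσ s) := by
  apply evalTwice_ext
  simp only [comp_whiskerRight, Category.assoc]
  have h₁ := congrArg (· ▷ T) (twistLast_natural T (loopTwist T A))
  have h₂ := twistLast_natural T (loopTwist T A ▷ T)
  have h₃ := congrArg (· ▷ T) (loopTwist_evalTwice T A)
  simp only [comp_whiskerRight] at h₁ h₃
  rw [loopTwist_evalTwice, reassoc_of% (twistLast_natural T (omegaσ (omegaσ s))),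
    omegaσ_omegaσ_evalTwice, reassoc_of% h₁, reassoc_of% h₂, reassoc_of% h₃,
    reassoc_of% (twistLast_braid T)]

/-- The exchange of the two variables, followed by a map `b`. -/
def loopTwistMap (T : D) {Z W : D} (b : Z ⟶ W) :
    (ihom T).obj ((ihom T).obj Z) ⟶ (ihom T).obj ((ihom T).obj W) :=
  loopTwist T Z ≫ (ihom T).map ((ihom T).map b)

theorem loopTwistMap_comp (T : D) {Z W Y : D} (b : Z ⟶ W) (c : W ⟶ Y) :
    loopTwistMap T b ≫ loopTwistMap T c = (ihom T).map ((ihom T).map (b ≫ c)) := by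
  rw [loopTwistMap, loopTwistMap, ← loopTwist_natural, Category.assoc,
    reassoc_of% (loopTwist_loopTwist T W), ← Functor.map_comp, ← Functor.map_comp]

theorem loopTwistMap_natural (T : D) {Z W Z' W' : D} {b : Z ⟶ W} {b' : Z' ⟶ W'} {f : Z ⟶ Z'}
    {g : W ⟶ W'} (h : f ≫ b' = b ≫ g) :
    (ihom T).map ((ihom T).map f) ≫ loopTwistMap T b' =
      loopTwistMap T b ≫ (ihom T).map ((ihom T).map g) := by
  rw [loopTwistMap, loopTwistMap, reassoc_of% (loopTwist_natural T f), Category.assoc,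
    ← Functor.map_comp, ← Functor.map_comp, ← Functor.map_comp, ← Functor.map_comp, h]

theorem loopTwistMap_omegaσ {T A B A' B' : D} {s : A ⊗ T ⟶ B} {s' : A' ⊗ T ⟶ B'} {a : A ⟶ A'}
    {b : B ⟶ B'} (h : s ≫ b = a ▷ T ≫ s') :
    omegaσ (omegaσ s) ≫ loopTwistMap T b = loopTwistMap T a ▷ T ≫ omegaσ (omegaσ s') := by
  rw [loopTwistMap, loopTwistMap, reassoc_of% (loopTwist_omegaσ s),
    omegaσ_natural (omegaσ_natural h), comp_whiskerRight, Category.assoc]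

/-- A form of the comparison of `R λ̃_X` with `λ̃_{R X}` in which `l`, `l'` are characterized by their
adjoints: `l` is `σ` followed by `a`, and `l'` is the loops of `σ` followed by `c = a ≫ b`. -/
theorem map_loopTwistMap_eq {T A B : D} {σ : A ⊗ T ⟶ B} {l : A ⟶ (ihom T).obj B}
    {l' : (ihom T).obj A ⟶ (ihom T).obj ((ihom T).obj B)} {a b c : B ⟶ B}
    (hl : l ▷ T ≫ evalRight T B = σ ≫ a)
    (hl' : l' ▷ T ≫ evalRight T ((ihom T).obj B) = omegaσ σ ≫ (ihom T).map c)
    (h : a ≫ b = c) : (ihom T).map l ≫ loopTwistMap T b = l' := by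
  apply evalTwice_ext
  have e : (ihom T).map l ▷ T ▷ T ≫ evalTwice T B = evalRight T A ▷ T ≫ σ ≫ a := by
    rw [evalTwice, ← comp_whiskerRight_assoc, evalRight_natural, comp_whiskerRight_assoc, hl]
  have e' : l' ▷ T ▷ T ≫ evalTwice T B = twistLast T _ ≫ evalRight T A ▷ T ≫ σ ≫ c := by
    rw [evalTwice, ← comp_whiskerRight_assoc, hl', comp_whiskerRight_assoc, evalRight_natural,
      reassoc_of% (omegaσ_evalRight σ)]
  rw [e', loopTwistMap]
  simp only [comp_whiskerRight, Category.assoc]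
  rw [evalTwice_natural, reassoc_of% (loopTwist_evalTwice T B),
    reassoc_of% (twistLast_natural T ((ihom T).map l)), reassoc_of% e, h]

/-- The symmetry of `R R X = Ω Ω (sh (sh X))` which exchanges both the two loop coordinates and the
two letters that are fixed by the symmetric groups. -/
def twistRR {T : D} (X : SymSpectrum T) : (R T).obj ((R T).obj X) ⟶ (R T).obj ((R T).obj X) where
  app n := loopTwistMap T (X.act (n + 2) (Equiv.swap 0 1))
  comm n := loopTwistMap_omegaσ (T := T) (s := X.σ (n + 2)) (s' := X.σ (n + 2)) (by
    rw [X.act_σ, permAddOne_swap])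
  act_comm n γ := loopTwistMap_natural T (X.act_permOneAdd_swap n γ)

theorem twistRR_twistRR {T : D} (X : SymSpectrum T) : twistRR X ≫ twistRR X = 𝟙 _ :=
  SymSpectrum.hom_ext fun n => (loopTwistMap_comp T _ _).trans
    ((congrArg (fun f => (ihom T).map ((ihom T).map f)) (X.act_swap_act_swap n)).trans (by
      rw [CategoryTheory.Functor.map_id, CategoryTheory.Functor.map_id]
      rfl))

theorem twistRR_natural {T : D} {X Y : SymSpectrum T} (f : X ⟶ Y) :
    (R T).map ((R T).map f) ≫ twistRR Y = twistRR X ≫ (R T).map ((R T).map f) :=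
  SymSpectrum.hom_ext fun n => loopTwistMap_natural T (f.act_comm (n + 2) (Equiv.swap 0 1)).symm

theorem lamTilde_natural {T : D} {X Y : SymSpectrum T} (f : X ⟶ Y) :
    f ≫ lamTilde Y = lamTilde X ≫ (R T).map f := by
  refine SymSpectrum.hom_ext fun n => ?_
  change f.app n ≫ MonoidalClosed.curry (lamApp Y n) =
    MonoidalClosed.curry (lamApp X n) ≫ (ihom T).map (f.app (n + 1))
  rw [← MonoidalClosed.curry_natural_left, ← MonoidalClosed.curry_natural_right]
  unfold lamApp
  rw [BraidedCategory.braiding_naturality_right_assoc, Category.assoc, Category.assoc, f.act_comm,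
    ← Category.assoc (X.σ n), f.comm, Category.assoc]

theorem lamTilde_app_evalRight {T : D} (X : SymSpectrum T) (n : ℕ) :
    (lamTilde X).app n ▷ T ≫ evalRight T (X.obj (n + 1)) = X.σ n ≫ X.act (n + 1) (chi n) := by
  refine (whiskerRight_curry_evalRight _).trans ?_
  rw [lamApp, SymmetricCategory.symmetry_assoc]

/-- The maps `R λ̃_X` and `λ̃_{R X}` differ by the symmetry of `R R X`. -/
theorem R_map_lamTilde_twistRR {T : D} (X : SymSpectrum T) :
    (R T).map (lamTilde X) ≫ twistRR X = lamTilde ((R T).obj X) := by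
  exact SymSpectrum.hom_ext fun n => map_loopTwistMap_eq (T := T)
    (l' := (lamTilde ((R T).obj X)).app n) (σ := X.σ (n + 1))
    (lamTilde_app_evalRight X (n + 1)) (lamTilde_app_evalRight ((R T).obj X) n)
    (by rw [← X.act_mul, swap_mul_chi]; rfl)

end DoubleLoops

/-! ### Comparison of `R^∞` with `Θ^∞` -/

section ThetaComparison

variable {D : Type u} [Category.{v} D] [MonoidalCategory D] [SymmetricCategory D]
  [MonoidalClosed D] {T : D}

instance (X : SymSpectrum T) : IsIso (twistRR X) :=
  ⟨twistRR X, twistRR_twistRR X, twistRR_twistRR X⟩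

/-- The isomorphism `R^k R X ≅ R R^k X` which is built from the symmetries of `R R`. -/
def shuffleR : ∀ (k : ℕ) (X : SymSpectrum T),
    (Rpow T k).obj ((R T).obj X) ⟶ (R T).obj ((Rpow T k).obj X)
  | 0, _ => 𝟙 _
  | k + 1, X => (Rpow T k).map (twistRR X) ≫ shuffleR k ((R T).obj X)

instance isIso_shuffleR (k : ℕ) (X : SymSpectrum T) : IsIso (shuffleR k X) := by
  induction k generalizing X with
  | zero => exact IsIso.id _
  | succ k ih =>
    exact IsIso.comp_isIso' (inferInstanceAs (IsIso ((Rpow T k).map (twistRR X)))) (ih _)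

theorem shuffleR_natural (k : ℕ) {X Y : SymSpectrum T} (f : X ⟶ Y) :
    (Rpow T k).map ((R T).map f) ≫ shuffleR k Y =
      shuffleR k X ≫ (R T).map ((Rpow T k).map f) := by
  induction k generalizing X Y with
  | zero => exact (Category.comp_id _).trans (Category.id_comp _).symm
  | succ k ih =>
    change (Rpow T k).map ((R T).map ((R T).map f)) ≫ (Rpow T k).map (twistRR Y) ≫ shuffleR k _ =
      ((Rpow T k).map (twistRR X) ≫ shuffleR k _) ≫ (R T).map ((Rpow T k).map ((R T).map f))
    rw [← Functor.map_comp_assoc, twistRR_natural, Functor.map_comp_assoc, ih, Category.assoc]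

theorem Rpow_map_lamTilde_shuffleR (k : ℕ) (X : SymSpectrum T) :
    (Rpow T k).map (lamTilde X) ≫ shuffleR k X = lamTilde ((Rpow T k).obj X) := by
  induction k generalizing X with
  | zero => exact Category.comp_id _
  | succ k ih =>
    change (Rpow T k).map ((R T).map (lamTilde X)) ≫ (Rpow T k).map (twistRR X) ≫ shuffleR k _ = _
    rw [← Functor.map_comp_assoc, R_map_lamTilde_twistRR, ih]
    rfl

/-- The isomorphisms `R^k R X ≅ R R^k X` are compatible with the transition maps of the sequences
which define `R^∞ R X` and `R R^∞ X`. -/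
theorem shuffleR_succ (k : ℕ) (X : SymSpectrum T) :
    (Rpow T k).map (lamTilde ((R T).obj X)) ≫ shuffleR (k + 1) X =
      shuffleR k X ≫ (R T).map ((Rpow T k).map (lamTilde X)) := by
  have h : lamTilde ((R T).obj X) ≫ twistRR X = (R T).map (lamTilde X) := by
    rw [← R_map_lamTilde_twistRR, Category.assoc, twistRR_twistRR, Category.comp_id]
  change (Rpow T k).map (lamTilde ((R T).obj X)) ≫ (Rpow T k).map (twistRR X) ≫ shuffleR k _ = _
  rw [← Functor.map_comp_assoc, h, shuffleR_natural]

/-- The identification `Ω^k X_{n+k} = (R^k X)_n`. -/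
def omegaPowIso (n : ℕ) : ∀ (k : ℕ) (X : SymSpectrum T),
    (omegaPow T k).obj (X.obj (n + k)) ≅ ((Rpow T k).obj X).obj n
  | 0, _ => Iso.refl _
  | k + 1, X => omegaPowIso n k ((R T).obj X)

theorem omegaPowIso_natural (n k : ℕ) {X Y : SymSpectrum T} (f : X ⟶ Y) :
    (omegaPow T k).map (f.app (n + k)) ≫ (omegaPowIso n k Y).hom =
      (omegaPowIso n k X).hom ≫ ((Rpow T k).map f).app n := by
  induction k generalizing X Y with
  | zero => exact (Category.comp_id _).trans (Category.id_comp _).symm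
  | succ k ih => exact ih ((R T).map f)

/-- The permutation of `n + k` letters by which the maps `Ω^k σ̃` and `R^k λ̃` differ. -/
def thetaPerm (n : ℕ) : ∀ k : ℕ, Equiv.Perm (Fin (n + k))
  | 0 => 1
  | k + 1 => chi (n + k) * permAddOne (thetaPerm n k)

theorem lamTilde_app_eq (X : SymSpectrum T) (n : ℕ) :
    (lamTilde X).app n = X.σTilde n ≫ (ihom T).map (X.act (n + 1) (chi n)) := by
  change MonoidalClosed.curry (lamApp X n) = MonoidalClosed.curry _ ≫ _
  rw [← MonoidalClosed.curry_natural_right, lamApp, Category.assoc]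

theorem act_lamTilde_app (X : SymSpectrum T) (n : ℕ) (γ : Equiv.Perm (Fin n)) :
    X.act n γ ≫ (lamTilde X).app n =
      X.σTilde n ≫ (ihom T).map (X.act (n + 1) (chi n * permAddOne γ)) := by
  rw [chi_mul_permAddOne, X.act_mul, Functor.map_comp, ← Category.assoc, ← lamTilde_app_eq]
  exact (lamTilde X).act_comm n γ

/-- The isomorphism of `Ω^k X_{n+k}` with `(R^k X)_n` which is compatible with the transition maps
of the sequences that define `Θ^∞ X` and `R^∞ X`. -/
def thetaToR (X : SymSpectrum T) (n k : ℕ) :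
    (omegaPow T k).obj (X.obj (n + k)) ⟶ ((Rpow T k).obj X).obj n :=
  (omegaPow T k).map (X.act (n + k) (thetaPerm n k)) ≫ (omegaPowIso n k X).hom

instance (X : SymSpectrum T) (n : ℕ) (γ : Equiv.Perm (Fin n)) : IsIso (X.act n γ) :=
  ⟨X.act n γ⁻¹, by rw [← X.act_mul, inv_mul_cancel, X.act_one],
    by rw [← X.act_mul, mul_inv_cancel, X.act_one]⟩

instance (X : SymSpectrum T) (n k : ℕ) : IsIso (thetaToR X n k) := by
  unfold thetaToR
  infer_instance

theorem thetaToR_natural {X Y : SymSpectrum T} (f : X ⟶ Y) (n k : ℕ) :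
    (omegaPow T k).map (f.app (n + k)) ≫ thetaToR Y n k =
      thetaToR X n k ≫ ((Rpow T k).map f).app n := by
  rw [thetaToR, thetaToR, ← Functor.map_comp_assoc, ← f.act_comm, Functor.map_comp_assoc,
    omegaPowIso_natural, Category.assoc]

theorem thetaToR_succ (X : SymSpectrum T) (n k : ℕ) :
    (omegaPow T k).map (X.σTilde (n + k)) ≫ thetaToR X n (k + 1) =
      thetaToR X n k ≫ ((Rpow T k).map (lamTilde X)).app n := by
  rw [← thetaToR_natural (lamTilde X) n k]
  have h : X.σTilde (n + k) ≫ (ihom T).map (X.act (n + k + 1) (thetaPerm n (k + 1))) =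
      (lamTilde X).app (n + k) ≫ ((R T).obj X).act (n + k) (thetaPerm n k) :=
    (act_lamTilde_app X (n + k) (thetaPerm n k)).symm.trans ((lamTilde X).act_comm _ _)
  have h' : ∀ {A B C C' E : D} {f : A ⟶ B} {g : B ⟶ C} {f' : A ⟶ C'} {g' : C' ⟶ C}
      (h : f ≫ g = f' ≫ g') (e : (omegaPow T k).obj C ⟶ E), (omegaPow T k).map f ≫
        (omegaPow T k).map g ≫ e = (omegaPow T k).map f' ≫ (omegaPow T k).map g' ≫ e :=
    fun h e => by rw [← Functor.map_comp_assoc, h, Functor.map_comp_assoc]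
  exact h' h (omegaPowIso n k ((R T).obj X)).hom

/-! ### When `R^∞ X` is an `Ω`-spectrum -/

/-- The isomorphism between the sequences that define `(Θ^∞ X)_n` and `(R^∞ X)_n`. -/
def thetaSeqToR (X : SymSpectrum T) (n : ℕ) :
    thetaSeq X.toSpectrum n ⟶ Rseq X ⋙ SymSpectrum.ev T n :=
  NatTrans.ofSequence (F := thetaSeq X.toSpectrum n) (G := Rseq X ⋙ SymSpectrum.ev T n)
    (fun k => thetaToR X n k) fun k => by
      rw [thetaSeq_map_succ, Functor.comp_map, Rseq_map_succ]
      exact thetaToR_succ X n k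

/-- The maps `λ̃` of the spectra `R^k X` in degree `n`. -/
def lamTildeSeq (X : SymSpectrum T) (n : ℕ) :
    Rseq X ⋙ SymSpectrum.ev T n ⟶ (Rseq X ⋙ SymSpectrum.ev T (n + 1)) ⋙ ihom T where
  app k := (lamTilde ((Rseq X).obj k)).app n
  naturality _ _ f := congrArg (fun g => SymSpectrum.Hom.app g n) (lamTilde_natural ((Rseq X).map f))

/-- The isomorphism between the sequences that define `(R^∞ R X)_n` and `(R R^∞ X)_n`. -/
def shuffleSeq (X : SymSpectrum T) (n : ℕ) :
    Rseq ((R T).obj X) ⋙ SymSpectrum.ev T n ⟶ (Rseq X ⋙ SymSpectrum.ev T (n + 1)) ⋙ ihom T :=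
  NatTrans.ofSequence (F := Rseq ((R T).obj X) ⋙ SymSpectrum.ev T n)
    (G := (Rseq X ⋙ SymSpectrum.ev T (n + 1)) ⋙ ihom T)
    (fun k => (shuffleR k X).app n) fun k => by
      rw [Functor.comp_map, Functor.comp_map, Functor.comp_map, Rseq_map_succ, Rseq_map_succ]
      exact congrArg (fun g => SymSpectrum.Hom.app g n) (shuffleR_succ k X)

instance (X : SymSpectrum T) (n : ℕ) : IsIso (thetaSeqToR X n) := by
  have (k : ℕ) : IsIso ((thetaSeqToR X n).app k) := inferInstanceAs (IsIso (thetaToR X n k))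
  exact NatIso.isIso_of_isIso_app _

instance (X : SymSpectrum T) (n : ℕ) : IsIso (shuffleSeq X n) := by
  have (k : ℕ) : IsIso ((shuffleSeq X n).app k) :=
    inferInstanceAs (IsIso ((SymSpectrum.ev T n).map (shuffleR k X)))
  exact NatIso.isIso_of_isIso_app _

theorem thetaSeqMap_lamTilde (X : SymSpectrum T) (n : ℕ) :
    thetaSeqMap ((forgetSym T).map (lamTilde X)) n ≫ thetaSeqToR ((R T).obj X) n ≫
      shuffleSeq X n = thetaSeqToR X n ≫ lamTildeSeq X n := by
  ext k
  have h := congrArg (fun g => SymSpectrum.Hom.app g n) (Rpow_map_lamTilde_shuffleR k X)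
  change (omegaPow T k).map ((lamTilde X).app (n + k)) ≫ thetaToR ((R T).obj X) n k ≫
    (shuffleR k X).app n = thetaToR X n k ≫ (lamTilde ((Rpow T k).obj X)).app n
  rw [← Category.assoc, thetaToR_natural, Category.assoc]
  exact congrArg _ h

theorem isOmega_of_weakEquivalence_lamTilde [ModelCategory D] {X : SymSpectrum T} (hX : X.LevelFibrant)
    (h : ∀ n, WeakEquivalence ((lamTilde X).app n)) : X.IsOmega := by
  refine ⟨hX, fun n => ?_⟩
  have : WeakEquivalence (X.σTilde n ≫ (ihom T).map (X.act (n + 1) (chi n))) :=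
    lamTilde_app_eq X n ▸ h n
  exact weakEquivalence_of_postcomp _ ((ihom T).map (X.act (n + 1) (chi n)))

variable [HasColimitsOfShape ℕ D]

/-- The map `λ̃` of `R^∞ X` is the colimit of the maps `λ̃` of the spectra `R^k X`. -/
theorem colimMap_lamTildeSeq (X : SymSpectrum T) (n : ℕ) :
    colimMap (lamTildeSeq X n) ≫ colimit.post (Rseq X ⋙ SymSpectrum.ev T (n + 1)) (ihom T) =
      (lamTilde (Rinf X)).app n := by
  have := tensorRight_preserves ℕ T
  refine colimit.hom_ext fun k => ?_
  rw [ι_colimMap_assoc, colimit.ι_post]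
  exact (congrArg (fun g => SymSpectrum.Hom.app g n)
    (lamTilde_natural ((colimCocone (Rseq X)).ι.app k))).symm

variable [ModelCategory D]

/-- If `Hom(T, -)` preserves sequential colimits, the map `λ̃` of `R^∞ X` is, up to isomorphisms,
the map `Θ^∞ λ̃_X`. Hence `R^∞ X` is an `Ω`-spectrum if the latter is a level equivalence. -/
theorem weakEquivalence_lamTilde_Rinf [PreservesColimitsOfShape ℕ (ihom T)] {X : SymSpectrum T}
    (h : ThetaLevelEquiv ((forgetSym T).map (lamTilde X))) (n : ℕ) :
    WeakEquivalence ((lamTilde (Rinf X)).app n) := by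
  have hcomp : ∀ {F G H : ℕ ⥤ D} (α : F ⟶ G) (β : G ⟶ H),
      colimMap (α ≫ β) = colimMap α ≫ colimMap β := fun α β => by ext; simp
  have hiso : ∀ {F G : ℕ ⥤ D} (α : F ⟶ G) [IsIso α], IsIso (colimMap α) := fun α _ =>
    (HasColimit.isoOfNatIso (asIso α)).isIso_hom
  have e := congrArg colimMap (thetaSeqMap_lamTilde X n)
  rw [hcomp, hcomp, hcomp] at e
  have := hiso (thetaSeqToR X n)
  have := hiso (thetaSeqToR ((R T).obj X) n)
  have := hiso (shuffleSeq X n)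
  have h₁ : WeakEquivalence (colimMap (thetaSeqMap ((forgetSym T).map (lamTilde X)) n)) := h n
  have h₂ : WeakEquivalence (colimMap (thetaSeqToR X n) ≫ colimMap (lamTildeSeq X n)) := by
    rw [← e]
    infer_instance
  have := weakEquivalence_of_precomp (colimMap (thetaSeqToR X n)) (colimMap (lamTildeSeq X n))
  have : IsIso (colimit.post (Rseq X ⋙ SymSpectrum.ev T (n + 1)) (ihom T)) := inferInstance
  have hcomp : ∀ {A B C : D} (f : A ⟶ B) (g : B ⟶ C) [WeakEquivalence f] [IsIso g],
      WeakEquivalence (f ≫ g) := fun _ _ _ _ => inferInstance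
  exact (colimMap_lamTildeSeq X n) ▸ hcomp (colimMap (lamTildeSeq X n))
    (colimit.post (Rseq X ⋙ SymSpectrum.ev T (n + 1)) (ihom T))

end ThetaComparison

/-! ### Level equivalences and level fibrant replacements -/

section LevelEquivalences

variable {D : Type u} [Category.{v} D] [MonoidalCategory D] [ModelCategory D]
  {T : D} [IsCircle T]

theorem stablePi_map_bijective_of_levelEquivalence (q : ℤ) (V : D) {X Y : Spectrum T} (f : X ⟶ Y)
    (hf : levelEquivalences T f) : Function.Bijective (StablePi.map q V f) := by
  have (n : ℕ) : IsIso ((toHo D).map (f.app n)) := isIso_toHo_map _ (hf := hf n)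
  let g (r : StableRep q V Y) : StableRep q V X :=
    ⟨r.level, r.dim, r.dim_eq, r.map ≫ inv ((toHo D).map (f.app r.level))⟩
  have hg (r : StableRep q V Y) : (g r).comp f = r := by
    have h : (r.map ≫ inv ((toHo D).map (f.app r.level))) ≫ (toHo D).map (f.app r.level) = r.map := by
      rw [Category.assoc, IsIso.inv_hom_id, Category.comp_id]
    exact congrArg (StableRep.mk r.level r.dim r.dim_eq) h
  have hg' (r : StableRep q V X) : g (r.comp f) = r := by
    have h : (r.map ≫ (toHo D).map (f.app r.level)) ≫ inv ((toHo D).map (f.app r.level)) = r.map := by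
      rw [Category.assoc, IsIso.hom_inv_id, Category.comp_id]
    exact congrArg (StableRep.mk r.level r.dim r.dim_eq) h
  refine Function.bijective_iff_has_inverse.2 ⟨Quot.map g fun r _ h => ?_, fun x => ?_, fun y => ?_⟩
  · rw [h, ← hg' (g r).stab, StableRep.comp_stab, hg]
  · exact Quot.inductionOn x fun r => congrArg (Quot.mk _) (hg' r)
  · exact Quot.inductionOn y fun r => congrArg (Quot.mk _) (hg r)

theorem PiEquiv.comp {B : ObjectProperty (CofibrantObject D)} {X Y Z : Spectrum T} {f : X ⟶ Y} {g : Y ⟶ Z} (hf : PiEquiv B f)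
    (hg : PiEquiv B g) : PiEquiv B (f ≫ g) := by
  intro V hV q
  have h : StablePi.map q V.obj (f ≫ g) = StablePi.map q V.obj g ∘ StablePi.map q V.obj f :=
    funext (StablePi.map_comp q V.obj f g)
  exact h ▸ (hg V hV q).comp (hf V hV q)

end LevelEquivalences

section FibrantReplacement

variable {D : Type u} [Category.{v} D] [MonoidalCategory D] [ModelCategory D] [SymmetricCategory D]

/-- The symmetric spectrum all of whose levels are terminal. -/
noncomputable def terminalSpectrum (T : D) : SymSpectrum T where
  obj _ := ⊤_ D
  σ _ := terminal.from _
  act _ _ := 𝟙 _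
  act_one _ := rfl
  act_mul _ _ _ := terminal.hom_ext _ _
  act_σ _ _ := terminal.hom_ext _ _
  twist_σ _ := terminal.hom_ext _ _

/-- The map to the symmetric spectrum all of whose levels are terminal. -/
noncomputable def toTerminalSpectrum {T : D} (X : SymSpectrum T) : X ⟶ terminalSpectrum T where
  app _ := terminal.from _
  comm _ := terminal.hom_ext _ _
  act_comm _ _ := terminal.hom_ext _ _

theorem exists_levelFibrant_replacement {T : D} (hM : HasSymProjectiveLevelStructure T)
    (X : SymSpectrum T) : ∃ (Y : SymSpectrum T) (f : X ⟶ Y), Y.LevelFibrant ∧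
      levelEquivalences T ((forgetSym T).map f) := by
  obtain ⟨M, hW, hF⟩ := hM
  have F := MorphismProperty.factorizationData (trivialCofibrations (SymSpectrum T))
    (fibrations (SymSpectrum T)) (toTerminalSpectrum X)
  have hi : (weakEquivalences (SymSpectrum T)) F.i := F.hi.2
  have hp : (fibrations (SymSpectrum T)) F.p := F.hp
  have hi' : (levelEquivalences T).inverseImage (forgetSym T) F.i := hW ▸ hi
  have hp' : (levelFibrations T).inverseImage (forgetSym T) F.p := hF ▸ hp
  refine ⟨F.Z, F.i, fun n => ?_, hi'⟩
  exact (isFibrant_iff_of_isTerminal (F.p.app n) terminalIsTerminal).2 (hp' n)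

end FibrantReplacement

/-! ### Stable equivalences to `Ω`-spectra -/

section OmegaSpectra

variable {D : Type u} [Category.{v} D] [MonoidalCategory D] [ModelCategory D]
  [SymmetricCategory D] [MonoidalClosed D] [MonoidalModel D] {T : D} [IsCircle T]
  (s : CircleSign T) {B : ObjectProperty (CofibrantObject D)}

theorem semistable_of_exists_isOmega {X : SymSpectrum T}
    (h : ∃ (Y : SymSpectrum T) (f : X ⟶ Y), Y.IsOmega ∧ PiEquiv B ((forgetSym T).map f)) :
    Semistable B s X := by
  obtain ⟨Y, f, hY, hf⟩ := h
  exact Semistable.of_injective s f (semistable_of_isOmega s hY) fun V hV q => (hf V hV q).1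

variable [HasColimitsOfShape ℕ D] [PreservesColimitsOfShape ℕ (ihom T)]

/-- For level fibrant `X`, the map `λ̃_X` is its own level fibrant replacement. Hence if it is a
`π^B`-stable equivalence, it is detected by `Θ^∞`, and `Θ^∞ λ̃_X` is `λ̃` of `R^∞ X`. -/
theorem isOmega_Rinf_of_semistable
    (hfib : ∀ F : ℕ ⥤ D, (∀ n, IsFibrant (F.obj n)) → IsFibrant (colimit F))
    (hΘ : ThetaDetectsStableEquiv T)
    (hπ : ∀ {Y Z : Spectrum T} (f : Y ⟶ Z), PiEquiv B f ↔ StableEquiv f)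
    {X : SymSpectrum T} (hX : X.LevelFibrant) (h : Semistable B s X) : (Rinf X).IsOmega := by
  have h₁ : StableEquiv ((forgetSym T).map (lamTilde X)) :=
    (hπ _).1 ((semistable_iff_piEquiv_lamTilde s hX).1 h)
  have hid (Y : Spectrum T) : levelEquivalences T (𝟙 Y) := fun n =>
    inferInstanceAs (WeakEquivalence (𝟙 (Y.obj n)))
  have h₂ : ThetaLevelEquiv ((forgetSym T).map (lamTilde X)) := (hΘ _).1.1 h₁ _
    ⟨hX, R_levelFibrant hX, 𝟙 _, 𝟙 _, hid _, hid _,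
      (Category.id_comp _).trans (Category.comp_id _).symm⟩
  exact isOmega_of_weakEquivalence_lamTilde (Rinf_levelFibrant hfib hX)
    (weakEquivalence_lamTilde_Rinf h₂)

theorem semistable_iff_isOmega_Rinf
    (hfib : ∀ F : ℕ ⥤ D, (∀ n, IsFibrant (F.obj n)) → IsFibrant (colimit F))
    (hB : ∀ V, B V → ∀ n, HoSeqSmall (smashPow T V.obj n))
    (hΘ : ThetaDetectsStableEquiv T)
    (hπ : ∀ {Y Z : Spectrum T} (f : Y ⟶ Z), PiEquiv B f ↔ StableEquiv f)
    {X : SymSpectrum T} (hX : X.LevelFibrant) : Semistable B s X ↔ (Rinf X).IsOmega :=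
  ⟨isOmega_Rinf_of_semistable s hfib hΘ hπ hX, fun h =>
    (semistable_iff_semistable_Rinf s hfib hX hB).2 (semistable_of_isOmega s h)⟩

/-- The `Ω`-spectrum is `R^∞` of a level fibrant replacement of `X`. -/
theorem semistable_iff_exists_isOmega
    (hfib : ∀ F : ℕ ⥤ D, (∀ n, IsFibrant (F.obj n)) → IsFibrant (colimit F))
    (hB : ∀ V, B V → ∀ n, HoSeqSmall (smashPow T V.obj n))
    (hΘ : ThetaDetectsStableEquiv T) (hM : HasSymProjectiveLevelStructure T)
    (hπ : ∀ {Y Z : Spectrum T} (f : Y ⟶ Z), PiEquiv B f ↔ StableEquiv f) {X : SymSpectrum T} :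
    Semistable B s X ↔
      ∃ (Y : SymSpectrum T) (f : X ⟶ Y), Y.IsOmega ∧ PiEquiv B ((forgetSym T).map f) := by
  refine ⟨fun h => ?_, semistable_of_exists_isOmega s⟩
  obtain ⟨Y, f, hY, hf⟩ := exists_levelFibrant_replacement hM X
  have hfπ : PiEquiv B ((forgetSym T).map f) := fun V _ q =>
    stablePi_map_bijective_of_levelEquivalence q V.obj _ hf
  have hYs : Semistable B s Y := h.of_surjective s f fun V hV q => (hfπ V hV q).2
  exact ⟨Rinf Y, f ≫ lamTildeInf Y, isOmega_Rinf_of_semistable s hfib hΘ hπ hY hYs,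
    hfπ.comp ((semistable_iff_piEquiv_lamTildeInf s hfib hY hB).1 hYs)⟩

end OmegaSpectra

end SemistableSpectra

theorem theorem2p22
    {D : Type u} [Category.{v} D] [MonoidalCategory D] [SymmetricCategory D] [MonoidalClosed D]
    [HasZeroObject D] [ModelCategory D] [SemistableSpectra.MonoidalModel D]
    [HasColimitsOfShape ℕ D]
    (T : D) [SemistableSpectra.IsCircle T] (s : SemistableSpectra.CircleSign T)
    (i : SemistableSpectra.PointedSSet.{w} ⥤ D) [i.Monoidal]
    (j : D ⥤ SemistableSpectra.PointedSSet.{w}) (_adj : i ⊣ j)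
    (_hij : SemistableSpectra.IsLeftQuillenPair i j)
    (B : ObjectProperty (CofibrantObject D))
    (_hfib : ∀ F : ℕ ⥤ D, (∀ n, IsFibrant (F.obj n)) → IsFibrant (colimit F))
    [PreservesColimitsOfShape ℕ j] [PreservesColimitsOfShape ℕ (ihom T)]
    (_hB : ∀ A, B A → PreservesColimitsOfShape ℕ (ihom A.obj))
    (X : SemistableSpectra.SymSpectrum T) :
    -- semistability and surjectivity of the cycle operator
    (SemistableSpectra.Semistable B s X ↔ SemistableSpectra.CycleSurjective B s X) ∧
    -- semistability and the map from `T ∧ X` to the shift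
    (SemistableSpectra.Semistable B s X ↔
      SemistableSpectra.PiEquiv B
        ((SemistableSpectra.forgetSym T).map (SemistableSpectra.lam X))) ∧
    -- semistability and the comparison map to the true homotopy groups
    (SemistableSpectra.Semistable B s X ↔
      ∀ V, B V → ∀ q : ℤ,
        Function.Bijective (SemistableSpectra.trueMap B s q V.obj X)) ∧
    -- the three further conditions for level fibrant `X`
    (X.LevelFibrant →
      (SemistableSpectra.Semistable B s X ↔
        SemistableSpectra.PiEquiv B
          ((SemistableSpectra.forgetSym T).map (SemistableSpectra.lamTilde X))) ∧
      (SemistableSpectra.Semistable B s X ↔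
        SemistableSpectra.PiEquiv B
          ((SemistableSpectra.forgetSym T).map (SemistableSpectra.lamTildeInf X))) ∧
      (SemistableSpectra.Semistable B s X ↔
        SemistableSpectra.Semistable B s (SemistableSpectra.Rinf X))) ∧
    -- maps to `Ω`-spectra, under the additional hypotheses on level and stable equivalences
    (SemistableSpectra.HasProjectiveLevelStructure T →
      SemistableSpectra.ThetaDetectsStableEquiv T →
      SemistableSpectra.StableEquivCountableComp T →
      SemistableSpectra.HasSymProjectiveLevelStructure T →
      (∀ {Y Z : SemistableSpectra.Spectrum T} (f : Y ⟶ Z),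
        SemistableSpectra.PiEquiv B f ↔ SemistableSpectra.StableEquiv f) →
      (SemistableSpectra.Semistable B s X ↔
        ∃ (Y : SemistableSpectra.SymSpectrum T) (f : X ⟶ Y), Y.IsOmega ∧
          SemistableSpectra.PiEquiv B ((SemistableSpectra.forgetSym T).map f)) ∧
      (X.LevelFibrant →
        (SemistableSpectra.Semistable B s X ↔ (SemistableSpectra.Rinf X).IsOmega))) ∧
    -- the implications which need no additional hypotheses
    ((∃ (Y : SemistableSpectra.SymSpectrum T) (f : X ⟶ Y), Y.IsOmega ∧
        SemistableSpectra.PiEquiv B ((SemistableSpectra.forgetSym T).map f)) →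
      SemistableSpectra.Semistable B s X) ∧
    ((SemistableSpectra.Rinf X).IsOmega →
      SemistableSpectra.Semistable B s (SemistableSpectra.Rinf X)) := by
  have hB (V : CofibrantObject D) (hV : B V) (n : ℕ) :
      SemistableSpectra.HoSeqSmall (SemistableSpectra.smashPow T V.obj n) := by
    have := _hB V hV
    have := SemistableSpectra.preservesColimits_ihom_smashPow T V.obj n
    exact SemistableSpectra.hoSeqSmall_of_preservesColimits _adj _hij _
  exact ⟨SemistableSpectra.semistable_iff_cycleSurjective s,
    SemistableSpectra.semistable_iff_piEquiv_lam s,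
    SemistableSpectra.semistable_iff_trueMap_bijective s,
    fun hX => ⟨SemistableSpectra.semistable_iff_piEquiv_lamTilde s hX,
      SemistableSpectra.semistable_iff_piEquiv_lamTildeInf s _hfib hX hB,
      SemistableSpectra.semistable_iff_semistable_Rinf s _hfib hX hB⟩,
    fun _ hΘ _ hM hπ => ⟨SemistableSpectra.semistable_iff_exists_isOmega s _hfib hB hΘ hM hπ,
      SemistableSpectra.semistable_iff_isOmega_Rinf s _hfib hB hΘ hπ⟩,
    SemistableSpectra.semistable_of_exists_isOmega s,
    SemistableSpectra.semistable_of_isOmega s⟩
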